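/- **Conventions.** Let $U\subseteq\mathbb R^m$ be finite. An input is a piecewise-constant function $u=(\alpha_1,t_1)\cdots(\alpha_k,t_k)$ ($\alpha_i\in U$, $t_i\ge 0$) of duration $T_u=\sum_i t_i$; $uv$ denotes concatenation. A set $S$ of inputs is *admissible* if (i) $u\in S$, $0\le t\le T_u$ imply $u|_{[0,t]}\in S$; (ii) for $u\in S$, $\alpha\in U$ there is $t>0$ with $u(\alpha,t)\in S$; (iii) for $u=(\alpha_1,t_1)\cdots(\alpha_k,t_k)\in S$ there is $\delta>0$ with $(\alpha_1,\bar t_1)\cdots(\alpha_k,\bar t_k)\in S$ whenever $0\le\bar t_i\le t_i+\delta$ for all $i$. A *response map* is a map $p:S\to\mathbb R^r$ on a non-empty admissible set such that $(t_1,\dots,t_k)\mapsto p((\alpha_1,t_1)\cdots(\alpha_k,t_k))$ is analytic on its domain for all $\alpha_1,\dots,\alpha_k\in U$. For $u\in S$ the map $p_u(v)=p(uv)$ is defined for $v\in S$ with $uv\in S$. A *Nash function* on an open semi-algebraic set $X$ is an analytic semi-algebraic function $X\to\mathbb R$; these form the ring $\mathcal N(X)$. A *Nash system* $\Sigma=(X,f,h,x_0)$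 consists of an open connected semi-algebraic set $X\subseteq\mathbb R^n$, maps $f_\alpha:X\to\mathbb R^n$ ($\alpha\in U$) and $h:X\to\mathbb R^r$ with Nash components, and $x_0\in X$. Its trajectory $x_\Sigma(\cdot;x_0,u):[0,T_u]\to X$ solves $\dot x=f_{u(t)}(x)$, $x(0)=x_0$. Let $\mathcal U(\Sigma)$ be the largest admissible set of inputs $u$ for which there is a unique trajectory on $[0,T_u]$, and $\mathcal R(x_0)=\{x_\Sigma(T_u;x_0,u): u\in\mathcal U(\Sigma)\}$. $\Sigma$ is a *local Nash realization* of $p:S\to\mathbb R^r$ if $p(u)=h(x_\Sigma(T_u;x_0,u))$ for all $u\in S\cap\mathcal U(\Sigma)$. $\Sigma$ is *semi-algebraically reachable* if every $g\in\mathcal N(X)$ vanishing on $\mathcal R(x_0)$ is $0$. The *observation algebra* $A_{obs}(\Sigma)$ is the smallest subalgebra of $\mathcal N(X)$ that contains the components of $h$ and is closed under the Lie derivatives $g\mapsto f_\alpha g$, $\alpha\in U$. $\Sigma$ is *semi-algebraically observable* if $\operatorname{trdeg}A_{obs}(\Sigma)=\operatorname{trdeg}\mathcal N(X)$ (over $\mathbb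 R$). **Theorem.** Let $\Sigma=(X,f,h,x_0)$ be a semi-algebraically reachable local Nash realization of a response map $p:S\to\mathbb R^r$ with finite set $U$ of input values. Then the following procedure is correct: each step can be carried out, whatever choices were made in the earlier steps, and step 5 always returns a system with the stated properties. 1. Choose a (finite) transcendence basis $\varphi_1,\dots,\varphi_d\in A_{obs}(\Sigma)$ of $A_{obs}(\Sigma)$ over $\mathbb R$; put $\Phi=(\varphi_1,\dots,\varphi_d)$. 2. For $\alpha\in U$, $i\le d$, $j\le r$ choose non-zero polynomials $Q_{\alpha,i},P_j\in\mathbb R[T,T_1,\dots,T_d]$, of the smallest possible degree in $T$, with $Q_{\alpha,i}(f_\alpha\varphi_i,\Phi)=0$ and $P_j(h_j,\Phi)=0$ on $X$. 3. Given $\varepsilon>0$, choose $u\in S\cap\mathcal U(\Sigma)$ with $T_u<\varepsilon$ such that, with $\bar x=x_\Sigma(T_u;x_0,u)$, the functions $\frac{dQ_{\alpha,i}}{dT}(f_\alpha\varphi_i,\Phi)$ and $\frac{dP_j}{dT}(h_j,\Phi)$ have no zeros on some open neighbourhood of $\bar x$. 4. Choose open connected semi-algebraic sets $W_{\alpha,i},W_j\subseteq\mathbb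 R$ and $V_{\alpha,i},V_j\subseteq\mathbb R^d$ and Nash maps $\psi_{\alpha,i}:V_{\alpha,i}\to W_{\alpha,i}$, $\psi_j:V_j\to W_j$ such that: $f_\alpha\varphi_i(\bar x)\in W_{\alpha,i}$, $\Phi(\bar x)\in V_{\alpha,i}$, $\psi_{\alpha,i}(\Phi(\bar x))=f_\alpha\varphi_i(\bar x)$, and for all $x\in X$ with $(f_\alpha\varphi_i(x),\Phi(x))\in W_{\alpha,i}\times V_{\alpha,i}$ one has $Q_{\alpha,i}(f_\alpha\varphi_i(x),\Phi(x))=0\iff f_\alpha\varphi_i(x)=\psi_{\alpha,i}(\Phi(x))$; the same holds with $h_j,P_j,W_j,V_j,\psi_j$ in place of $f_\alpha\varphi_i,Q_{\alpha,i},W_{\alpha,i},V_{\alpha,i},\psi_{\alpha,i}$; and $V:=\bigcap_{\alpha,i}V_{\alpha,i}\cap\bigcap_jV_j\subseteq\mathbb R^d$ is connected. 5. Return $\Sigma_V=(V,f^V,h^V,\Phi(\bar x))$ with $f^V_\alpha=(\psi_{\alpha,1},\dots,\psi_{\alpha,d})$ and $h^V=(\psi_1,\dots,\psi_r)$ on $V$.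 Then $\Sigma_V$ is a local Nash realization of $p_u$ which is both semi-algebraically reachable and semi-algebraically observable. In particular, for every $\varepsilon>0$ there is $u\in S\cap\mathcal U(\Sigma)$ with $T_u<\varepsilon$ such that $p_u$ has a semi-algebraically reachable and semi-algebraically observable local Nash realization. -/

import Mathlib

open scoped NNReal Topology

noncomputable section

namespace NashSys

/-! ### Semi-algebraic sets and Nash functions -/

/-- A subset of `ℝ^ι` is semi-algebraic if it is a finite union of sets given by finitely many
polynomial equations `P = 0` and strict inequalities `Q > 0`. -/
def IsSemialgebraic {ι : Type} (A : Set (ι → ℝ)) : Prop :=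
  ∃ F : Finset (Finset (MvPolynomial ι ℝ) × Finset (MvPolynomial ι ℝ)),
    A = {x | ∃ c ∈ F, (∀ P ∈ c.1, MvPolynomial.eval x P = 0) ∧
      (∀ Q ∈ c.2, 0 < MvPolynomial.eval x Q)}

/-- The real function `g` restricted to `X ⊆ ℝ^n` is semi-algebraic: its graph is a semi-algebraic
subset of `ℝ^(n+1)`. -/
def IsSemialgebraicFunOn {n : ℕ} (X : Set (Fin n → ℝ)) (g : (Fin n → ℝ) → ℝ) : Prop :=
  IsSemialgebraic {y : Fin (n + 1) → ℝ | Fin.init y ∈ X ∧ y (Fin.last n) = g (Fin.init y)}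

/-- `g` restricted to the (open semi-algebraic) set `X` is a Nash function. The values of `g`
outside `X` are irrelevant. -/
def IsNashOn {n : ℕ} (X : Set (Fin n → ℝ)) (g : (Fin n → ℝ) → ℝ) : Prop :=
  AnalyticOnNhd ℝ g X ∧ IsSemialgebraicFunOn X g

/-- The ring `N(X)` of Nash functions, as an algebra of functions on `X`. Nash functions on an open
semi-algebraic set are closed under the ring operations and contain the constants, so the algebra
that they generate consists of Nash functions only. -/
def nashAlgebra {n : ℕ} (X : Set (Fin n → ℝ)) : Subalgebra ℝ (X → ℝ) :=
  Algebra.adjoin ℝ {g | ∃ G : (Fin n → ℝ) → ℝ, IsNashOn X G ∧ g = fun x : X => G x}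

/-! ### Piecewise-constant inputs -/

section Inputs

variable {A : Type}

/-- A switching word `(α₁,t₁)⋯(α_k,t_k)` with input values in `A`, which describes a
piecewise-constant input. The empty input is `[]` and concatenation of inputs is `++`. -/
abbrev Input (A : Type) : Type := List (A × ℝ≥0)

/-- The duration `T_u = t₁ + ⋯ + t_k`. -/
def duration : Input A → ℝ
  | [] => 0
  | (_, t) :: w => (t : ℝ) + duration w

/-- The piecewise-constant function `[0, T_u) → A` that a switching word describes
(`none` for times `≥ T_u`). -/
def value : Input A → ℝ → Option A
  | [], _ => none
  | (a, t) :: w, s => if s < (t : ℝ) then some a else value w (s - t)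

/-- Two switching words describe the same piecewise-constant function (in particular they have the
same duration). -/
def SameInput (u v : Input A) : Prop := ∀ s : ℝ, 0 ≤ s → value u s = value v s

/-- The restriction `u_{[0,s]}` of an input to the time interval `[0,s]`. -/
def truncate : Input A → ℝ≥0 → Input A
  | [], _ => []
  | (a, t) :: w, s => if s ≤ t then [(a, s)] else (a, t) :: truncate w (s - t)

/-- Admissible sets of inputs. A set of inputs is a set of switching words that does not
distinguish between words describing the same input (`saturated`). -/
structure IsAdmissible (S : Set (Input A)) : Prop where
  saturated : ∀ u v, SameInput u v → u ∈ S → v ∈ S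
  restrict : ∀ u ∈ S, ∀ s : ℝ≥0, (s : ℝ) ≤ duration u → truncate u s ∈ S
  extend : ∀ u ∈ S, ∀ a : A, ∃ t : ℝ≥0, 0 < t ∧ u ++ [(a, t)] ∈ S
  perturb : ∀ u ∈ S, ∃ δ : ℝ≥0, 0 < δ ∧ ∀ v : Input A,
    List.Forall₂ (fun q q' => q'.1 = q.1 ∧ q'.2 ≤ q.2 + δ) u v → v ∈ S

/-- The input with values `α₁,…,α_k` and switching times `t₁,…,t_k` (used for `t_i ≥ 0`). -/
def word {k : ℕ} (α : Fin k → A) (t : Fin k → ℝ) : Input A :=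
  List.ofFn fun i => (α i, (t i).toNNReal)

/-- `p`, restricted to `S`, is a response map with domain the admissible set `S`.
The values of `p` outside `S` are irrelevant. -/
structure IsResponseMap {r : ℕ} (S : Set (Input A)) (p : Input A → Fin r → ℝ) : Prop where
  admissible : IsAdmissible S
  congr : ∀ u ∈ S, ∀ v ∈ S, SameInput u v → p u = p v
  analytic : ∀ (k : ℕ) (α : Fin k → A),
    AnalyticOn ℝ (fun t : Fin k → ℝ => p (word α t))
      {t | (∀ i, 0 ≤ t i) ∧ word α t ∈ S}

/-- The domain `{v ∈ S | uv ∈ S}` of the shifted response map `p_u`. -/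
def shiftDomain (S : Set (Input A)) (u : Input A) : Set (Input A) := {v | v ∈ S ∧ u ++ v ∈ S}

/-- The shifted response map `p_u(v) = p(uv)`. -/
def shift {r : ℕ} (p : Input A → Fin r → ℝ) (u : Input A) : Input A → Fin r → ℝ :=
  fun v => p (u ++ v)

/-- A union of admissible sets of inputs is admissible. -/
theorem isAdmissible_sUnion {C : Set (Set (Input A))} (hC : ∀ S ∈ C, IsAdmissible S) :
    IsAdmissible (⋃₀ C) where
  saturated := by
    rintro u v h ⟨S, hS, hu⟩
    exact ⟨S, hS, (hC S hS).saturated u v h hu⟩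
  restrict := by
    rintro u ⟨S, hS, hu⟩ s hs
    exact ⟨S, hS, (hC S hS).restrict u hu s hs⟩
  extend := by
    rintro u ⟨S, hS, hu⟩ a
    obtain ⟨t, ht, h⟩ := (hC S hS).extend u hu a
    exact ⟨t, ht, S, hS, h⟩
  perturb := by
    rintro u ⟨S, hS, hu⟩
    obtain ⟨δ, hδ, h⟩ := (hC S hS).perturb u hu
    exact ⟨δ, hδ, fun v hv => ⟨S, hS, h v hv⟩⟩

end Inputs

/-! ### Nash systems -/

/-- The data `(X, f, h, x₀)` of a control system with input values in `A`, state-space in `ℝ^n` and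
outputs in `ℝ^r`. Only the values of `f α` and `h` on `X` matter. -/
structure ControlSystem (A : Type) (n r : ℕ) where
  X : Set (Fin n → ℝ)
  f : A → (Fin n → ℝ) → (Fin n → ℝ)
  h : (Fin n → ℝ) → (Fin r → ℝ)
  x₀ : Fin n → ℝ

namespace ControlSystem

variable {A : Type} {n r : ℕ}

/-- The system is a Nash system. -/
structure IsNashSystem (sys : ControlSystem A n r) : Prop where
  isOpen : IsOpen sys.X
  isConnected : IsConnected sys.X
  isSemialgebraic : IsSemialgebraic sys.X
  nash_f : ∀ (a : A) (i : Fin n), IsNashOn sys.X fun x => sys.f a x i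
  nash_h : ∀ j : Fin r, IsNashOn sys.X fun x => sys.h x j
  x₀_mem : sys.x₀ ∈ sys.X

/-- `x : [0, T_u] → X` is a trajectory of the system for the input `u`: a continuous function with
`x(0) = x₀` and `x'(t) = f_α(x(t))` in the interior of each interval on which `u` has the
value `α`. -/
structure IsTrajectory (sys : ControlSystem A n r) (u : Input A) (x : ℝ → Fin n → ℝ) : Prop where
  continuousOn : ContinuousOn x (Set.Icc 0 (duration u))
  mapsTo : Set.MapsTo x (Set.Icc 0 (duration u)) sys.X
  initial : x 0 = sys.x₀
  hasDerivAt : ∀ (v : Input A) (a : A) (t : ℝ≥0) (w : Input A), u = v ++ (a, t) :: w →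
    ∀ s ∈ Set.Ioo (duration v) (duration v + t), HasDerivAt x (sys.f a (x s)) s

/-- There is a unique trajectory on `[0, T_u]` for the input `u`. -/
def HasUniqueTrajectory (sys : ControlSystem A n r) (u : Input A) : Prop :=
  ∃ x, sys.IsTrajectory u x ∧
    ∀ y, sys.IsTrajectory u y → Set.EqOn x y (Set.Icc 0 (duration u))

/-- The largest admissible set of inputs for which there is a unique trajectory. -/
def admissibleInputs (sys : ControlSystem A n r) : Set (Input A) :=
  ⋃₀ {S | IsAdmissible S ∧ ∀ u ∈ S, sys.HasUniqueTrajectory u}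

/-- `admissibleInputs` is what its name says. -/
theorem isGreatest_admissibleInputs (sys : ControlSystem A n r) :
    IsGreatest {S | IsAdmissible S ∧ ∀ u ∈ S, sys.HasUniqueTrajectory u}
      sys.admissibleInputs := by
  refine ⟨⟨isAdmissible_sUnion fun S hS => hS.1, ?_⟩, fun S hS => Set.subset_sUnion_of_mem hS⟩
  rintro u ⟨S, hS, hu⟩
  exact hS.2 u hu

/-- `z = x(T_u; x₀, u)`: the input `u` steers the system from `x₀` to `z`. -/
def Reaches (sys : ControlSystem A n r) (u : Input A) (z : Fin n → ℝ) : Prop :=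
  ∃ x, sys.IsTrajectory u x ∧ x (duration u) = z

/-- The set `R(x₀)` of states that are reachable from `x₀`. -/
def reachableSet (sys : ControlSystem A n r) : Set (Fin n → ℝ) :=
  {z | ∃ u ∈ sys.admissibleInputs, sys.Reaches u z}

/-- Semi-algebraic reachability: a Nash function that vanishes on `R(x₀)` is zero. -/
def IsSemialgebraicallyReachable (sys : ControlSystem A n r) : Prop :=
  ∀ g : (Fin n → ℝ) → ℝ, IsNashOn sys.X g →
    (∀ z ∈ sys.reachableSet, g z = 0) → ∀ z ∈ sys.X, g z = 0

/-- The Lie derivative `f_α g` of a function on the open set `X` along the vector field `f_α`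
(the derivative does not depend on how `g` is extended outside `X`). -/
def lieDeriv (sys : ControlSystem A n r) (a : A) (g : sys.X → ℝ) : sys.X → ℝ :=
  fun x => fderiv ℝ (Function.extend Subtype.val g 0) (x : Fin n → ℝ) (sys.f a x)

/-- The observation algebra: the smallest algebra of functions on `X` which contains the components
of `h` and is closed under the Lie derivatives along all `f_α`. For a Nash system the Nash functions
on `X` form such an algebra, so this is a subalgebra of `N(X)`. -/
def obsAlgebra (sys : ControlSystem A n r) : Subalgebra ℝ (sys.X → ℝ) :=
  sInf {B | (∀ j : Fin r, (fun x : sys.X => sys.h x j) ∈ B) ∧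
    ∀ (a : A), ∀ g ∈ B, sys.lieDeriv a g ∈ B}

/-- Semi-algebraic observability. -/
def IsSemialgebraicallyObservable (sys : ControlSystem A n r) : Prop :=
  Algebra.trdeg ℝ sys.obsAlgebra = Algebra.trdeg ℝ (nashAlgebra sys.X)

/-- The system is a Nash system which locally realizes the response map `p` with domain `S`:
`p(u) = h(x(T_u; x₀, u))` for all inputs `u` in `S` that are admissible for the system. -/
def IsLocalNashRealization (sys : ControlSystem A n r) (S : Set (Input A))
    (p : Input A → Fin r → ℝ) : Prop :=
  sys.IsNashSystem ∧
    ∀ u ∈ S ∩ sys.admissibleInputs, ∀ z, sys.Reaches u z → p u = sys.h z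

end ControlSystem

/-! ### Ingredients of the observability reduction -/

section Reduction

variable {n d : ℕ} {X : Set (Fin n → ℝ)}

/-- The value `Q(y, z)` of a polynomial `Q ∈ ℝ[T, T₁, …, T_d]`, seen as a polynomial in `T` with
coefficients in `ℝ[T₁, …, T_d]`. -/
def evalAt (Q : Polynomial (MvPolynomial (Fin d) ℝ)) (y : ℝ) (z : Fin d → ℝ) : ℝ :=
  (Q.map (MvPolynomial.eval z)).eval y

/-- `Q` is a non-zero polynomial with `Q(g(x), Φ(x)) = 0` for all `x ∈ X`, and it has the smallest
possible degree in `T` among all such polynomials. -/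
def IsMinimalRelation (Φ : X → Fin d → ℝ) (g : X → ℝ)
    (Q : Polynomial (MvPolynomial (Fin d) ℝ)) : Prop :=
  (Q ≠ 0 ∧ ∀ x, evalAt Q (g x) (Φ x) = 0) ∧
    ∀ Q' : Polynomial (MvPolynomial (Fin d) ℝ), Q' ≠ 0 → (∀ x, evalAt Q' (g x) (Φ x) = 0) →
      Q.natDegree ≤ Q'.natDegree

/-- `(dQ/dT)(g, Φ)` does not vanish on an open neighbourhood of `xb`. -/
def IsRegularAt (Φ : X → Fin d → ℝ) (g : X → ℝ)
    (Q : Polynomial (MvPolynomial (Fin d) ℝ)) (xb : X) : Prop :=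
  ∀ᶠ x in 𝓝 xb, evalAt (Polynomial.derivative Q) (g x) (Φ x) ≠ 0

/-- `ψ : V → W` is a Nash map between open connected semi-algebraic sets `V ⊆ ℝ^d`, `W ⊆ ℝ` which
solves `Q(g, Φ) = 0` for `g` near `xb`. -/
structure IsImplicitSolution (Φ : X → Fin d → ℝ) (g : X → ℝ)
    (Q : Polynomial (MvPolynomial (Fin d) ℝ)) (xb : X)
    (W : Set ℝ) (V : Set (Fin d → ℝ)) (ψ : (Fin d → ℝ) → ℝ) : Prop where
  isOpen_W : IsOpen W
  isConnected_W : IsConnected W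
  isSemialgebraic_W : IsSemialgebraic {y : Fin 1 → ℝ | y 0 ∈ W}
  isOpen_V : IsOpen V
  isConnected_V : IsConnected V
  isSemialgebraic_V : IsSemialgebraic V
  nash : IsNashOn V ψ
  mapsTo : Set.MapsTo ψ V W
  mem_W : g xb ∈ W
  mem_V : Φ xb ∈ V
  base : ψ (Φ xb) = g xb
  solves : ∀ x, g x ∈ W → Φ x ∈ V → (evalAt Q (g x) (Φ x) = 0 ↔ g x = ψ (Φ x))

/-- The reduced system `(V, f^V, h^V, Φ(xb))` with `V` the intersection of all `V_{α,i}` and `V_j`,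
`f^V_α = (ψ_{α,1}, …, ψ_{α,d})` and `h^V = (ψ_1, …, ψ_r)`. -/
def reducedSystem {A : Type} {r : ℕ}
    (VQ : A → Fin d → Set (Fin d → ℝ)) (VP : Fin r → Set (Fin d → ℝ))
    (ψQ : A → Fin d → (Fin d → ℝ) → ℝ) (ψP : Fin r → (Fin d → ℝ) → ℝ)
    (z₀ : Fin d → ℝ) : ControlSystem A d r where
  X := (⋂ a, ⋂ i, VQ a i) ∩ ⋂ j, VP j
  f := fun a z i => ψQ a i z
  h := fun z j => ψP j z
  x₀ := z₀

end Reduction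

end NashSys

end

open NashSys

/-! Let φ be a transcendence basis of the observation algebra. The functions f_α φ_i and h_j lie in
that algebra, hence are algebraic over ℝ[φ]. For a relation Q of minimal degree in T, (dQ/dT)(g, Φ)
is not the zero function (`relationValue_derivative_ne_zero`). As X is connected, analytic functions
on X form a domain, so the product of these finitely many derivatives is non-zero as well. Where it
does not vanish, the implicit function theorem expresses f_α φ_i and h_j as Nash functions of Φ.
Thus near such a state xb the map Φ carries trajectories and outputs of Σ to those of Σ_V
(`IsReductionData.exists_isLocalMorphism`). This is only local in the state space. The properties of
Σ_V follow by analytic continuation in the switching times.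

Continuation. The flow of an analytic vector field is jointly analytic in time and initial state
(`exists_analytic_flow`), so endpoints along an affine family of inputs are analytic in the
parameter. If an analytic function vanishes at all states reached by a fixed admissible u followed
by short inputs, the letters of u can be shrunk away one by one, and the function vanishes at every
reachable state (`eq_zero_of_vanishesAfter`). For u empty this yields a regular state reached by an
arbitrarily short input of S (`IsNashSystem.exists_short_input`). In the same way, p_u and the
output of Σ_V agree on short inputs, hence on every input of both domains, by contracting it to the
empty one.

Algebra. The ring N(X) is enlarged to the analytic functions that are algebraic over the polynomials
(`algebraicAnalytic`). This ring is closed under Lie derivatives, has transcendence degree n, and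
the zeros of a non-zero element satisfy a polynomial equation that is not identically satisfied on X
(`exists_polynomial_of_ne_zero`). Reachability is therefore needed for polynomials only, and closure
properties of Nash functions that rest on quantifier elimination are avoided.

Observability: near xb each φ_i is K_i ∘ Φ with K_i in the observation algebra of Σ_V, and the K_i
inherit algebraic independence, which gives the full degree d. Reachability: if a non-zero g
vanished on the reachable set of Σ_V, some polynomial P ≠ 0 would vanish there too. Then P(φ) would
vanish after u followed by short inputs, hence identically, against the independence of φ. -/

noncomputable section

namespace NashSys

/-! ### The superposition operator on spaces of continuous functions -/

section Nemytskii

variable {E F K : Type*} [NormedAddCommGroup E] [NormedSpace ℝ E] [NormedAddCommGroup F]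
  [NormedSpace ℝ F] [TopologicalSpace K] [CompactSpace K]

/-- A continuous multilinear map, applied pointwise to continuous functions. -/
def pointwiseMultilinear {k : ℕ} (q : ContinuousMultilinearMap ℝ (fun _ : Fin k => E) F) :
    ContinuousMultilinearMap ℝ (fun _ : Fin k => C(K, E)) C(K, F) :=
  MultilinearMap.mkContinuous
    { toFun := fun m => ⟨fun t => q fun i => m i t, by fun_prop⟩
      map_update_add' := by
        intro _ m i x y
        ext t
        have h : ∀ z : C(K, E), (fun j => Function.update m i z j t) =
            Function.update (fun j => m j t) i (z t) := by
          intro z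
          funext j
          by_cases hj : j = i
          · subst hj; simp
          · simp [hj]
        simp only [ContinuousMap.coe_mk, ContinuousMap.add_apply, h]
        exact q.map_update_add _ i _ _
      map_update_smul' := by
        intro _ m i c x
        ext t
        have h : ∀ z : C(K, E), (fun j => Function.update m i z j t) =
            Function.update (fun j => m j t) i (z t) := by
          intro z
          funext j
          by_cases hj : j = i
          · subst hj; simp
          · simp [hj]
        simp only [ContinuousMap.coe_mk, ContinuousMap.smul_apply, h]
        exact q.map_update_smul _ i _ _ }
    ‖q‖ (by
      intro m
      rw [ContinuousMap.norm_le _ (by positivity)]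
      intro t
      refine (q.le_opNorm _).trans ?_
      gcongr with i
      exact ContinuousMap.norm_coe_le_norm (m i) t)

@[simp] theorem pointwiseMultilinear_apply {k : ℕ}
    (q : ContinuousMultilinearMap ℝ (fun _ : Fin k => E) F) (m : Fin k → C(K, E)) (t : K) :
    pointwiseMultilinear q m t = q fun i => m i t := rfl

theorem norm_pointwiseMultilinear_le {k : ℕ}
    (q : ContinuousMultilinearMap ℝ (fun _ : Fin k => E) F) :
    ‖(pointwiseMultilinear q : ContinuousMultilinearMap ℝ (fun _ : Fin k => C(K, E)) C(K, F))‖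
      ≤ ‖q‖ :=
  MultilinearMap.mkContinuous_norm_le _ (norm_nonneg _) _

/-- Composition with an analytic map is an analytic operator on continuous functions near `0`. -/
theorem exists_analyticAt_superposition [CompleteSpace F] {f : E → F} {z : E}
    (hf : AnalyticAt ℝ f z) :
    ∃ N : C(K, E) → C(K, F), AnalyticAt ℝ N 0 ∧
      ∀ᶠ c in 𝓝 (0 : C(K, E)), ∀ t, N c t = f (z + c t) := by
  obtain ⟨p, r, hp⟩ := hf
  let q : FormalMultilinearSeries ℝ C(K, E) C(K, F) := fun k => pointwiseMultilinear (p k)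
  have hq : p.radius ≤ q.radius := by
    refine ENNReal.le_of_forall_nnreal_lt fun s hs => ?_
    obtain ⟨C, -, hC⟩ := p.norm_mul_pow_le_of_lt_radius hs
    refine q.le_radius_of_bound C fun k => ?_
    refine le_trans ?_ (hC k)
    gcongr
    exact norm_pointwiseMultilinear_le _
  have hr : 0 < q.radius := lt_of_lt_of_le (lt_of_lt_of_le hp.r_pos hp.r_le) hq
  have hs := q.hasFPowerSeriesOnBall hr
  refine ⟨q.sum, hs.analyticAt, ?_⟩
  have h1 : Metric.eball (0 : C(K, E)) r ∈ 𝓝 (0 : C(K, E)) := Metric.eball_mem_nhds _ hp.r_pos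
  filter_upwards [h1] with c hc t
  have hc' : c ∈ Metric.eball (0 : C(K, E)) q.radius :=
    Metric.eball_subset_eball (hp.r_le.trans hq) hc
  have h2 := hs.hasSum hc'
  rw [zero_add] at h2
  have h3 := h2.mapL (ContinuousMap.evalCLM ℝ t : C(K, F) →L[ℝ] F)
  have h4 : c t ∈ Metric.eball (0 : E) r := by
    rw [Metric.mem_eball, edist_zero_right] at hc ⊢
    refine lt_of_le_of_lt ?_ hc
    exact enorm_le_iff_norm_le.2 (ContinuousMap.norm_coe_le_norm c t)
  exact h3.unique (hp.hasSum h4)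

end Nemytskii

/-! ### Flows of vector fields -/

section Flow

variable {E : Type*} [NormedAddCommGroup E] [NormedSpace ℝ E]

/-- `c` is an integral curve of `f` on `[0,t]` which stays in `X`. -/
structure IsFlow (X : Set E) (f : E → E) (t : ℝ) (c : ℝ → E) : Prop where
  continuousOn : ContinuousOn c (Set.Icc 0 t)
  mapsTo : Set.MapsTo c (Set.Icc 0 t) X
  hasDerivAt : ∀ s ∈ Set.Ioo 0 t, HasDerivAt c (f (c s)) s

theorem IsFlow.mono {X : Set E} {f : E → E} {t t' : ℝ} {c : ℝ → E} (h : IsFlow X f t c)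
    (ht : t' ≤ t) : IsFlow X f t' c where
  continuousOn := h.continuousOn.mono (Set.Icc_subset_Icc_right ht)
  mapsTo := h.mapsTo.mono_left (Set.Icc_subset_Icc_right ht)
  hasDerivAt s hs := h.hasDerivAt s ⟨hs.1, hs.2.trans_le ht⟩

theorem IsFlow.shift {X : Set E} {f : E → E} {t s : ℝ} {c : ℝ → E} (h : IsFlow X f (s + t) c)
    (hs : 0 ≤ s) : IsFlow X f t (fun τ => c (s + τ)) where
  continuousOn := h.continuousOn.comp (by fun_prop) fun τ hτ =>
    ⟨by linarith [hτ.1], by linarith [hτ.2]⟩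
  mapsTo τ hτ := h.mapsTo ⟨by linarith [hτ.1], by linarith [hτ.2]⟩
  hasDerivAt τ hτ := (h.hasDerivAt (s + τ) ⟨by linarith [hτ.1], by linarith [hτ.2]⟩).comp_const_add

/-- By the mean value theorem the one-sided derivatives at x are limits of nearby derivatives. This
supplies the differential equation at the junction of two concatenated curves. -/
theorem hasDerivAt_of_eventually_hasDerivAt_of_ne {f g : ℝ → E} {x : ℝ}
    (hfg : ∀ᶠ y in 𝓝 x, y ≠ x → HasDerivAt f (g y) y) (hf : ContinuousAt f x)
    (hg : ContinuousAt g x) : HasDerivAt f (g x) x := by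
  obtain ⟨a, b, hx, hab⟩ := mem_nhds_iff_exists_Ioo_subset.1 hfg
  have hA : HasDerivWithinAt f (g x) (Set.Ici x) x := by
    refine hasDerivWithinAt_Ici_of_tendsto_deriv (s := Set.Ioo x b)
      (fun y hy => (hab ⟨hx.1.trans hy.1, hy.2⟩ hy.1.ne').differentiableAt.differentiableWithinAt)
      hf.continuousWithinAt (Ioo_mem_nhdsGT hx.2) ?_
    refine (hg.tendsto.mono_left inf_le_left).congr' ?_
    filter_upwards [Ioo_mem_nhdsGT hx.2] with y hy
    exact (hab ⟨hx.1.trans hy.1, hy.2⟩ hy.1.ne').deriv.symm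
  have hB : HasDerivWithinAt f (g x) (Set.Iic x) x := by
    refine hasDerivWithinAt_Iic_of_tendsto_deriv (s := Set.Ioo a x)
      (fun y hy => (hab ⟨hy.1, hy.2.trans hx.2⟩ hy.2.ne).differentiableAt.differentiableWithinAt)
      hf.continuousWithinAt (Ioo_mem_nhdsLT hx.1) ?_
    refine (hg.tendsto.mono_left inf_le_left).congr' ?_
    filter_upwards [Ioo_mem_nhdsLT hx.1] with y hy
    exact (hab ⟨hy.1, hy.2.trans hx.2⟩ hy.2.ne).deriv.symm
  simpa using hB.union hA

/-- The equation is imposed in the open interval only, whereas the Grönwall argument for uniqueness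
also asks for the right derivative at time 0. It is the limit of f (c τ). -/
theorem IsFlow.hasDerivWithinAt_Ici {X : Set E} {f : E → E} {t : ℝ} {c : ℝ → E}
    (h : IsFlow X f t c) (hf : ContinuousOn f X) {s : ℝ} (hs : s ∈ Set.Ico 0 t) :
    HasDerivWithinAt c (f (c s)) (Set.Ici s) s := by
  have hsub : Set.Ioo s t ⊆ Set.Ioo 0 t := Set.Ioo_subset_Ioo_left hs.1
  have hsub' : Set.Ioo s t ⊆ Set.Icc 0 t := hsub.trans Set.Ioo_subset_Icc_self
  have hsI : s ∈ Set.Icc 0 t := Set.Ico_subset_Icc_self hs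
  refine hasDerivWithinAt_Ici_of_tendsto_deriv (s := Set.Ioo s t) ?_ ?_
    (Ioo_mem_nhdsGT hs.2) ?_
  · exact fun τ hτ => (h.hasDerivAt τ (hsub hτ)).differentiableAt.differentiableWithinAt
  · exact (h.continuousOn s hsI).mono hsub'
  · have h1 : Filter.Tendsto (fun τ => f (c τ)) (𝓝[>] s) (𝓝 (f (c s))) := by
      have h2 : ContinuousWithinAt (fun τ => f (c τ)) (Set.Ioo s t) s :=
        ((hf.comp h.continuousOn h.mapsTo) s hsI).mono hsub'
      rw [← nhdsWithin_Ioo_eq_nhdsGT hs.2]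
      exact h2
    refine h1.congr' ?_
    filter_upwards [Ioo_mem_nhdsGT hs.2] with τ hτ
    exact (h.hasDerivAt τ (hsub hτ)).deriv.symm

theorem exists_lipschitzOnWith_of_analyticOnNhd [CompleteSpace E] {X A : Set E} {f : E → E}
    (hf : AnalyticOnNhd ℝ f X) (hA : IsCompact A) (hAX : A ⊆ X) : ∃ C, LipschitzOnWith C f A := by
  refine LocallyLipschitzOn.exists_lipschitzOnWith_of_compact hA fun x hx => ?_
  obtain ⟨C, s, hs, h⟩ :=
    ((hf x (hAX hx)).contDiffAt (n := 1)).exists_lipschitzOnWith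
  exact ⟨C, s, mem_nhdsWithin_of_mem_nhds hs, h⟩

/-- Both curves stay in a compact subset of X, on which the locally Lipschitz field f is Lipschitz;
Grönwall's inequality applies with this set as domain. -/
theorem IsFlow.eqOn [CompleteSpace E] {X : Set E} {f : E → E} (hf : AnalyticOnNhd ℝ f X) {t : ℝ} {c c' : ℝ → E}
    (h : IsFlow X f t c) (h' : IsFlow X f t c') (h0 : c 0 = c' 0) :
    Set.EqOn c c' (Set.Icc 0 t) := by
  have hA : IsCompact (c '' Set.Icc 0 t ∪ c' '' Set.Icc 0 t) :=
    (isCompact_Icc.image_of_continuousOn h.continuousOn).union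
      (isCompact_Icc.image_of_continuousOn h'.continuousOn)
  obtain ⟨C, hC⟩ := exists_lipschitzOnWith_of_analyticOnNhd hf hA
    (Set.union_subset h.mapsTo.image_subset h'.mapsTo.image_subset)
  refine ODE_solution_unique_of_mem_Icc_right (v := fun _ => f)
    (s := fun _ => c '' Set.Icc 0 t ∪ c' '' Set.Icc 0 t) (fun _ _ => hC) h.continuousOn
    (fun s hs => h.hasDerivWithinAt_Ici hf.continuousOn hs)
    (fun s hs => Or.inl ⟨s, Set.Ico_subset_Icc_self hs, rfl⟩) h'.continuousOn
    (fun s hs => h'.hasDerivWithinAt_Ici hf.continuousOn hs)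
    (fun s hs => Or.inr ⟨s, Set.Ico_subset_Icc_self hs, rfl⟩) h0

/-- Integral curves can be concatenated. -/
theorem IsFlow.append {X : Set E} {f : E → E} (hf : ContinuousOn f X) {s t : ℝ} {c c' : ℝ → E}
    (h : IsFlow X f s c) (h' : IsFlow X f t c') (hs : 0 ≤ s) (ht : 0 ≤ t) (h0 : c s = c' 0) :
    IsFlow X f (s + t) (fun τ => if τ ≤ s then c τ else c' (τ - s)) := by
  set g : ℝ → E := fun τ => if τ ≤ s then c τ else c' (τ - s) with hg
  have e1 : Set.EqOn g c (Set.Iic s) := fun τ hτ => if_pos hτ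
  have e2 : Set.EqOn g (fun τ => c' (τ - s)) (Set.Ici s) := by
    intro τ hτ
    rcases eq_or_lt_of_le (Set.mem_Ici.1 hτ) with rfl | hlt
    · simp [hg, h0]
    · simp [hg, not_le.2 hlt]
  have c1 : ContinuousOn g (Set.Icc 0 s) :=
    h.continuousOn.congr (e1.mono Set.Icc_subset_Iic_self)
  have c2 : ContinuousOn g (Set.Icc s (s + t)) := by
    refine ContinuousOn.congr ?_ (e2.mono Set.Icc_subset_Ici_self)
    exact h'.continuousOn.comp (by fun_prop) fun τ hτ => ⟨by linarith [hτ.1], by linarith [hτ.2]⟩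
  have hIcc : Set.Icc 0 (s + t) = Set.Icc 0 s ∪ Set.Icc s (s + t) :=
    (Set.Icc_union_Icc_eq_Icc hs (by linarith)).symm
  have hcont : ContinuousOn g (Set.Icc 0 (s + t)) := by
    rw [hIcc]
    exact c1.union_of_isClosed c2 isClosed_Icc isClosed_Icc
  have hmaps : Set.MapsTo g (Set.Icc 0 (s + t)) X := by
    intro τ hτ
    rcases le_total τ s with h1 | h1
    · rw [e1 h1]; exact h.mapsTo ⟨hτ.1, h1⟩
    · rw [e2 h1]; exact h'.mapsTo ⟨by linarith, by linarith [hτ.2]⟩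
  have hd : ∀ τ ∈ Set.Ioo 0 (s + t), τ ≠ s → HasDerivAt g (f (g τ)) τ := by
    intro τ hτ hne
    rcases lt_or_gt_of_ne hne with h1 | h1
    · rw [e1 h1.le]
      exact (h.hasDerivAt τ ⟨hτ.1, h1⟩).congr_of_eventuallyEq
        (Filter.eventuallyEq_of_mem (Iio_mem_nhds h1) (e1.mono Set.Iio_subset_Iic_self))
    · rw [e2 h1.le]
      have h2 := h'.hasDerivAt (τ - s) ⟨by linarith, by linarith [hτ.2]⟩
      exact (h2.comp_sub_const).congr_of_eventuallyEq
        (Filter.eventuallyEq_of_mem (Ioi_mem_nhds h1) (e2.mono Set.Ioi_subset_Ici_self))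
  refine ⟨hcont, hmaps, fun τ hτ => ?_⟩
  by_cases hne : τ = s
  · subst hne
    have hn : Set.Icc 0 (τ + t) ∈ 𝓝 τ := Icc_mem_nhds hτ.1 hτ.2
    have hgc : ContinuousAt g τ := hcont.continuousAt hn
    have hfg : ContinuousAt (fun σ => f (g σ)) τ := (hf.comp hcont hmaps).continuousAt hn
    refine hasDerivAt_of_eventually_hasDerivAt_of_ne ?_ hgc hfg
    filter_upwards [Ioo_mem_nhds hτ.1 hτ.2] with σ hσ using hd σ hσ
  · exact hd τ hτ hne

end Flow

/-! ### Existence of flows and their analytic dependence on time and initial state -/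

section LocalFlow

variable {E : Type*} [NormedAddCommGroup E] [NormedSpace ℝ E]

/-- Integration from `0`, as an operator on continuous functions on `[0,1]`. -/
def integralCLM : C(unitInterval, E) →L[ℝ] C(unitInterval, E) :=
  LinearMap.mkContinuous
    { toFun := fun c => ⟨fun t => ∫ τ in (0 : ℝ)..t, Set.IccExtend zero_le_one c τ,
        (intervalIntegral.continuous_primitive
          (fun a b => c.continuous.Icc_extend'.intervalIntegrable a b) 0).comp
            continuous_subtype_val⟩
      map_add' := fun c c' => by
        ext t
        exact intervalIntegral.integral_add (c.continuous.Icc_extend'.intervalIntegrable _ _)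
          (c'.continuous.Icc_extend'.intervalIntegrable _ _)
      map_smul' := fun a c => by
        ext t
        exact intervalIntegral.integral_smul a _ }
    1 (by
      intro c
      rw [ContinuousMap.norm_le _ (by positivity)]
      intro t
      have h := intervalIntegral.norm_integral_le_of_norm_le_const (a := (0 : ℝ)) (b := t)
        (f := Set.IccExtend zero_le_one c) (C := ‖c‖)
        (fun τ _ => ContinuousMap.norm_coe_le_norm c _)
      refine h.trans ?_
      rw [sub_zero, abs_of_nonneg t.2.1, mul_comm]
      gcongr
      exact t.2.2)

theorem integralCLM_apply (c : C(unitInterval, E)) (t : unitInterval) :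
    integralCLM c t = ∫ τ in (0 : ℝ)..t, Set.IccExtend zero_le_one c τ := rfl

/-- `f` steers `z` to `z'` in time `t` inside `X`. -/
def FlowsTo (X : Set E) (f : E → E) (t : ℝ) (z z' : E) : Prop :=
  ∃ c, IsFlow X f t c ∧ c 0 = z ∧ c t = z'

theorem isFlow_zero {X : Set E} {f : E → E} {c : ℝ → E} (h : c 0 ∈ X) : IsFlow X f 0 c where
  continuousOn := by simp
  mapsTo := by
    intro s hs
    rw [Set.Icc_self, Set.mem_singleton_iff] at hs
    rwa [hs]
  hasDerivAt s hs := by simp at hs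

theorem flowsTo_zero_iff {X : Set E} {f : E → E} {z z' : E} :
    FlowsTo X f 0 z z' ↔ z ∈ X ∧ z' = z := by
  constructor
  · rintro ⟨c, hc, rfl, rfl⟩
    exact ⟨hc.mapsTo (by simp), rfl⟩
  · rintro ⟨hz, rfl⟩
    exact ⟨fun _ => z', isFlow_zero hz, rfl, rfl⟩

theorem FlowsTo.left_mem {X : Set E} {f : E → E} {t : ℝ} {z z' : E} (h : FlowsTo X f t z z')
    (ht : 0 ≤ t) : z ∈ X := by
  obtain ⟨c, hc, rfl, rfl⟩ := h
  exact hc.mapsTo ⟨le_rfl, ht⟩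

theorem FlowsTo.unique [CompleteSpace E] {X : Set E} {f : E → E} (hf : AnalyticOnNhd ℝ f X)
    {t : ℝ} (ht : 0 ≤ t) {z z₁ z₂ : E} (h₁ : FlowsTo X f t z z₁) (h₂ : FlowsTo X f t z z₂) :
    z₁ = z₂ := by
  obtain ⟨c, hc, rfl, rfl⟩ := h₁
  obtain ⟨c', hc', h0, rfl⟩ := h₂
  exact hc.eqOn hf hc' h0.symm ⟨ht, le_rfl⟩

theorem FlowsTo.trans {X : Set E} {f : E → E} (hf : ContinuousOn f X) {s t : ℝ} (hs : 0 ≤ s)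
    (ht : 0 ≤ t) {z₁ z₂ z₃ : E} (h₁ : FlowsTo X f s z₁ z₂) (h₂ : FlowsTo X f t z₂ z₃) :
    FlowsTo X f (s + t) z₁ z₃ := by
  obtain ⟨c, hc, rfl, rfl⟩ := h₁
  obtain ⟨c', hc', h0, rfl⟩ := h₂
  refine ⟨_, hc.append hf hc' hs ht h0.symm, by simp [hs], ?_⟩
  rcases eq_or_lt_of_le ht with rfl | h
  · simp [h0]
  · simp [h]

theorem FlowsTo.split {X : Set E} {f : E → E} {s t : ℝ} (hs : 0 ≤ s) (ht : 0 ≤ t) {z z' : E}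
    (h : FlowsTo X f (s + t) z z') : ∃ w, FlowsTo X f s z w ∧ FlowsTo X f t w z' := by
  obtain ⟨c, hc, rfl, rfl⟩ := h
  exact ⟨c s, ⟨c, hc.mono (by linarith), rfl, rfl⟩, ⟨_, hc.shift hs, by simp, rfl⟩⟩

theorem FlowsTo.mono {X Y : Set E} {f : E → E} {t : ℝ} {z z' : E} (h : FlowsTo X f t z z')
    (hXY : X ⊆ Y) : FlowsTo Y f t z z' := by
  obtain ⟨c, hc, h⟩ := h
  exact ⟨c, ⟨hc.continuousOn, hc.mapsTo.mono_right hXY, hc.hasDerivAt⟩, h⟩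

/-- The solution of the rescaled integral equation on `[0,1]` gives an integral curve. -/
theorem flowsTo_of_integral_eq {X : Set E} {f : E → E} {z₀ z : E} {t : ℝ} (ht : 0 ≤ t)
    {c N : C(unitInterval, E)} (hN : ∀ σ, N σ = f (z₀ + c σ)) (hX : ∀ σ, z₀ + c σ ∈ X)
    (hc : c = ContinuousMap.const _ (z - z₀) + t • integralCLM N) [CompleteSpace E] :
    FlowsTo X f t z (z₀ + c 1) := by
  have hNc : Continuous (Set.IccExtend zero_le_one N : ℝ → E) := N.continuous.Icc_extend'
  -- Extending N by constants beyond [0,1] makes e differentiable on the whole line, so the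
  -- derivatives below are two-sided.
  let e : ℝ → E := fun σ => z + t • ∫ τ in (0 : ℝ)..σ, Set.IccExtend zero_le_one N τ
  have he : ∀ σ : unitInterval, z₀ + c σ = e σ := by
    intro σ
    have h := congrArg (fun g : C(unitInterval, E) => g σ) hc
    simp only [ContinuousMap.add_apply, ContinuousMap.const_apply, ContinuousMap.smul_apply,
      integralCLM_apply] at h
    rw [h]
    simp only [e]
    abel
  have hd : ∀ σ, HasDerivAt e (t • Set.IccExtend zero_le_one N σ) σ := fun σ =>
    ((hNc.integral_hasStrictDerivAt 0 σ).hasDerivAt.const_smul t).const_add z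
  have he0 : e 0 = z := by simp [e]
  have hz : z ∈ X := by
    have h := hX 0
    rw [he 0] at h
    simpa [he0] using h
  rcases eq_or_lt_of_le ht with rfl | ht0
  · rw [flowsTo_zero_iff]
    refine ⟨hz, ?_⟩
    rw [he 1]
    simp [e]
  have hd' : ∀ τ, HasDerivAt (fun τ => e (τ / t)) (Set.IccExtend zero_le_one N (τ / t)) τ := by
    intro τ
    have h := HasDerivAt.scomp τ (hd (τ / t)) ((hasDerivAt_id τ).div_const t)
    simpa [Function.comp_def, smul_smul, ht0.ne'] using h
  have hmem : ∀ τ ∈ Set.Icc 0 t, τ / t ∈ unitInterval := fun τ hτ =>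
    ⟨div_nonneg hτ.1 ht, div_le_one_of_le₀ hτ.2 ht⟩
  refine ⟨fun τ => e (τ / t), ⟨fun τ _ => (hd' τ).continuousAt.continuousWithinAt, ?_, ?_⟩, ?_, ?_⟩
  · intro τ hτ
    have h := hX ⟨τ / t, hmem τ hτ⟩
    rwa [he] at h
  · intro τ hτ
    have hm := hmem τ ⟨hτ.1.le, hτ.2.le⟩
    have h := hd' τ
    rw [Set.IccExtend_of_mem zero_le_one _ hm, hN, he] at h
    exact h
  · simp [he0]
  · simp only [div_self ht0.ne']
    exact (he 1).symm

/-- The local flow of an analytic vector field is jointly analytic in time and initial state. -/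
theorem exists_local_analytic_flow [CompleteSpace E] {X : Set E} (hX : IsOpen X) {f : E → E}
    (hf : AnalyticOnNhd ℝ f X) {z₀ : E} (hz₀ : z₀ ∈ X) :
    ∃ Ψ : ℝ × E → E, AnalyticAt ℝ Ψ (0, z₀) ∧ Ψ (0, z₀) = z₀ ∧
      ∀ᶠ q in 𝓝 ((0, z₀) : ℝ × E), 0 ≤ q.1 → FlowsTo X f q.1 q.2 (Ψ q) := by
  obtain ⟨N, hN, hNf⟩ := exists_analyticAt_superposition (K := unitInterval) (hf z₀ hz₀)
  let k : E →L[ℝ] C(unitInterval, E) := ContinuousLinearMap.const ℝ unitInterval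
  -- Rescaling time to [0,1] turns the flow time into a scalar factor, so that all curves live in
  -- one Banach space. The unknown is the displacement from `z₀`, and a zero of G is a solution of
  -- the integral equation.
  let G : (ℝ × E) × C(unitInterval, E) → C(unitInterval, E) := fun q =>
    q.2 - k (q.1.2 - z₀) - q.1.1 • integralCLM (N q.2)
  let u : (ℝ × E) × C(unitInterval, E) := ((0, z₀), 0)
  have hGa : AnalyticAt ℝ G u := by
    have h1 : AnalyticAt ℝ (fun q : (ℝ × E) × C(unitInterval, E) => integralCLM (N q.2)) u :=
      (integralCLM.analyticAt _).comp (hN.comp_of_eq analyticAt_snd rfl)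
    have h2 : AnalyticAt ℝ (fun q : (ℝ × E) × C(unitInterval, E) => k (q.1.2 - z₀)) u :=
      (k.analyticAt _).comp
        (((analyticAt_snd (𝕜 := ℝ) (E := ℝ) (F := E)).comp analyticAt_fst).sub analyticAt_const)
    exact (analyticAt_snd.sub h2).sub
      (((analyticAt_fst (𝕜 := ℝ) (E := ℝ) (F := E)).comp analyticAt_fst).smul h1)
  have hGu : G u = 0 := by simp [G, u]
  have hG : ContDiffAt ℝ (⊤ : WithTop ℕ∞) G u := hGa.contDiffAt
  -- At time 0 the integral term disappears and G is the identity in the unknown curve.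
  have hinv : (fderiv ℝ G u ∘L .inr ℝ (ℝ × E) C(unitInterval, E)).IsInvertible := by
    have h1 : HasFDerivAt (fun c => G ((0, z₀), c))
        (fderiv ℝ G u ∘L .inr ℝ (ℝ × E) C(unitInterval, E)) 0 :=
      HasFDerivAt.comp (0 : C(unitInterval, E)) (hGa.differentiableAt.hasFDerivAt (x := u))
        (hasFDerivAt_prodMk_right (0, z₀) 0)
    have h2 : (fun c => G ((0, z₀), c)) = id := by
      funext c
      simp [G]
    rw [h2] at h1
    rw [h1.unique (hasFDerivAt_id _)]
    exact ⟨ContinuousLinearEquiv.refl ℝ _, rfl⟩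
  have hne : (⊤ : WithTop ℕ∞) ≠ 0 := by simp
  let ψ := hG.implicitFunction hne hinv
  have hψ : AnalyticAt ℝ ψ (0, z₀) :=
    (hG.contDiffAt_implicitFunction hne hinv).analyticAt
  have hψ0 : ψ (0, z₀) = 0 := hG.implicitFunction_apply_self hne hinv
  have hψG : ∀ᶠ q in 𝓝 (0, z₀), G (q, ψ q) = 0 := by
    have h := hG.eventually_apply_implicitFunction hne hinv
    rw [hGu] at h
    exact h
  refine ⟨fun q => z₀ + ψ q 1, ?_, ?_, ?_⟩
  · exact analyticAt_const.add
      (((ContinuousMap.evalCLM ℝ 1 : C(unitInterval, E) →L[ℝ] E).analyticAt _).comp hψ)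
  · simp [hψ0]
  · have hXn : ∀ᶠ c in 𝓝 (0 : C(unitInterval, E)), ∀ σ, z₀ + c σ ∈ X := by
      obtain ⟨ε, hε, hb⟩ := Metric.isOpen_iff.1 hX z₀ hz₀
      filter_upwards [Metric.ball_mem_nhds (0 : C(unitInterval, E)) hε] with c hc σ
      apply hb
      rw [mem_ball_zero_iff] at hc
      simpa using (ContinuousMap.norm_coe_le_norm c σ).trans_lt hc
    have ht : Filter.Tendsto ψ (𝓝 (0, z₀)) (𝓝 0) := by
      have h := hψ.continuousAt.tendsto
      rwa [hψ0] at h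
    filter_upwards [hψG, ht.eventually hXn, ht.eventually hNf] with q h1 h2 h3 hq
    refine flowsTo_of_integral_eq hq h3 h2 ?_
    have h4 : ψ q - k (q.2 - z₀) - q.1 • integralCLM (N (ψ q)) = 0 := h1
    rw [sub_sub, sub_eq_zero] at h4
    exact h4

/-- The flow of an analytic vector field near a given trajectory is jointly analytic in time and
initial state. -/
theorem exists_analytic_flow [CompleteSpace E] {X : Set E} (hX : IsOpen X) {f : E → E}
    (hf : AnalyticOnNhd ℝ f X) {T : ℝ} (hT : 0 ≤ T) {z₀ z₁ : E} (h : FlowsTo X f T z₀ z₁) :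
    ∃ Ψ : ℝ × E → E, AnalyticAt ℝ Ψ (T, z₀) ∧
      ∀ᶠ q in 𝓝 ((T, z₀) : ℝ × E), 0 ≤ q.1 → FlowsTo X f q.1 q.2 (Ψ q) := by
  obtain ⟨c, hc, hc0, -⟩ := h
  let P : ℝ → Prop := fun τ => ∃ Ψ : ℝ × E → E, AnalyticAt ℝ Ψ (τ, z₀) ∧
      ∀ᶠ q in 𝓝 ((τ, z₀) : ℝ × E), 0 ≤ q.1 → FlowsTo X f q.1 q.2 (Ψ q)
  have hz₀ : z₀ ∈ X := hc0 ▸ hc.mapsTo ⟨le_rfl, hT⟩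
  have hP0 : P 0 := by
    obtain ⟨Ψ, h1, -, h2⟩ := exists_local_analytic_flow hX hf hz₀
    exact ⟨Ψ, h1, h2⟩
  -- Here δ comes from the local flow at `c σ` and does not depend on τ. Starting from a τ close to
  -- the supremum of the good times, the step therefore reaches beyond that supremum.
  have step : ∀ σ ∈ Set.Icc 0 T, ∃ δ > 0, ∀ τ ∈ Set.Icc 0 T, σ - δ < τ → τ ≤ σ → P τ →
      ∀ τ', τ < τ' → τ' < τ + δ → P τ' := by
    intro σ hσ
    obtain ⟨Ψ, h1, -, h2⟩ := exists_local_analytic_flow hX hf (hc.mapsTo hσ)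
    obtain ⟨ε, hε, hball⟩ := Metric.eventually_nhds_iff_ball.1
      (h1.eventually_analyticAt.and h2.eventually_nhds)
    obtain ⟨δ, hδ, hδc⟩ := Metric.continuousWithinAt_iff.1 (hc.continuousOn σ hσ) ε hε
    refine ⟨min δ ε, lt_min hδ hε, fun τ hτ hτ1 hτ2 hPτ τ' hτ' hτ'' => ?_⟩
    obtain ⟨Θ, hΘ, hΘf⟩ := hPτ
    have hΘ0 : Θ (τ, z₀) = c τ :=
      (hΘf.self_of_nhds hτ.1).unique hf hτ.1 ⟨c, hc.mono hτ.2, hc0, rfl⟩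
    have hin : ((τ' - τ, c τ) : ℝ × E) ∈ Metric.ball ((0, c σ) : ℝ × E) ε := by
      rw [Metric.mem_ball, Prod.dist_eq, max_lt_iff]
      constructor
      · rw [Real.dist_eq, sub_zero, abs_of_pos (by linarith)]
        linarith [min_le_right δ ε]
      · refine hδc hτ ?_
        rw [Real.dist_eq, abs_sub_lt_iff]
        constructor <;> linarith [min_le_left δ ε]
    obtain ⟨hA, hF⟩ := hball _ hin
    -- The flow for time `q.1` is the known flow for time τ followed by the local flow for the
    -- remaining time.
    let m : ℝ × E → ℝ × E := fun q => (q.1 - τ, Θ (τ, q.2))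
    have hm0 : m (τ', z₀) = (τ' - τ, c τ) := by simp [m, hΘ0]
    have hi : AnalyticAt ℝ (fun q : ℝ × E => ((τ, q.2) : ℝ × E)) (τ', z₀) :=
      analyticAt_const.prod analyticAt_snd
    have hm : AnalyticAt ℝ m (τ', z₀) :=
      (analyticAt_fst.sub analyticAt_const).prod (hΘ.comp_of_eq hi rfl)
    refine ⟨fun q => Ψ (m q), hA.comp_of_eq hm hm0, ?_⟩
    have e1 : ∀ᶠ q : ℝ × E in 𝓝 (τ', z₀), 0 ≤ τ → FlowsTo X f τ q.2 (Θ (τ, q.2)) :=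
      hi.continuousAt.tendsto.eventually hΘf
    have e2 : ∀ᶠ q : ℝ × E in 𝓝 (τ', z₀), 0 ≤ (m q).1 → FlowsTo X f (m q).1 (m q).2 (Ψ (m q)) := by
      have h3 := hm.continuousAt.tendsto
      rw [hm0] at h3
      exact h3.eventually hF
    have e3 : ∀ᶠ q : ℝ × E in 𝓝 (τ', z₀), τ < q.1 :=
      continuousAt_fst.eventually (lt_mem_nhds hτ')
    filter_upwards [e1, e2, e3] with q q1 q2 q3 _
    have h4 := (q1 hτ.1).trans hf.continuousOn hτ.1 (sub_nonneg.2 q3.le) (q2 (sub_nonneg.2 q3.le))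
    simpa [m] using h4
  let A : Set ℝ := {τ | τ ∈ Set.Icc 0 T ∧ P τ}
  have hA0 : (0 : ℝ) ∈ A := ⟨⟨le_rfl, hT⟩, hP0⟩
  have hAb : BddAbove A := ⟨T, fun τ hτ => hτ.1.2⟩
  have hσ : sSup A ∈ Set.Icc 0 T :=
    ⟨le_csSup hAb hA0, csSup_le ⟨0, hA0⟩ fun τ hτ => hτ.1.2⟩
  obtain ⟨δ, hδ, hstep⟩ := step _ hσ
  obtain ⟨τ, hτA, hτ⟩ := exists_lt_of_lt_csSup ⟨0, hA0⟩ (sub_lt_self (sSup A) hδ)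
  have hτs : τ ≤ sSup A := le_csSup hAb hτA
  have hnext := hstep τ hτA.1 hτ hτs hτA.2
  rcases eq_or_lt_of_le hσ.2 with heq | hlt
  · rcases eq_or_lt_of_le hτA.1.2 with h1 | h1
    · rw [← h1]; exact hτA.2
    · exact hnext T h1 (by linarith)
  · exfalso
    have h1 : sSup A < min T (τ + δ) := lt_min hlt (by linarith)
    obtain ⟨τ', h2, h3⟩ := exists_between h1
    have h4 : τ' ∈ A := ⟨⟨hσ.1.trans h2.le, (h3.trans_le (min_le_left _ _)).le⟩,
      hnext τ' (hτs.trans_lt h2) (h3.trans_le (min_le_right _ _))⟩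
    exact absurd (le_csSup hAb h4) (not_le.2 h2)

/-- Existence of integral curves inside a ball, for as long as the speed allows. -/
theorem exists_isFlow_closedBall [CompleteSpace E] {f : E → E} {z : E} {a M : ℝ≥0} {C : ℝ≥0}
    (hM : ∀ x ∈ Metric.closedBall z a, ‖f x‖ ≤ M) (hL : LipschitzOnWith C f (Metric.closedBall z a))
    {t : ℝ} (ht : 0 ≤ t) (hta : M * t ≤ a) :
    ∃ c, IsFlow (Metric.closedBall z a) f t c ∧ c 0 = z := by
  have hp : IsPicardLindelof (fun _ : ℝ => f) (tmin := 0) (tmax := t) ⟨0, le_rfl, ht⟩ z a 0 M C :=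
    IsPicardLindelof.of_time_independent hM hL (by simpa [ht] using hta)
  have hz : z ∈ Metric.closedBall z (0 : ℝ≥0) := by simp
  -- Working with the fixed point of the Picard operator retains the information that the curve
  -- stays in the ball.
  obtain ⟨α, hα⟩ := ODE.FunSpace.exists_isFixedPt_next hp hz
  rw [ODE.FunSpace.isFixedPt_next_iff] at hα
  have hmem : ∀ s, α.compProj s ∈ Metric.closedBall z a := fun s =>
    α.compProj_mem_closedBall hp.mul_max_le
  have heq : ∀ s ∈ Set.Icc 0 t, α.compProj s = ODE.picard (fun _ => f) 0 z α.compProj s := by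
    intro s hs
    rw [ODE.FunSpace.compProj_of_mem hs]
    exact hα ⟨s, hs⟩
  refine ⟨α.compProj, ⟨α.continuous_compProj.continuousOn, fun s _ => hmem s, fun s hs => ?_⟩, ?_⟩
  · have h := ODE.hasDerivWithinAt_picard_Icc (f := fun _ => f) (u := Metric.closedBall z a)
      (⟨le_rfl, ht⟩ : (0 : ℝ) ∈ Set.Icc 0 t)
      (hL.continuousOn.comp continuousOn_snd fun q hq => hq.2)
      α.continuous_compProj.continuousOn (fun s _ => hmem s) z (Set.Ioo_subset_Icc_self hs)
    have hn := Icc_mem_nhds hs.1 hs.2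
    exact (h.hasDerivAt hn).congr_of_eventuallyEq (Filter.eventuallyEq_of_mem hn heq)
  · rw [heq 0 ⟨le_rfl, ht⟩]
    simp

end LocalFlow

/-! ### Switching words -/

section Words

variable {A : Type}

@[simp] theorem duration_nil : duration ([] : Input A) = 0 := rfl

@[simp] theorem duration_cons (q : A × ℝ≥0) (w : Input A) :
    duration (q :: w) = q.2 + duration w := rfl

theorem duration_nonneg : ∀ u : Input A, 0 ≤ duration u
  | [] => le_rfl
  | (_, t) :: w => add_nonneg t.2 (duration_nonneg w)

theorem duration_append (u v : Input A) : duration (u ++ v) = duration u + duration v := by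
  induction u with
  | nil => simp
  | cons q u ih => simp [ih, add_assoc]

theorem value_eq_none_iff (u : Input A) {s : ℝ} (hs : 0 ≤ s) :
    value u s = none ↔ duration u ≤ s := by
  induction u generalizing s with
  | nil => simpa [value] using hs
  | cons q w ih =>
    obtain ⟨a, t⟩ := q
    simp only [value, duration_cons]
    split_ifs with h
    · have := duration_nonneg w
      simp only [false_iff, not_le]
      linarith
    · rw [ih (by linarith)]
      constructor <;> intro h' <;> linarith

/-- The duration is the least non-negative time at which the value is `none`, so it depends on the
described function only. -/
theorem SameInput.duration_eq {u v : Input A} (h : SameInput u v) : duration u = duration v := by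
  have key : ∀ {u v : Input A}, SameInput u v → duration v ≤ duration u := by
    intro u v h
    rw [← value_eq_none_iff v (duration_nonneg u), ← h _ (duration_nonneg u),
      value_eq_none_iff u (duration_nonneg u)]
  exact le_antisymm (key fun s hs => (h s hs).symm) (key h)

theorem duration_truncate_le (u : Input A) (s : ℝ≥0) : duration (truncate u s) ≤ duration u := by
  induction u generalizing s with
  | nil => simp [truncate]
  | cons q w ih =>
    obtain ⟨a, t⟩ := q
    simp only [truncate]
    have := duration_nonneg w
    split_ifs with h
    · have h' : (s : ℝ) ≤ t := h
      simp only [duration_cons, duration_nil]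
      linarith
    · simp only [duration_cons]
      linarith [ih (s - t)]

/-- The word `v` has the same letters as `u` and durations which exceed those of `u` by at most
`δ`. -/
def Dominates (δ : ℝ≥0) (u v : Input A) : Prop :=
  List.Forall₂ (fun q q' => q'.1 = q.1 ∧ q'.2 ≤ q.2 + δ) u v

theorem Dominates.duration_le {δ : ℝ≥0} {u v : Input A} (h : Dominates δ u v) :
    duration v ≤ duration u + u.length * δ := by
  induction h with
  | nil => simp
  | @cons q q' u v h _ ih =>
    have h1 : (q'.2 : ℝ) ≤ q.2 + δ := by exact_mod_cast h.2
    simp only [duration_cons, List.length_cons]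
    push_cast
    linarith

theorem Dominates.refl (δ : ℝ≥0) (u : Input A) : Dominates δ u u := by
  induction u with
  | nil => exact List.Forall₂.nil
  | cons q u ih => exact List.Forall₂.cons ⟨rfl, le_self_add⟩ ih

theorem Dominates.mono {δ δ' : ℝ≥0} {u v : Input A} (h : Dominates δ u v) (hδ : δ ≤ δ') :
    Dominates δ' u v :=
  h.imp fun _ _ hq => ⟨hq.1, hq.2.trans (by gcongr)⟩

theorem Dominates.append {δ : ℝ≥0} {u u' v v' : Input A} (h : Dominates δ u v)
    (h' : Dominates δ u' v') : Dominates δ (u ++ u') (v ++ v') := by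
  induction h with
  | nil => exact h'
  | cons hq _ ih => exact List.Forall₂.cons hq ih

/-- Domination bounds durations from above only, so short words are dominated by every word with the
same letters. -/
theorem dominates_of_letters {δ : ℝ≥0} {u v : Input A} (h : v.map Prod.fst = u.map Prod.fst)
    (hv : ∀ q ∈ v, q.2 ≤ δ) : Dominates δ u v := by
  induction u generalizing v with
  | nil =>
    rw [List.map_nil, List.map_eq_nil_iff] at h
    subst h
    exact List.Forall₂.nil
  | cons q u ih =>
    cases v with
    | nil => simp at h
    | cons q' v =>
      simp only [List.map_cons, List.cons.injEq] at h
      exact List.Forall₂.cons ⟨h.1, (hv q' (by simp)).trans le_add_self⟩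
        (ih h.2 fun r hr => hv r (by simp [hr]))

theorem IsAdmissible.nil_mem {S : Set (Input A)} (hS : IsAdmissible S) (hne : S.Nonempty) :
    [] ∈ S := by
  obtain ⟨u, hu⟩ := hne
  have h := hS.restrict u hu 0 (by simpa using duration_nonneg u)
  cases u with
  | nil => exact h
  | cons q w =>
    -- Restriction to [0,0] leaves one letter of duration 0, which describes the empty input.
    refine hS.saturated _ _ ?_ h
    intro s hs
    simp [truncate, value, not_lt.2 hs]

/-- The perturbation axiom allows durations to decrease arbitrarily; no increase is used here. -/
theorem IsAdmissible.mem_of_dominates_zero {S : Set (Input A)} (hS : IsAdmissible S) {u v : Input A}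
    (hu : u ∈ S) (h : Dominates 0 u v) : v ∈ S := by
  obtain ⟨δ, -, hδ⟩ := hS.perturb u hu
  exact hδ v (h.mono zero_le)

/-- An admissible input can be followed by short inputs with any given sequence of values. -/
theorem IsAdmissible.exists_extension {S : Set (Input A)} (hS : IsAdmissible S) {u : Input A}
    (hu : u ∈ S) (β : List A) : ∃ δ : ℝ≥0, 0 < δ ∧ ∀ u' v : Input A, Dominates δ u u' →
      v.map Prod.fst = β → (∀ q ∈ v, q.2 ≤ δ) → u' ++ v ∈ S := by
  -- Some word w with letters β extends u. The perturbation axiom at `u ++ w` then replaces w by any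
  -- shorter word with these letters and moves u at the same time.
  have h : ∃ w : Input A, w.map Prod.fst = β ∧ u ++ w ∈ S := by
    induction β generalizing u with
    | nil => exact ⟨[], rfl, by simpa using hu⟩
    | cons a β ih =>
      obtain ⟨t, -, ht⟩ := hS.extend u hu a
      obtain ⟨w, hw, hm⟩ := ih ht
      exact ⟨(a, t) :: w, by simp [hw], by simpa using hm⟩
  obtain ⟨w, hw, hm⟩ := h
  obtain ⟨δ, hδ, hp⟩ := hS.perturb _ hm
  exact ⟨δ, hδ, fun u' v hu' hv hvδ =>
    hp _ (hu'.append (dominates_of_letters (hv.trans hw.symm) hvδ))⟩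

/-- The inputs of duration less than `ε` form an admissible set. -/
theorem isAdmissible_duration_lt {ε : ℝ} : IsAdmissible {u : Input A | duration u < ε} where
  saturated u v h hu := by
    rw [Set.mem_ofPred_eq, ← h.duration_eq]
    exact hu
  restrict u hu s _ := (duration_truncate_le u s).trans_lt hu
  extend u hu a := by
    have hu' : 0 < ε - duration u := sub_pos.2 hu
    refine ⟨((ε - duration u) / 2).toNNReal, by simpa using hu', ?_⟩
    rw [Set.mem_ofPred_eq, duration_append]
    simp only [duration_cons, duration_nil]
    rw [Real.coe_toNNReal _ (by linarith)]
    linarith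
  perturb u hu := by
    have hu' : 0 < ε - duration u := sub_pos.2 hu
    have hδ : 0 < (ε - duration u) / (u.length + 1) := by positivity
    -- The remaining time is distributed over the letters; the summand 1 covers the empty word and
    -- makes the inequality strict.
    refine ⟨((ε - duration u) / (u.length + 1)).toNNReal, by simpa using hδ, fun v hv => ?_⟩
    have h := Dominates.duration_le hv
    rw [Real.coe_toNNReal _ hδ.le] at h
    refine h.trans_lt ?_
    have h1 : (u.length : ℝ) * ((ε - duration u) / (u.length + 1)) < ε - duration u := by
      rw [mul_div_assoc', div_lt_iff₀ (by positivity)]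
      nlinarith
    linarith

end Words

/-! ### Steering -/

section Steering

variable {A : Type} {E : Type*} [NormedAddCommGroup E] [NormedSpace ℝ E]

/-- The input `u` steers `z` to `z'` inside `X`. -/
def Steers (X : Set E) (f : A → E → E) : Input A → E → E → Prop
  | [], z, z' => z ∈ X ∧ z' = z
  | (a, t) :: w, z, z' => ∃ y, FlowsTo X (f a) t z y ∧ Steers X f w y z'

variable {X : Set E} {f : A → E → E}

theorem steers_cons {a : A} {t : ℝ≥0} {w : Input A} {z z' : E} :
    Steers X f ((a, t) :: w) z z' ↔ ∃ y, FlowsTo X (f a) t z y ∧ Steers X f w y z' := Iff.rfl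

theorem Steers.left_mem {u : Input A} {z z' : E} (h : Steers X f u z z') : z ∈ X := by
  cases u with
  | nil => exact h.1
  | cons q w =>
    obtain ⟨y, hy, -⟩ := h
    exact hy.left_mem q.2.2

theorem Steers.right_mem {u : Input A} {z z' : E} (h : Steers X f u z z') : z' ∈ X := by
  induction u generalizing z with
  | nil => exact h.2 ▸ h.1
  | cons q w ih =>
    obtain ⟨y, -, hy⟩ := h
    exact ih hy

theorem steers_append {u v : Input A} {z z' : E} :
    Steers X f (u ++ v) z z' ↔ ∃ y, Steers X f u z y ∧ Steers X f v y z' := by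
  induction u generalizing z with
  | nil =>
    constructor
    · intro h
      exact ⟨z, ⟨h.left_mem, rfl⟩, h⟩
    · rintro ⟨y, ⟨-, rfl⟩, h⟩
      exact h
  | cons q w ih =>
    obtain ⟨a, t⟩ := q
    simp only [List.cons_append, steers_cons, ih]
    constructor
    · rintro ⟨y, hy, y', hy', h⟩
      exact ⟨y', ⟨y, hy, hy'⟩, h⟩
    · rintro ⟨y', ⟨y, hy, hy'⟩, h⟩
      exact ⟨y, hy, y', hy', h⟩

theorem steers_zero_cons {a : A} {w : Input A} {z z' : E} :
    Steers X f ((a, 0) :: w) z z' ↔ Steers X f w z z' := by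
  simp only [steers_cons, NNReal.coe_zero, flowsTo_zero_iff]
  constructor
  · rintro ⟨y, ⟨-, rfl⟩, h⟩
    exact h
  · intro h
    exact ⟨z, ⟨h.left_mem, rfl⟩, h⟩

theorem Steers.mono {Y : Set E} (hXY : X ⊆ Y) {u : Input A} {z z' : E} (h : Steers X f u z z') :
    Steers Y f u z z' := by
  induction u generalizing z with
  | nil => exact ⟨hXY h.1, h.2⟩
  | cons q w ih =>
    obtain ⟨y, hy, h⟩ := h
    exact ⟨y, hy.mono hXY, ih h⟩

theorem Steers.unique [CompleteSpace E] (hf : ∀ a, AnalyticOnNhd ℝ (f a) X) {u : Input A}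
    {z z₁ z₂ : E} (h₁ : Steers X f u z z₁) (h₂ : Steers X f u z z₂) : z₁ = z₂ := by
  induction u generalizing z with
  | nil => rw [h₁.2, h₂.2]
  | cons q w ih =>
    obtain ⟨y, hy, h₁⟩ := h₁
    obtain ⟨y', hy', h₂⟩ := h₂
    obtain rfl := hy.unique (hf _) q.2.2 hy'
    exact ih h₁ h₂

/-- Short inputs steer inside any given neighbourhood. -/
theorem exists_steers_of_duration_lt [CompleteSpace E] [Finite A] {N : Set E} {z₀ : E}
    (hN : N ∈ 𝓝 z₀) (hf : ∀ a, AnalyticAt ℝ (f a) z₀) :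
    ∃ ε > 0, ∀ u : Input A, duration u < ε → ∃ z, Steers N f u z₀ z := by
  -- The requirements on the radius are stated for all small ρ, so that one ρ serves the finitely
  -- many input values.
  have h1 : ∀ a, ∃ C : ℝ≥0, ∀ᶠ ρ in 𝓝[>] (0 : ℝ),
      LipschitzOnWith C (f a) (Metric.closedBall z₀ ρ) := by
    intro a
    obtain ⟨C, s, hs, hC⟩ := ((hf a).contDiffAt (n := 1)).exists_lipschitzOnWith
    refine ⟨C, ?_⟩
    obtain ⟨r, hr, hrs⟩ := Metric.nhds_basis_closedBall.mem_iff.1 hs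
    filter_upwards [Ioc_mem_nhdsGT hr] with ρ hρ
    exact hC.mono ((Metric.closedBall_subset_closedBall hρ.2).trans hrs)
  choose C hC using h1
  have h2 : ∀ a, ∀ᶠ ρ in 𝓝[>] (0 : ℝ), ∀ x ∈ Metric.closedBall z₀ ρ, ‖f a x‖ < ‖f a z₀‖ + 1 := by
    intro a
    have hs : ∀ᶠ x in 𝓝 z₀, ‖f a x‖ < ‖f a z₀‖ + 1 :=
      (hf a).continuousAt.norm.eventually (gt_mem_nhds (by simp))
    obtain ⟨r, hr, hrs⟩ := Metric.nhds_basis_closedBall.mem_iff.1 hs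
    filter_upwards [Ioc_mem_nhdsGT hr] with ρ hρ x hx
    exact hrs (Metric.closedBall_subset_closedBall hρ.2 hx)
  have h3 : ∀ᶠ ρ in 𝓝[>] (0 : ℝ), Metric.closedBall z₀ ρ ⊆ N := by
    obtain ⟨r, hr, hrs⟩ := Metric.nhds_basis_closedBall.mem_iff.1 hN
    filter_upwards [Ioc_mem_nhdsGT hr] with ρ hρ
    exact (Metric.closedBall_subset_closedBall hρ.2).trans hrs
  obtain ⟨ρ, h1, h2, h3, hρ⟩ := ((Filter.eventually_all.2 hC).and
    ((Filter.eventually_all.2 h2).and (h3.and self_mem_nhdsWithin))).exists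
  have hρ' : 0 < ρ := hρ
  obtain ⟨M, hM⟩ : ∃ M : ℝ≥0, ∀ a, ‖f a z₀‖ + 1 ≤ M := by
    obtain ⟨M, hM⟩ := (Set.finite_range fun a => ‖f a z₀‖ + 1).bddAbove
    exact ⟨M.toNNReal, fun a => (hM ⟨a, rfl⟩).trans (Real.le_coe_toNNReal M)⟩
  -- M bounds the speed: the distance already covered plus M times the remaining duration stays
  -- within ρ along the word.
  have key : ∀ (u : Input A) (z : E), dist z z₀ + M * duration u ≤ ρ →
      ∃ z', Steers (Metric.closedBall z₀ ρ) f u z z' := by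
    intro u
    induction u with
    | nil =>
      intro z hz
      exact ⟨z, by simpa using hz, rfl⟩
    | cons q w ih =>
      obtain ⟨a, t⟩ := q
      intro z hz
      rw [duration_cons] at hz
      have hw : 0 ≤ M * duration w := mul_nonneg M.2 (duration_nonneg w)
      have hsub : Metric.closedBall z ((M * t : ℝ≥0) : ℝ) ⊆ Metric.closedBall z₀ ρ := by
        refine Metric.closedBall_subset_closedBall' ?_
        push_cast
        linarith
      obtain ⟨c, hc, hc0⟩ := exists_isFlow_closedBall (f := f a) (a := M * t) (M := M)
        (fun x hx => (h2 a x (hsub hx)).le.trans (hM a)) ((h1 a).mono hsub) t.2 (by simp)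
      have hct : dist (c t) z ≤ M * t := by
        have := hc.mapsTo (⟨t.2, le_rfl⟩ : (t : ℝ) ∈ Set.Icc 0 (t : ℝ))
        simpa using this
      obtain ⟨z', hz'⟩ := ih (c t) (by linarith [dist_triangle (c t) z z₀])
      exact ⟨z', c t, FlowsTo.mono ⟨c, hc, hc0, rfl⟩ hsub, hz'⟩
  refine ⟨ρ / (M + 1), by positivity, fun u hu => ?_⟩
  obtain ⟨z', hz'⟩ := key u z₀ (by
    rw [dist_self, zero_add]
    rw [lt_div_iff₀ (by positivity)] at hu
    nlinarith [duration_nonneg u])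
  exact ⟨z', hz'.mono h3⟩

end Steering

/-! ### Trajectories and steering -/

namespace ControlSystem

variable {A : Type} {n r : ℕ} {sys : ControlSystem A n r}

theorem IsTrajectory.isFlow {a : A} {t : ℝ≥0} {w : Input A} {x : ℝ → Fin n → ℝ}
    (h : sys.IsTrajectory ((a, t) :: w) x) : IsFlow sys.X (sys.f a) t x where
  continuousOn := h.continuousOn.mono (Set.Icc_subset_Icc_right (by
    simpa using duration_nonneg w))
  mapsTo := h.mapsTo.mono_left (Set.Icc_subset_Icc_right (by simpa using duration_nonneg w))
  hasDerivAt s hs := h.hasDerivAt [] a t w rfl s (by simpa using hs)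

theorem IsTrajectory.tail {a : A} {t : ℝ≥0} {w : Input A} {x : ℝ → Fin n → ℝ}
    (h : sys.IsTrajectory ((a, t) :: w) x) :
    ({ sys with x₀ := x t } : ControlSystem A n r).IsTrajectory w (fun τ => x (t + τ)) where
  continuousOn := h.continuousOn.comp (by fun_prop) fun τ hτ =>
    ⟨add_nonneg t.2 hτ.1, by simpa using hτ.2⟩
  mapsTo τ hτ := h.mapsTo ⟨add_nonneg t.2 hτ.1, by simpa using hτ.2⟩
  initial := by simp
  hasDerivAt v b s w' hw τ hτ :=
    (h.hasDerivAt ((a, t) :: v) b s w' (by simp [hw]) (t + τ)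
      (by
        simp only [duration_cons]
        exact ⟨by linarith [hτ.1], by linarith [hτ.2]⟩)).comp_const_add

theorem IsTrajectory.cons {a : A} {t : ℝ≥0} {w : Input A} {c y : ℝ → Fin n → ℝ}
    (hc : IsFlow sys.X (sys.f a) t c) (hc0 : c 0 = sys.x₀)
    (hy : ({ sys with x₀ := c t } : ControlSystem A n r).IsTrajectory w y) :
    sys.IsTrajectory ((a, t) :: w) (fun τ => if τ ≤ t then c τ else y (τ - t)) := by
  set g : ℝ → Fin n → ℝ := fun τ => if τ ≤ t then c τ else y (τ - t) with hg
  have h0 : y 0 = c t := hy.initial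
  have e1 : Set.EqOn g c (Set.Iic t) := fun τ hτ => if_pos hτ
  have e2 : Set.EqOn g (fun τ => y (τ - t)) (Set.Ici t) := by
    intro τ hτ
    rcases eq_or_lt_of_le (Set.mem_Ici.1 hτ) with rfl | hlt
    · simp [hg, h0]
    · simp [hg, not_le.2 hlt]
  have hw := duration_nonneg w
  have c1 : ContinuousOn g (Set.Icc 0 t) :=
    hc.continuousOn.congr (e1.mono Set.Icc_subset_Iic_self)
  have c2 : ContinuousOn g (Set.Icc t (t + duration w)) := by
    refine ContinuousOn.congr ?_ (e2.mono Set.Icc_subset_Ici_self)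
    exact hy.continuousOn.comp (by fun_prop) fun τ hτ => ⟨by linarith [hτ.1], by linarith [hτ.2]⟩
  refine ⟨?_, ?_, ?_, ?_⟩
  · rw [duration_cons, ← Set.Icc_union_Icc_eq_Icc t.2 (show (t : ℝ) ≤ t + duration w by linarith)]
    exact c1.union_of_isClosed c2 isClosed_Icc isClosed_Icc
  · intro τ hτ
    rw [duration_cons] at hτ
    rcases le_total τ t with h1 | h1
    · rw [e1 h1]; exact hc.mapsTo ⟨hτ.1, h1⟩
    · rw [e2 h1]; exact hy.mapsTo ⟨by linarith, by linarith [hτ.2]⟩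
  · rw [e1 (show (0 : ℝ) ∈ Set.Iic (t : ℝ) from t.2), hc0]
  · intro v b s w' hv τ hτ
    cases v with
    | nil =>
      simp only [List.nil_append, List.cons.injEq, Prod.mk.injEq] at hv
      obtain ⟨⟨rfl, rfl⟩, rfl⟩ := hv
      simp only [duration_nil, zero_add] at hτ
      rw [e1 hτ.2.le]
      exact (hc.hasDerivAt τ hτ).congr_of_eventuallyEq
        (Filter.eventuallyEq_of_mem (Iio_mem_nhds hτ.2) (e1.mono Set.Iio_subset_Iic_self))
    | cons q v =>
      simp only [List.cons_append, List.cons.injEq] at hv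
      obtain ⟨rfl, hv⟩ := hv
      simp only [duration_cons] at hτ
      have hv0 := duration_nonneg v
      have h1 : (t : ℝ) < τ := by linarith [hτ.1]
      rw [e2 h1.le]
      have h2 := hy.hasDerivAt v b s w' hv (τ - t) ⟨by linarith [hτ.1], by linarith [hτ.2]⟩
      exact (h2.comp_sub_const).congr_of_eventuallyEq
        (Filter.eventuallyEq_of_mem (Ioi_mem_nhds h1) (e2.mono Set.Ioi_subset_Ici_self))

/-- This replaces one trajectory on the whole time interval by a chain of flows, one per letter,
which suits induction on words. The tail of the word starts from another state, hence the induction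
varies the system. -/
theorem reaches_iff_steers {u : Input A} {z : Fin n → ℝ} :
    sys.Reaches u z ↔ Steers sys.X sys.f u sys.x₀ z := by
  induction u generalizing sys with
  | nil =>
    constructor
    · rintro ⟨x, hx, rfl⟩
      have h := hx.mapsTo (⟨le_rfl, le_rfl⟩ : (0 : ℝ) ∈ Set.Icc 0 (duration ([] : Input A)))
      rw [hx.initial] at h
      exact ⟨h, hx.initial⟩
    · rintro ⟨h, rfl⟩
      have hf := isFlow_zero (f := fun z => z) (c := fun _ => sys.x₀) h
      refine ⟨fun _ => sys.x₀, ⟨hf.continuousOn, hf.mapsTo, rfl, ?_⟩, rfl⟩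
      intro v a t w hv
      simp at hv
  | cons q w ih =>
    obtain ⟨a, t⟩ := q
    rw [steers_cons]
    constructor
    · rintro ⟨x, hx, rfl⟩
      refine ⟨x t, ⟨x, hx.isFlow, hx.initial, rfl⟩, ?_⟩
      exact (ih (sys := { sys with x₀ := x t })).1 ⟨_, hx.tail, rfl⟩
    · rintro ⟨y, ⟨c, hc, hc0, rfl⟩, h⟩
      obtain ⟨x, hx, rfl⟩ := (ih (sys := { sys with x₀ := c t })).2 h
      refine ⟨_, IsTrajectory.cons hc hc0 hx, ?_⟩
      simp only [duration_cons]
      rcases eq_or_lt_of_le (duration_nonneg w) with h0 | h0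
      · have h1 : x 0 = c t := hx.initial
        simp [← h0, h1]
      · simp [h0]

theorem IsTrajectory.eqOn (hf : ∀ a, AnalyticOnNhd ℝ (sys.f a) sys.X) {u : Input A}
    {x y : ℝ → Fin n → ℝ} (hx : sys.IsTrajectory u x) (hy : sys.IsTrajectory u y) :
    Set.EqOn x y (Set.Icc 0 (duration u)) := by
  induction u generalizing sys x y with
  | nil =>
    intro τ hτ
    have h0 : τ = 0 := le_antisymm hτ.2 hτ.1
    rw [h0, hx.initial, hy.initial]
  | cons q w ih =>
    obtain ⟨a, t⟩ := q
    have h1 := hx.isFlow.eqOn (hf a) hy.isFlow (hx.initial.trans hy.initial.symm)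
    have h2 : x t = y t := h1 ⟨t.2, le_rfl⟩
    have hy' := hy.tail
    rw [← h2] at hy'
    have h3 := ih (sys := { sys with x₀ := x t }) hf hx.tail hy'
    intro τ hτ
    rw [duration_cons] at hτ
    rcases le_total τ t with h4 | h4
    · exact h1 ⟨hτ.1, h4⟩
    · have h5 := h3 (⟨sub_nonneg.2 h4, by linarith [hτ.2]⟩ : τ - t ∈ Set.Icc 0 (duration w))
      simpa using h5

/-- Analytic fields have at most one trajectory for a given input, so only existence matters. -/
theorem hasUniqueTrajectory_iff (hf : ∀ a, AnalyticOnNhd ℝ (sys.f a) sys.X) {u : Input A} :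
    sys.HasUniqueTrajectory u ↔ ∃ z, Steers sys.X sys.f u sys.x₀ z := by
  constructor
  · rintro ⟨x, hx, -⟩
    exact ⟨_, reaches_iff_steers.1 ⟨x, hx, rfl⟩⟩
  · rintro ⟨z, hz⟩
    obtain ⟨x, hx, -⟩ := reaches_iff_steers.2 hz
    exact ⟨x, hx, fun y hy => hx.eqOn hf hy⟩

theorem isAdmissible_admissibleInputs : IsAdmissible sys.admissibleInputs :=
  sys.isGreatest_admissibleInputs.1.1

theorem exists_steers_of_mem_admissibleInputs {u : Input A} (hu : u ∈ sys.admissibleInputs) :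
    ∃ z, Steers sys.X sys.f u sys.x₀ z := by
  obtain ⟨x, hx, -⟩ := sys.isGreatest_admissibleInputs.1.2 u hu
  exact ⟨_, reaches_iff_steers.1 ⟨x, hx, rfl⟩⟩

/-- Short inputs are admissible for a system with analytic vector fields. -/
theorem exists_mem_admissibleInputs_of_duration_lt [Finite A] (hX : IsOpen sys.X)
    (hx₀ : sys.x₀ ∈ sys.X) (hf : ∀ a, AnalyticOnNhd ℝ (sys.f a) sys.X) :
    ∃ ε > 0, ∀ u : Input A, duration u < ε → u ∈ sys.admissibleInputs := by
  obtain ⟨ε, hε, h⟩ := exists_steers_of_duration_lt (hX.mem_nhds hx₀) fun a => hf a _ hx₀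
  have hmem : IsAdmissible {u : Input A | duration u < ε} ∧
      ∀ u ∈ {u : Input A | duration u < ε}, sys.HasUniqueTrajectory u :=
    ⟨isAdmissible_duration_lt, fun v hv => (hasUniqueTrajectory_iff hf).2 (h v hv)⟩
  exact ⟨ε, hε, fun u hu => sys.isGreatest_admissibleInputs.2 hmem hu⟩

end ControlSystem

/-! ### Analytic continuation along families of inputs -/

section Continuation

/-- A function that is analytic on `[0,1]` and vanishes near `0` vanishes at `1`. -/
theorem eq_zero_at_one_of_analyticOn {F : Type*} [NormedAddCommGroup F] [NormedSpace ℝ F]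
    [CompleteSpace F] {g : ℝ → F} (hg : AnalyticOn ℝ g (Set.Icc 0 1)) {η : ℝ} (hη : 0 < η)
    (h : ∀ s ∈ Set.Icc (0 : ℝ) 1, s < η → g s = 0) : g 1 = 0 := by
  let S : Set ℝ := {s | s ∈ Set.Icc (0 : ℝ) 1 ∧ ∀ τ ∈ Set.Icc 0 s, g τ = 0}
  have hη' : min (η / 2) 1 ∈ S := by
    refine ⟨⟨by positivity, min_le_right _ _⟩, fun τ hτ => h τ ⟨hτ.1, hτ.2.trans (min_le_right _ _)⟩
      (lt_of_le_of_lt (hτ.2.trans (min_le_left _ _)) (by linarith))⟩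
  have hSb : BddAbove S := ⟨1, fun s hs => hs.1.2⟩
  set σ := sSup S with hσdef
  have hσ0 : 0 < σ := lt_of_lt_of_le (by positivity) (le_csSup hSb hη')
  have hσ1 : σ ≤ 1 := csSup_le ⟨_, hη'⟩ fun s hs => hs.1.2
  have hlt : ∀ τ, 0 ≤ τ → τ < σ → g τ = 0 := by
    intro τ h0 h1
    obtain ⟨s, hs, hτs⟩ := exists_lt_of_lt_csSup ⟨_, hη'⟩ h1
    exact hs.2 τ ⟨h0, hτs.le⟩
  have hσI : σ ∈ Set.Icc (0 : ℝ) 1 := ⟨hσ0.le, hσ1⟩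
  -- At σ the function is analytic only within [0,1]; G is an analytic extension across σ. Its zeros
  -- accumulate at σ from the left, so it vanishes near σ.
  obtain ⟨G, hG1, hG⟩ := analyticWithinAt_iff_exists_analyticAt.1 (hg σ hσI)
  rw [Set.insert_eq_of_mem hσI] at hG1
  have hGz : ∀ᶠ τ in 𝓝 σ, G τ = 0 := by
    refine hG.frequently_zero_iff_eventually_zero.1 ?_
    have h1 : ∀ᶠ τ in 𝓝[<] σ, G τ = 0 := by
      have h2 : 𝓝[Set.Ioo 0 σ] σ ≤ 𝓝[Set.Icc (0 : ℝ) 1] σ :=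
        nhdsWithin_mono _ fun τ hτ => ⟨hτ.1.le, hτ.2.le.trans hσ1⟩
      rw [← nhdsWithin_Ioo_eq_nhdsLT hσ0]
      filter_upwards [h2 hG1, self_mem_nhdsWithin] with τ h3 h4
      rw [← h3, hlt τ h4.1.le h4.2]
    exact h1.frequently.filter_mono (nhdsWithin_mono _ fun τ hτ => ne_of_lt hτ)
  have hgz : ∀ᶠ τ in 𝓝 σ, τ ∈ Set.Icc (0 : ℝ) 1 → g τ = 0 := by
    filter_upwards [eventually_nhdsWithin_iff.1 hG1, hGz] with τ h1 h2 h3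
    rw [h1 h3, h2]
  obtain ⟨a, b, hab, hsub⟩ := mem_nhds_iff_exists_Ioo_subset.1 hgz
  rcases eq_or_lt_of_le hσ1 with h1 | h1
  · rw [← h1]
    exact hsub hab hσI
  · exfalso
    obtain ⟨τ', h2, h3⟩ := exists_between (lt_min h1 hab.2)
    have h4 : τ' ∈ S := by
      refine ⟨⟨hσ0.le.trans h2.le, h3.le.trans (min_le_left _ _)⟩, fun τ hτ => ?_⟩
      rcases lt_or_ge τ σ with h5 | h5
      · exact hlt τ hτ.1 h5
      · exact hsub ⟨hab.1.trans_le h5, hτ.2.trans_lt (h3.trans_le (min_le_right _ _))⟩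
          ⟨hτ.1, hτ.2.trans (h3.le.trans (min_le_left _ _))⟩
    exact absurd (le_csSup hSb h4) (not_le.2 h2)

variable {A : Type}

/-- The inputs with values `α_i` and durations `p_i + s q_i`, for a list of triples
`(α_i, p_i, q_i)`. -/
def affineWord (L : List (A × ℝ × ℝ)) (s : ℝ) : Input A :=
  L.map fun q => (q.1, (q.2.1 + s * q.2.2).toNNReal)

/-- The durations of `affineWord L s` are given by the affine formulas for `s ∈ [0,1]`. -/
def AffineNonneg (L : List (A × ℝ × ℝ)) : Prop :=
  ∀ q ∈ L, ∀ s ∈ Set.Icc (0 : ℝ) 1, 0 ≤ q.2.1 + s * q.2.2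

/-- The affine family of inputs whose durations are those of `v` multiplied by `s`. -/
def contraction (v : Input A) : List (A × ℝ × ℝ) := v.map fun q => (q.1, 0, (q.2 : ℝ))

/-- The constant affine family. -/
def constantFamily (u : Input A) : List (A × ℝ × ℝ) := u.map fun q => (q.1, (q.2 : ℝ), 0)

theorem affineWord_append (L M : List (A × ℝ × ℝ)) (s : ℝ) :
    affineWord (L ++ M) s = affineWord L s ++ affineWord M s := by
  simp [affineWord]

theorem affineWord_constantFamily (u : Input A) (s : ℝ) :
    affineWord (constantFamily u) s = u := by
  simp [affineWord, constantFamily, Function.comp_def]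

theorem affineWord_contraction (v : Input A) (s : ℝ) :
    affineWord (contraction v) s = v.map fun q => (q.1, (s * q.2).toNNReal) := by
  simp [affineWord, contraction]

theorem affineWord_contraction_one (v : Input A) : affineWord (contraction v) 1 = v := by
  rw [affineWord_contraction]
  simp

theorem affineNonneg_contraction (v : Input A) : AffineNonneg (contraction v) := by
  intro q hq s hs
  obtain ⟨r, -, rfl⟩ := List.mem_map.1 hq
  simpa using mul_nonneg hs.1 r.2.2

theorem affineNonneg_constantFamily (u : Input A) : AffineNonneg (constantFamily u) := by
  intro q hq s hs
  obtain ⟨r, -, rfl⟩ := List.mem_map.1 hq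
  simp

theorem AffineNonneg.append {L M : List (A × ℝ × ℝ)} (hL : AffineNonneg L) (hM : AffineNonneg M) :
    AffineNonneg (L ++ M) := by
  intro q hq
  rcases List.mem_append.1 hq with h | h
  · exact hL q h
  · exact hM q h

theorem dominates_affineWord_contraction (v : Input A) {s : ℝ} (hs : s ∈ Set.Icc (0 : ℝ) 1) :
    Dominates 0 v (affineWord (contraction v) s) := by
  rw [affineWord_contraction]
  refine List.forall₂_map_right_iff.2 (List.forall₂_same.2 fun q _ => ⟨rfl, ?_⟩)
  rw [add_zero, Real.toNNReal_le_iff_le_coe]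
  exact mul_le_of_le_one_left q.2.2 hs.2

theorem duration_affineWord_contraction (v : Input A) {s : ℝ} (hs : 0 ≤ s) :
    duration (affineWord (contraction v) s) = s * duration v := by
  rw [affineWord_contraction]
  induction v with
  | nil => simp
  | cons q v ih =>
    rw [List.map_cons, duration_cons, ih, duration_cons, mul_add]
    simp only
    rw [Real.coe_toNNReal _ (mul_nonneg hs q.2.coe_nonneg)]

theorem coe_le_duration {v : Input A} {q : A × ℝ≥0} (hq : q ∈ v) : (q.2 : ℝ) ≤ duration v := by
  induction v with
  | nil => simp at hq
  | cons r v ih =>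
    rw [duration_cons]
    rcases List.mem_cons.1 hq with rfl | hq
    · linarith [duration_nonneg v]
    · linarith [ih hq, r.2.coe_nonneg]

variable {E : Type*} [NormedAddCommGroup E] [NormedSpace ℝ E] [CompleteSpace E]
  {X : Set E} {f : A → E → E}

/-- The state after the first letter is, by uniqueness, locally the analytic flow evaluated at an
affine time and an analytic initial state. Since that state depends on s, the induction over letters
needs an initial state that varies with s. -/
theorem analyticOn_of_steers_affineWord (hX : IsOpen X) (hf : ∀ a, AnalyticOnNhd ℝ (f a) X)
    {L : List (A × ℝ × ℝ)} (hL : AffineNonneg L) {z e : ℝ → E}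
    (hz : AnalyticOn ℝ z (Set.Icc 0 1))
    (he : ∀ s ∈ Set.Icc (0 : ℝ) 1, Steers X f (affineWord L s) (z s) (e s)) :
    AnalyticOn ℝ e (Set.Icc 0 1) := by
  induction L generalizing z with
  | nil => exact hz.congr fun s hs => (he s hs).2
  | cons q L ih =>
    obtain ⟨a, p, q⟩ := q
    have hnn : ∀ s ∈ Set.Icc (0 : ℝ) 1, 0 ≤ p + s * q :=
      hL (a, p, q) (by simp)
    have h1 : ∀ s, ∃ y, s ∈ Set.Icc (0 : ℝ) 1 →
        FlowsTo X (f a) (p + s * q) (z s) y ∧ Steers X f (affineWord L s) y (e s) := by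
      intro s
      by_cases hs : s ∈ Set.Icc (0 : ℝ) 1
      · obtain ⟨y, hy, hy'⟩ := he s hs
        rw [Real.coe_toNNReal _ (hnn s hs)] at hy
        exact ⟨y, fun _ => ⟨hy, hy'⟩⟩
      · exact ⟨0, fun h => absurd h hs⟩
    choose y hy using h1
    refine ih (z := y) (fun r hr => hL r (by simp [hr])) ?_ fun s hs => (hy s hs).2
    intro s₀ hs₀
    obtain ⟨Ψ, hΨ, hΨf⟩ := exists_analytic_flow hX (hf a) (hnn s₀ hs₀) (hy s₀ hs₀).1
    have hm : AnalyticWithinAt ℝ (fun s => (p + s * q, z s)) (Set.Icc 0 1) s₀ := by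
      have h2 : AnalyticAt ℝ (fun s : ℝ => p + s * q) s₀ :=
        analyticAt_const.add (analyticAt_id.mul analyticAt_const)
      exact h2.analyticWithinAt.prod (hz s₀ hs₀)
    have hc : AnalyticWithinAt ℝ (fun s => Ψ (p + s * q, z s)) (Set.Icc 0 1) s₀ :=
      AnalyticAt.comp_analyticWithinAt hΨ hm
    have hev : ∀ᶠ s in 𝓝[Set.Icc 0 1] s₀, y s = Ψ (p + s * q, z s) := by
      filter_upwards [hm.continuousWithinAt.tendsto.eventually hΨf, self_mem_nhdsWithin] with s h2 h3
      exact (hy s h3).1.unique (hf a) (hnn s h3) (h2 (hnn s h3))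
    exact hc.congr_of_eventuallyEq hev (hev.self_of_nhdsWithin hs₀)

/-- If an analytic function vanishes at the endpoints of an affine family of inputs for small
parameters, then it vanishes at the endpoint for the parameter `1`. -/
theorem eq_zero_of_steers_affineWord (hX : IsOpen X) (hf : ∀ a, AnalyticOnNhd ℝ (f a) X)
    {L : List (A × ℝ × ℝ)} (hL : AffineNonneg L) {x₀ : E}
    (hex : ∀ s ∈ Set.Icc (0 : ℝ) 1, ∃ z, Steers X f (affineWord L s) x₀ z)
    {g : E → ℝ} (hg : AnalyticOnNhd ℝ g X) {η : ℝ} (hη : 0 < η)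
    (h : ∀ s ∈ Set.Icc (0 : ℝ) 1, s < η → ∀ z, Steers X f (affineWord L s) x₀ z → g z = 0)
    {z : E} (hz : Steers X f (affineWord L 1) x₀ z) : g z = 0 := by
  have h1 : ∀ s, ∃ z, s ∈ Set.Icc (0 : ℝ) 1 → Steers X f (affineWord L s) x₀ z := by
    intro s
    by_cases hs : s ∈ Set.Icc (0 : ℝ) 1
    · obtain ⟨z, hz⟩ := hex s hs
      exact ⟨z, fun _ => hz⟩
    · exact ⟨0, fun h => absurd h hs⟩
  choose e he using h1
  have hea : AnalyticOn ℝ e (Set.Icc 0 1) :=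
    analyticOn_of_steers_affineWord hX hf hL analyticOn_const he
  have h2 : AnalyticOn ℝ (fun s => g (e s)) (Set.Icc 0 1) := fun s hs =>
    AnalyticAt.comp_analyticWithinAt (hg _ (he s hs).right_mem) (hea s hs)
  rw [hz.unique hf (he 1 ⟨zero_le_one, le_rfl⟩)]
  exact eq_zero_at_one_of_analyticOn h2 hη fun s hs hsη => h s hs hsη _ (he s hs)

/-- `g` vanishes at all states reached by `u` followed by short inputs. -/
def VanishesAfter (X : Set E) (f : A → E → E) (x₀ : E) (g : E → ℝ) (u : Input A) : Prop :=
  ∀ β : List A, ∃ η > 0, ∀ v : Input A, v.map Prod.fst = β → (∀ q ∈ v, (q.2 : ℝ) < η) →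
    ∀ z, Steers X f (u ++ v) x₀ z → g z = 0

/-- Multiplying the durations of w by s joins w to the empty input within S, and for small s all
letters are shorter than the bound η belonging to the letters of w. -/
theorem eq_zero_of_vanishesAfter_nil (hX : IsOpen X) (hf : ∀ a, AnalyticOnNhd ℝ (f a) X) {x₀ : E}
    {g : E → ℝ} (hg : AnalyticOnNhd ℝ g X) {S : Set (Input A)} (hS : IsAdmissible S)
    (hSX : ∀ u ∈ S, ∃ z, Steers X f u x₀ z) (h : VanishesAfter X f x₀ g []) {w : Input A}
    (hw : w ∈ S) {z : E} (hz : Steers X f w x₀ z) : g z = 0 := by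
  obtain ⟨η, hη, hv⟩ := h (w.map Prod.fst)
  have hw0 := duration_nonneg w
  refine eq_zero_of_steers_affineWord hX hf (affineNonneg_contraction w) (x₀ := x₀)
    (fun s hs => hSX _ (hS.mem_of_dominates_zero hw (dominates_affineWord_contraction w hs))) hg
    (η := η / (duration w + 1)) (by positivity) (fun s hs hsη z' hz' => ?_)
    (by rwa [affineWord_contraction_one])
  refine hv (affineWord (contraction w) s)
    (by simp [affineWord_contraction, Function.comp_def]) (fun q hq => ?_) z' hz'
  refine (coe_le_duration hq).trans_lt ?_
  rw [duration_affineWord_contraction w hs.1]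
  rw [lt_div_iff₀ (by positivity)] at hsη
  nlinarith [hs.1]

/-- For a short v consider the inputs u (α,(1-s)T) v with T slightly larger than t. For small s they
read u (α,t) followed by a short input, where g vanishes by hypothesis; at s = 1 the middle letter
has disappeared. -/
theorem VanishesAfter.of_append_singleton (hX : IsOpen X) (hf : ∀ a, AnalyticOnNhd ℝ (f a) X)
    {x₀ : E} {g : E → ℝ} (hg : AnalyticOnNhd ℝ g X) {S : Set (Input A)} (hS : IsAdmissible S)
    (hSX : ∀ u ∈ S, ∃ z, Steers X f u x₀ z) {u : Input A} {a : A} {t : ℝ≥0}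
    (hu : u ++ [(a, t)] ∈ S) (h : VanishesAfter X f x₀ g (u ++ [(a, t)])) :
    VanishesAfter X f x₀ g u := by
  intro β
  obtain ⟨η, hη, hv⟩ := h (a :: β)
  obtain ⟨δ, hδ, hδS⟩ := hS.exists_extension hu β
  have hδ' : (0 : ℝ) < δ := hδ
  set ρ : ℝ := min η δ with hρdef
  have hρ : 0 < ρ := lt_min hη hδ'
  refine ⟨ρ, hρ, fun v hvβ hvρ z hz => ?_⟩
  -- The surplus ρ/2 keeps (1-s)T ≥ t as long as s < ρ/(2T), and the part exceeding t stays below ρ.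
  set T : ℝ := t + ρ / 2 with hT
  have ht : (0 : ℝ) ≤ t := t.2
  have hT0 : 0 < T := by positivity
  let L : List (A × ℝ × ℝ) := (u.map fun q => (q.1, (q.2 : ℝ), (0 : ℝ))) ++ (a, T, -T) ::
    v.map fun q => (q.1, (q.2 : ℝ), (0 : ℝ))
  have hLw : ∀ s, affineWord L s = u ++ (a, ((1 - s) * T).toNNReal) :: v := by
    intro s
    have h1 : T + -(s * T) = (1 - s) * T := by ring
    simp [affineWord, L, Function.comp_def, h1]
  have hL : AffineNonneg L := by
    intro q hq s hs
    simp only [L, List.mem_append, List.mem_cons, List.mem_map] at hq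
    rcases hq with ⟨r, -, rfl⟩ | rfl | ⟨r, -, rfl⟩
    · simp
    · have : T + s * -T = (1 - s) * T := by ring
      simp only [this]
      exact mul_nonneg (by linarith [hs.2]) hT0.le
    · simp
  refine eq_zero_of_steers_affineWord hX hf hL (x₀ := x₀) ?_ hg
    (η := ρ / (2 * T)) (by positivity) ?_ ?_ (z := z)
  · intro s hs
    rw [hLw]
    have h1 : Dominates δ (u ++ [(a, t)]) (u ++ [(a, ((1 - s) * T).toNNReal)]) := by
      refine (Dominates.refl δ u).append (List.Forall₂.cons ⟨rfl, ?_⟩ List.Forall₂.nil)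
      rw [Real.toNNReal_le_iff_le_coe]
      push_cast
      have h2 : (1 - s) * T ≤ T := mul_le_of_le_one_left hT0.le (by linarith [hs.1])
      linarith [min_le_right η δ]
    have h2 := hδS _ v h1 hvβ fun q hq => by
      have h3 : (q.2 : ℝ) ≤ δ := (hvρ q hq).le.trans (min_le_right _ _)
      exact_mod_cast h3
    simpa using hSX _ h2
  · intro s hs hsη z' hz'
    rw [hLw] at hz'
    rw [lt_div_iff₀ (by positivity)] at hsη
    have h1 : 0 ≤ (1 - s) * T - t := by linarith
    have h2 : (1 - s) * T - t < ρ := by nlinarith [mul_nonneg hs.1 hT0.le]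
    have h3 : ((1 - s) * T).toNNReal = t + ((1 - s) * T - t).toNNReal := by
      rw [← NNReal.coe_inj, NNReal.coe_add, Real.coe_toNNReal _ h1,
        Real.coe_toNNReal _ (by linarith)]
      ring
    rw [h3, steers_append] at hz'
    obtain ⟨y, hy, y', hy', hz'⟩ := hz'
    rw [NNReal.coe_add] at hy'
    obtain ⟨y₁, hy₁, hy₂⟩ := hy'.split t.2 (NNReal.coe_nonneg _)
    refine hv ((a, ((1 - s) * T - t).toNNReal) :: v) (by simp [hvβ]) ?_ z' ?_
    · intro q hq
      rcases List.mem_cons.1 hq with rfl | hq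
      · rw [Real.coe_toNNReal _ h1]
        exact h2.trans_le (min_le_left _ _)
      · exact (hvρ q hq).trans_le (min_le_left _ _)
    · rw [List.append_assoc, List.singleton_append, steers_append]
      exact ⟨y, hy, y₁, hy₁, y', hy₂, hz'⟩
  · rw [hLw]
    rw [steers_append] at hz ⊢
    obtain ⟨y, hy, hz⟩ := hz
    refine ⟨y, hy, ?_⟩
    simpa [steers_zero_cons] using hz

/-- If an analytic function vanishes at all states reached by a fixed admissible input followed by
short inputs, then it vanishes at all states that are reached by admissible inputs. -/
theorem eq_zero_of_vanishesAfter (hX : IsOpen X) (hf : ∀ a, AnalyticOnNhd ℝ (f a) X) {x₀ : E}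
    {g : E → ℝ} (hg : AnalyticOnNhd ℝ g X) {S : Set (Input A)} (hS : IsAdmissible S)
    (hSX : ∀ u ∈ S, ∃ z, Steers X f u x₀ z) {u : Input A} (hu : u ∈ S)
    (h : VanishesAfter X f x₀ g u) {w : Input A} (hw : w ∈ S) {z : E}
    (hz : Steers X f w x₀ z) : g z = 0 := by
  induction u using List.reverseRecOn with
  | nil => exact eq_zero_of_vanishesAfter_nil hX hf hg hS hSX h hw hz
  | append_singleton u q ih =>
    refine ih ?_ (h.of_append_singleton hX hf hg hS hSX hu)
    -- Shrinking the last letter to duration 0 gives a word that describes the same input as u.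
    have h1 : u ++ [(q.1, 0)] ∈ S := by
      refine hS.mem_of_dominates_zero hu ?_
      exact (Dominates.refl 0 u).append (List.Forall₂.cons ⟨rfl, zero_le⟩ List.Forall₂.nil)
    refine hS.saturated _ _ ?_ h1
    clear * -
    induction u with
    | nil =>
      intro s hs
      simp [value, not_lt.2 hs]
    | cons r u ih =>
      obtain ⟨b, t⟩ := r
      intro s hs
      simp only [List.cons_append, value]
      split_ifs with h
      · rfl
      · exact ih _ (by linarith)

end Continuation

/-! ### Derivations and transcendence degree -/

section Algebra

variable {F B : Type} [Field F] [CommRing B] [IsDomain B] [Algebra F B]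

open Algebra in
/-- A derivation maps elements that are algebraic over `F[x]` to such elements if it does so with
the generators. -/
theorem isAlgebraic_derivation [CharZero F] {s : Set B} (D : Derivation F B B)
    (hD : ∀ y ∈ s, IsAlgebraic (adjoin F s) (D y)) {g : B}
    (hg : IsAlgebraic (adjoin F s) g) : IsAlgebraic (adjoin F s) (D g) := by
  have hch : CharZero B := charZero_of_injective_algebraMap (algebraMap F B).injective
  have hch' : CharZero (adjoin F s) := charZero_of_injective_algebraMap
    (algebraMap F (adjoin F s)).injective
  have hs : ∀ c ∈ adjoin F s, IsAlgebraic (adjoin F s) (D c) := by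
    intro c hc
    induction hc using adjoin_induction with
    | mem y hy => exact hD y hy
    | algebraMap r => simpa using isAlgebraic_zero
    | add a b _ _ ha hb => simpa using ha.add hb
    | mul a b ha' hb' ha hb =>
      rw [D.leibniz, smul_eq_mul, smul_eq_mul]
      exact ((isAlgebraic_algebraMap (⟨a, ha'⟩ : adjoin F s)).mul hb).add
        ((isAlgebraic_algebraMap (⟨b, hb'⟩ : adjoin F s)).mul ha)
  -- This is D(p(g)) = p^D(g) + p'(g) D(g), where p^D has the coefficients of p differentiated. For
  -- a non-zero p of least degree with p(g) = 0 one has p'(g) ≠ 0, and D(g) can be solved for.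
  have key : ∀ p : Polynomial (adjoin F s), ∃ k : B, IsAlgebraic (adjoin F s) k ∧
      D (Polynomial.aeval g p) = k + Polynomial.aeval g p.derivative * D g := by
    intro p
    induction p using Polynomial.induction_on' with
    | add p q hp hq =>
      obtain ⟨k, hk, e⟩ := hp
      obtain ⟨l, hl, e'⟩ := hq
      refine ⟨k + l, hk.add hl, ?_⟩
      simp only [map_add, e, e']
      ring
    | monomial m c =>
      refine ⟨g ^ m * D c, (hg.pow m).mul (hs c c.2), ?_⟩
      rw [Polynomial.aeval_monomial, Polynomial.derivative_monomial, Polynomial.aeval_monomial,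
        D.leibniz, D.leibniz_pow]
      simp only [smul_eq_mul, nsmul_eq_mul, map_mul, map_natCast]
      have : algebraMap (adjoin F s) B c = (c : B) := rfl
      rw [this]
      ring
  let P : ℕ → Prop := fun m => ∃ p : Polynomial (adjoin F s), p ≠ 0 ∧
    Polynomial.aeval g p = 0 ∧ p.natDegree = m
  classical
  have hP : ∃ m, P m := by
    obtain ⟨p, hp, h⟩ := hg
    exact ⟨_, p, hp, h, rfl⟩
  obtain ⟨p, hp0, hp, hdeg⟩ := Nat.find_spec hP
  have hder : Polynomial.aeval g p.derivative ≠ 0 := by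
    intro h
    by_cases h0 : p.natDegree = 0
    · rw [Polynomial.eq_C_of_natDegree_eq_zero h0, Polynomial.aeval_C,
        FaithfulSMul.algebraMap_eq_zero_iff] at hp
      apply hp0
      rw [Polynomial.eq_C_of_natDegree_eq_zero h0, hp, Polynomial.C_0]
    · have h1 : p.derivative ≠ 0 := fun h2 =>
        h0 (Polynomial.derivative_eq_zero.1 h2)
      have h2 := Nat.find_min' hP ⟨p.derivative, h1, h, rfl⟩
      have h3 := Polynomial.natDegree_derivative_lt h0
      omega
  obtain ⟨k, hk, e⟩ := key p
  rw [hp, map_zero] at e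
  refine IsAlgebraic.of_mul (mem_nonZeroDivisors_of_ne_zero hder) ?_ (?_ : IsAlgebraic _
    (Polynomial.aeval g p.derivative * D g))
  · exact isAlgebraic_adjoin_singleton_iff.mpr hg _ (Polynomial.aeval_mem_adjoin_singleton _ _)
  · rw [show Polynomial.aeval g p.derivative * D g = -k by linear_combination -e]
    exact hk.neg

/-- The elements of `B` which are algebraic over the subalgebra generated by `s`. -/
def algebraicOver (F : Type) [Field F] [Algebra F B] (s : Set B) : Subalgebra F B :=
  (Subalgebra.algebraicClosure (Algebra.adjoin F s) B).restrictScalars F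

theorem mem_algebraicOver {s : Set B} {g : B} :
    g ∈ algebraicOver F s ↔ IsAlgebraic (Algebra.adjoin F s) g := Iff.rfl

/-- The generated algebra is a polynomial ring in d variables, and by additivity of the
transcendence degree an algebraic extension adds nothing. -/
theorem trdeg_algebraicOver {d : ℕ} {x : Fin d → B} (hx : AlgebraicIndependent F x) :
    Algebra.trdeg F (algebraicOver F (Set.range x)) = d := by
  have h1 : Algebra.trdeg F (Algebra.adjoin F (Set.range x)) = d := by
    rw [← hx.aevalEquiv.trdeg_eq, MvPolynomial.trdeg_of_isDomain]
    simp
  have hinj : FaithfulSMul (Algebra.adjoin F (Set.range x))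
      (Subalgebra.algebraicClosure (Algebra.adjoin F (Set.range x)) B) := by
    rw [faithfulSMul_iff_algebraMap_injective]
    intro a b hab
    exact Subtype.ext (congrArg (Subtype.val : Subalgebra.algebraicClosure
      (Algebra.adjoin F (Set.range x)) B → B) hab)
  have h2 := trdeg_add_eq F (Algebra.adjoin F (Set.range x))
    (A := Subalgebra.algebraicClosure (Algebra.adjoin F (Set.range x)) B)
  rw [h1, trdeg_eq_zero, add_zero] at h2
  exact h2.symm

theorem trdeg_le_of_le_algebraicOver {d : ℕ} {x : Fin d → B} (hx : AlgebraicIndependent F x)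
    {C : Type} [CommRing C] [Algebra F C] (φ : C →ₐ[F] B) (hφ : Function.Injective φ)
    (h : ∀ c, φ c ∈ algebraicOver F (Set.range x)) : Algebra.trdeg F C ≤ d := by
  rw [← trdeg_algebraicOver hx]
  refine trdeg_le_of_injective (φ.codRestrict _ h) fun a b hab => hφ ?_
  exact congrArg Subtype.val hab

end Algebra

/-! ### Analytic functions on an open set -/

section Analytic

variable {n : ℕ}

/-- The algebra of analytic functions on `X`. -/
def analyticAlgebra (X : Set (Fin n → ℝ)) : Subalgebra ℝ (X → ℝ) where
  carrier := {g | ∃ G : (Fin n → ℝ) → ℝ, AnalyticOnNhd ℝ G X ∧ g = fun x : X => G x}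
  mul_mem' := by
    rintro _ _ ⟨G, hG, rfl⟩ ⟨H, hH, rfl⟩
    exact ⟨fun x => G x * H x, hG.mul hH, rfl⟩
  add_mem' := by
    rintro _ _ ⟨G, hG, rfl⟩ ⟨H, hH, rfl⟩
    exact ⟨fun x => G x + H x, hG.add hH, rfl⟩
  algebraMap_mem' c := ⟨fun _ => c, analyticOnNhd_const, rfl⟩

/-- If GH = 0 and G does not vanish at x, then H vanishes near x, hence on the connected set X by
the identity theorem. -/
theorem isDomain_analyticAlgebra {X : Set (Fin n → ℝ)} (hX : IsOpen X) (hc : IsConnected X) :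
    IsDomain (analyticAlgebra X) := by
  have : Nonempty X := hc.nonempty.to_subtype
  have : NoZeroDivisors (analyticAlgebra X) := by
    refine ⟨?_⟩
    rintro ⟨_, G, hG, rfl⟩ ⟨_, H, hH, rfl⟩ h
    by_contra! hne
    obtain ⟨x, hx⟩ : ∃ x : X, G x ≠ 0 := by
      by_contra! h0
      exact hne.1 (Subtype.ext (funext h0))
    apply hne.2
    have hev : H =ᶠ[𝓝 (x : Fin n → ℝ)] 0 := by
      filter_upwards [(hG x x.2).continuousAt.eventually_ne hx, hX.mem_nhds x.2] with y hy hyX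
      have h1 : G y * H y = 0 := congrFun (congrArg Subtype.val h) ⟨y, hyX⟩
      exact (mul_eq_zero.1 h1).resolve_left hy
    have h2 := hH.eqOn_zero_of_preconnected_of_eventuallyEq_zero hc.isPreconnected x.2 hev
    exact Subtype.ext (funext fun y => h2 y.2)
  have : Nontrivial (analyticAlgebra X) := inferInstance
  exact NoZeroDivisors.to_isDomain _

namespace ControlSystem

variable {A : Type} {r : ℕ} {sys : ControlSystem A n r}

/-- Only the germ of g at x matters. The local form is needed for functions that are known as
pull-backs near one state only. -/
theorem lieDeriv_apply (hX : IsOpen sys.X) (a : A) {g : sys.X → ℝ} {G : (Fin n → ℝ) → ℝ}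
    {x : sys.X} (hg : ∀ᶠ y in 𝓝 x, g y = G y) :
    sys.lieDeriv a g x = fderiv ℝ G x (sys.f a x) := by
  have h : Function.extend Subtype.val g 0 =ᶠ[𝓝 (x : Fin n → ℝ)] G := by
    have h1 : ∀ᶠ y : Fin n → ℝ in 𝓝 (x : Fin n → ℝ), ∀ hy : y ∈ sys.X, g ⟨y, hy⟩ = G y := by
      rw [nhds_subtype_eq_comap, Filter.eventually_comap] at hg
      filter_upwards [hg] with y hy hyX using hy ⟨y, hyX⟩ rfl
    filter_upwards [hX.mem_nhds x.2, h1] with y hy h2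
    rw [← h2 hy]
    exact Subtype.val_injective.extend_apply g 0 ⟨y, hy⟩
  rw [lieDeriv, h.fderiv_eq]

theorem lieDeriv_comp_val (hX : IsOpen sys.X) (a : A) (G : (Fin n → ℝ) → ℝ) (x : sys.X) :
    sys.lieDeriv a (fun y => G y) x = fderiv ℝ G x (sys.f a x) :=
  lieDeriv_apply hX a (Filter.Eventually.of_forall fun _ => rfl)

theorem lieDeriv_mem_analyticAlgebra (hX : IsOpen sys.X) {a : A}
    (hf : AnalyticOnNhd ℝ (sys.f a) sys.X) {g : sys.X → ℝ} (hg : g ∈ analyticAlgebra sys.X) :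
    sys.lieDeriv a g ∈ analyticAlgebra sys.X := by
  obtain ⟨G, hG, rfl⟩ := hg
  refine ⟨fun x => fderiv ℝ G x (sys.f a x), ?_, funext fun x => lieDeriv_comp_val hX a G x⟩
  intro x hx
  exact AnalyticAt.comp (f := fun y => (fderiv ℝ G y, sys.f a y))
    ((ContinuousLinearMap.id ℝ ((Fin n → ℝ) →L[ℝ] ℝ)).analyticAt_bilinear
      (fderiv ℝ G x, sys.f a x)) ((hG.fderiv x hx).prod (hf x hx))

/-- The Lie derivative as a derivation on the algebra of analytic functions. -/
def lieDerivation (sys : ControlSystem A n r) (hX : IsOpen sys.X) (a : A)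
    (hf : AnalyticOnNhd ℝ (sys.f a) sys.X) :
    Derivation ℝ (analyticAlgebra sys.X) (analyticAlgebra sys.X) :=
  Derivation.mk'
    { toFun := fun g => ⟨sys.lieDeriv a g, lieDeriv_mem_analyticAlgebra hX hf g.2⟩
      map_add' := by
        rintro ⟨_, G, hG, rfl⟩ ⟨_, H, hH, rfl⟩
        ext x
        change sys.lieDeriv a (fun y : sys.X => G y + H y) x =
          sys.lieDeriv a (fun y => G y) x + sys.lieDeriv a (fun y => H y) x
        rw [lieDeriv_comp_val hX a fun z => G z + H z, lieDeriv_comp_val hX, lieDeriv_comp_val hX,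
          fderiv_fun_add (hG x x.2).differentiableAt (hH x x.2).differentiableAt]
        rfl
      map_smul' := by
        rintro c ⟨_, G, hG, rfl⟩
        ext x
        change sys.lieDeriv a (fun y : sys.X => c * G y) x =
          c * sys.lieDeriv a (fun y => G y) x
        rw [lieDeriv_comp_val hX a fun z => c * G z, lieDeriv_comp_val hX, fderiv_const_mul (hG x x.2).differentiableAt]
        rfl }
    (by
      rintro ⟨_, G, hG, rfl⟩ ⟨_, H, hH, rfl⟩
      ext x
      change sys.lieDeriv a (fun y : sys.X => G y * H y) x =
        G x * sys.lieDeriv a (fun y => H y) x + H x * sys.lieDeriv a (fun y => G y) x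
      rw [lieDeriv_comp_val hX a fun z => G z * H z, lieDeriv_comp_val hX, lieDeriv_comp_val hX,
        fderiv_fun_mul (hG x x.2).differentiableAt (hH x x.2).differentiableAt]
      rfl)

end ControlSystem

/-- The coordinate functions on `X`. -/
def coord (X : Set (Fin n → ℝ)) (i : Fin n) : analyticAlgebra X :=
  ⟨fun x => (x : Fin n → ℝ) i, fun x => x i,
    (ContinuousLinearMap.proj (R := ℝ) (φ := fun _ : Fin n => ℝ) i).analyticOnNhd _, rfl⟩

theorem aeval_coord_apply {X : Set (Fin n → ℝ)} (P : MvPolynomial (Fin n) ℝ) (x : X) :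
    (MvPolynomial.aeval (coord X) P : analyticAlgebra X).1 x =
      MvPolynomial.eval (x : Fin n → ℝ) P := by
  induction P using MvPolynomial.induction_on with
  | C c => simp
  | add p q hp hq =>
    rw [map_add, map_add, ← hp, ← hq]
    rfl
  | mul_X p i hp =>
    rw [map_mul, map_mul, ← hp, MvPolynomial.aeval_X, MvPolynomial.eval_X]
    rfl

theorem analyticOnNhd_eval (P : MvPolynomial (Fin n) ℝ) (X : Set (Fin n → ℝ)) :
    AnalyticOnNhd ℝ (fun x => MvPolynomial.eval x P) X := by
  induction P using MvPolynomial.induction_on with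
  | C c => simpa using analyticOnNhd_const
  | add p q hp hq =>
    simp only [map_add]
    exact hp.add hq
  | mul_X p i hp =>
    simp only [map_mul, MvPolynomial.eval_X]
    exact hp.mul
      ((ContinuousLinearMap.proj (R := ℝ) (φ := fun _ : Fin n => ℝ) i).analyticOnNhd X)

/-- A polynomial that vanishes on a non-empty open set is zero. -/
theorem mvPolynomial_eq_zero_of_eventually {P : MvPolynomial (Fin n) ℝ} {x : Fin n → ℝ}
    (h : ∀ᶠ y in 𝓝 x, MvPolynomial.eval y P = 0) : P = 0 := by
  have h1 := (analyticOnNhd_eval P Set.univ).eqOn_zero_of_preconnected_of_eventuallyEq_zero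
    isPreconnected_univ (Set.mem_univ x) h
  exact MvPolynomial.funext fun y => by simpa using h1 (Set.mem_univ y)

theorem algebraicIndependent_coord {X : Set (Fin n → ℝ)} (hX : IsOpen X) (hne : X.Nonempty) :
    AlgebraicIndependent ℝ (coord X) := by
  rw [algebraicIndependent_iff]
  intro P hP
  obtain ⟨x, hx⟩ := hne
  refine mvPolynomial_eq_zero_of_eventually (x := x) ?_
  filter_upwards [hX.mem_nhds hx] with y hy
  rw [← aeval_coord_apply P ⟨y, hy⟩, hP]
  rfl

end Analytic

/-! ### Semi-algebraic sets -/

section Semialgebraic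

variable {ι κ : Type}

theorem isSemialgebraic_univ : IsSemialgebraic (Set.univ : Set (ι → ℝ)) :=
  ⟨{(∅, ∅)}, by simp⟩

theorem isSemialgebraic_eval_eq_zero (P : MvPolynomial ι ℝ) :
    IsSemialgebraic {x | MvPolynomial.eval x P = 0} :=
  ⟨{({P}, ∅)}, by simp⟩

theorem isSemialgebraic_eval_pos (P : MvPolynomial ι ℝ) :
    IsSemialgebraic {x | 0 < MvPolynomial.eval x P} :=
  ⟨{(∅, {P})}, by simp⟩

theorem IsSemialgebraic.inter {A B : Set (ι → ℝ)} (hA : IsSemialgebraic A)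
    (hB : IsSemialgebraic B) : IsSemialgebraic (A ∩ B) := by
  classical
  obtain ⟨F, rfl⟩ := hA
  obtain ⟨G, rfl⟩ := hB
  refine ⟨(F ×ˢ G).image fun c => (c.1.1 ∪ c.2.1, c.1.2 ∪ c.2.2), ?_⟩
  ext x
  constructor
  · rintro ⟨⟨c, hc, h1, h2⟩, ⟨e, he, h3, h4⟩⟩
    refine ⟨_, Finset.mem_image_of_mem _ (Finset.mk_mem_product hc he), ?_, ?_⟩
    · intro P hP
      exact (Finset.mem_union.1 hP).elim (h1 P) (h3 P)
    · intro P hP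
      exact (Finset.mem_union.1 hP).elim (h2 P) (h4 P)
  · rintro ⟨_, h, h1, h2⟩
    obtain ⟨⟨c, e⟩, hce, rfl⟩ := Finset.mem_image.1 h
    obtain ⟨hc, he⟩ := Finset.mem_product.1 hce
    exact ⟨⟨c, hc, fun P hP => h1 P (Finset.mem_union_left _ hP),
      fun P hP => h2 P (Finset.mem_union_left _ hP)⟩,
      ⟨e, he, fun P hP => h1 P (Finset.mem_union_right _ hP),
      fun P hP => h2 P (Finset.mem_union_right _ hP)⟩⟩

theorem isSemialgebraic_iInter {τ : Type} [Finite τ] {A : τ → Set (ι → ℝ)}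
    (hA : ∀ t, IsSemialgebraic (A t)) : IsSemialgebraic (⋂ t, A t) := by
  classical
  have := Fintype.ofFinite τ
  have key : ∀ s : Finset τ, IsSemialgebraic (⋂ t ∈ s, A t) := by
    intro s
    induction s using Finset.induction_on with
    | empty => simpa using isSemialgebraic_univ
    | insert t s _ ih =>
      rw [Finset.set_biInter_insert]
      exact (hA t).inter ih
  simpa using key Finset.univ

theorem IsSemialgebraic.preimage_comp {A : Set (ι → ℝ)} (hA : IsSemialgebraic A) (σ : ι → κ) :
    IsSemialgebraic {y : κ → ℝ | y ∘ σ ∈ A} := by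
  classical
  obtain ⟨F, rfl⟩ := hA
  refine ⟨F.image fun c => (c.1.image (MvPolynomial.rename σ), c.2.image (MvPolynomial.rename σ)),
    ?_⟩
  ext y
  constructor
  · rintro ⟨c, hc, h1, h2⟩
    refine ⟨_, Finset.mem_image_of_mem _ hc, ?_, ?_⟩
    · intro P hP
      obtain ⟨Q, hQ, rfl⟩ := Finset.mem_image.1 hP
      rw [MvPolynomial.eval_rename]
      exact h1 Q hQ
    · intro P hP
      obtain ⟨Q, hQ, rfl⟩ := Finset.mem_image.1 hP
      rw [MvPolynomial.eval_rename]
      exact h2 Q hQ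
  · rintro ⟨_, h, h1, h2⟩
    obtain ⟨c, hc, rfl⟩ := Finset.mem_image.1 h
    refine ⟨c, hc, fun P hP => ?_, fun P hP => ?_⟩
    · rw [← MvPolynomial.eval_rename]
      exact h1 _ (Finset.mem_image_of_mem _ hP)
    · rw [← MvPolynomial.eval_rename]
      exact h2 _ (Finset.mem_image_of_mem _ hP)

theorem isSemialgebraic_ball [Fintype ι] (z : ι → ℝ) {ρ : ℝ} (hρ : 0 < ρ) :
    IsSemialgebraic (Metric.ball z ρ) := by
  have h : Metric.ball z ρ = ⋂ i, ({x : ι → ℝ | 0 < MvPolynomial.eval x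
      (MvPolynomial.X i - MvPolynomial.C (z i - ρ))} ∩ {x : ι → ℝ | 0 < MvPolynomial.eval x
      (MvPolynomial.C (z i + ρ) - MvPolynomial.X i)}) := by
    ext x
    simp only [Metric.mem_ball, dist_pi_lt_iff hρ, Real.dist_eq, abs_sub_lt_iff, Set.mem_iInter]
    refine forall_congr' fun i => ?_
    simp only [Set.mem_inter_iff, Set.mem_ofPred_eq, map_sub, MvPolynomial.eval_X,
      MvPolynomial.eval_C]
    constructor <;> rintro ⟨h1, h2⟩ <;> constructor <;> linarith
  rw [h]
  exact isSemialgebraic_iInter fun i =>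
    (isSemialgebraic_eval_pos _).inter (isSemialgebraic_eval_pos _)

end Semialgebraic

/-! ### Nash functions -/

section Nash

variable {n : ℕ} {X : Set (Fin n → ℝ)}

theorem isSemialgebraic_init_mem (hX : IsSemialgebraic X) :
    IsSemialgebraic {y : Fin (n + 1) → ℝ | Fin.init y ∈ X} :=
  hX.preimage_comp Fin.castSucc

theorem isNashOn_eval (hX : IsSemialgebraic X) (P : MvPolynomial (Fin n) ℝ) :
    IsNashOn X fun x => MvPolynomial.eval x P := by
  refine ⟨analyticOnNhd_eval P X, ?_⟩
  have h := (isSemialgebraic_init_mem hX).inter (isSemialgebraic_eval_eq_zero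
    (MvPolynomial.X (Fin.last n) - MvPolynomial.rename Fin.castSucc P))
  unfold IsSemialgebraicFunOn
  convert h using 1
  ext y
  have : (Fin.init y : Fin n → ℝ) = y ∘ Fin.castSucc := rfl
  simp [sub_eq_zero, MvPolynomial.eval_rename, this]

theorem IsNashOn.mono {Y : Set (Fin n → ℝ)} {g : (Fin n → ℝ) → ℝ} (hg : IsNashOn X g)
    (hYX : Y ⊆ X) (hY : IsSemialgebraic Y) : IsNashOn Y g := by
  refine ⟨hg.1.mono hYX, ?_⟩
  have h := (isSemialgebraic_init_mem hY).inter hg.2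
  unfold IsSemialgebraicFunOn
  convert h using 1
  ext y
  simp only [Set.mem_ofPred_eq, Set.mem_inter_iff]
  exact ⟨fun h => ⟨h.1, hYX h.1, h.2⟩, fun h => ⟨h.1, h.2.2⟩⟩

/-- The graph of a semi-algebraic function satisfies a non-trivial polynomial equation. -/
theorem IsSemialgebraicFunOn.exists_relation {g : (Fin n → ℝ) → ℝ}
    (hg : IsSemialgebraicFunOn X g) : ∃ P : MvPolynomial (Fin (n + 1)) ℝ, P ≠ 0 ∧
      ∀ x ∈ X, MvPolynomial.eval (Fin.snoc x (g x) : Fin (n + 1) → ℝ) P = 0 := by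
  obtain ⟨F, hF⟩ := hg
  have key : ∀ c ∈ F, ∃ P : MvPolynomial (Fin (n + 1)) ℝ, P ≠ 0 ∧
      ∀ y : Fin (n + 1) → ℝ, (∀ P ∈ c.1, MvPolynomial.eval y P = 0) →
        (∀ Q ∈ c.2, 0 < MvPolynomial.eval y Q) → MvPolynomial.eval y P = 0 := by
    intro c hc
    by_cases h0 : ∃ P ∈ c.1, P ≠ 0
    · obtain ⟨P, hP, hP0⟩ := h0
      exact ⟨P, hP0, fun y h1 _ => h1 P hP⟩
    -- All equations of this piece are trivial, so the piece is open and, if non-empty, contains a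
    -- vertical segment, which a graph does not. Hence it is empty and the constant 1 serves as
    -- witness.
    · push Not at h0
      refine ⟨1, one_ne_zero, fun y h1 h2 => ?_⟩
      exfalso
      have hmem : ∀ y' : Fin (n + 1) → ℝ, (∀ Q ∈ c.2, 0 < MvPolynomial.eval y' Q) →
          Fin.init y' ∈ X ∧ y' (Fin.last n) = g (Fin.init y') := by
        intro y' hy'
        have : y' ∈ {y : Fin (n + 1) → ℝ | Fin.init y ∈ X ∧ y (Fin.last n) = g (Fin.init y)} := by
          rw [hF]
          refine ⟨c, hc, fun P hP => ?_, hy'⟩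
          rw [h0 P hP, map_zero]
        exact this
      let γ : ℝ → Fin (n + 1) → ℝ := fun s => Fin.snoc (Fin.init y) s
      have hγ : Continuous γ := by
        refine continuous_pi fun i => ?_
        refine Fin.lastCases ?_ (fun j => ?_) i
        · simpa [γ] using continuous_id'
        · simpa [γ] using continuous_const
      have hγ0 : γ (y (Fin.last n)) = y := Fin.snoc_init_self y
      have hev : ∀ᶠ s in 𝓝 (y (Fin.last n)), ∀ Q ∈ c.2, 0 < MvPolynomial.eval (γ s) Q := by
        rw [Filter.eventually_all_finset]
        intro Q hQ
        have hc : Continuous fun s => MvPolynomial.eval (γ s) Q :=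
          (MvPolynomial.continuous_eval Q).comp hγ
        refine hc.continuousAt.eventually (lt_mem_nhds ?_)
        simp only [hγ0]
        exact h2 Q hQ
      have hev' : ∀ᶠ s in 𝓝 (y (Fin.last n)), s = y (Fin.last n) := by
        filter_upwards [hev] with s hs
        have h3 := (hmem _ hs).2
        have h4 := (hmem _ h2).2
        simp only [γ, Fin.snoc_last, Fin.init_snoc] at h3
        rw [h3, h4]
      obtain ⟨a, b, hab, hsub⟩ := mem_nhds_iff_exists_Ioo_subset.1 hev'
      obtain ⟨s, hs1, hs2⟩ := exists_between hab.2
      exact hs1.ne' (hsub ⟨hab.1.trans hs1, hs2⟩)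
  choose! P hP0 hP using key
  refine ⟨∏ c ∈ F, P c, Finset.prod_ne_zero_iff.2 hP0, fun x hx => ?_⟩
  have hmem : (Fin.snoc x (g x) : Fin (n + 1) → ℝ) ∈
      {y : Fin (n + 1) → ℝ | Fin.init y ∈ X ∧ y (Fin.last n) = g (Fin.init y)} := by
    simpa using hx
  rw [hF] at hmem
  obtain ⟨c, hc, h1, h2⟩ := hmem
  rw [map_prod]
  exact Finset.prod_eq_zero hc (hP c hc _ h1 h2)

/-- The analytic functions on `X` which are algebraic over the polynomials. -/
def algebraicAnalytic (X : Set (Fin n → ℝ)) [IsDomain (analyticAlgebra X)] :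
    Subalgebra ℝ (X → ℝ) :=
  (algebraicOver ℝ (Set.range (coord X))).map (analyticAlgebra X).val

theorem mem_algebraicAnalytic [IsDomain (analyticAlgebra X)] {g : X → ℝ} :
    g ∈ algebraicAnalytic X ↔ ∃ h : g ∈ analyticAlgebra X,
      (⟨g, h⟩ : analyticAlgebra X) ∈ algebraicOver ℝ (Set.range (coord X)) := by
  constructor
  · rintro ⟨k, hk, rfl⟩
    exact ⟨k.2, hk⟩
  · rintro ⟨h, hg⟩
    exact ⟨_, hg, rfl⟩

theorem nonempty_of_isDomain_analyticAlgebra [IsDomain (analyticAlgebra X)] : X.Nonempty := by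
  by_contra h
  rw [Set.not_nonempty_iff_eq_empty] at h
  have h1 : (0 : analyticAlgebra X) ≠ 1 := zero_ne_one
  refine h1 (Subtype.ext (funext fun x => ?_))
  exact absurd x.2 (by simp [h])

/-- If g were transcendental over the coordinates, the coordinates and g would be n + 1
algebraically independent functions, against the polynomial relation satisfied by the graph. -/
theorem IsNashOn.mem_algebraicAnalytic [IsDomain (analyticAlgebra X)] (hX : IsOpen X)
    {g : (Fin n → ℝ) → ℝ} (hg : IsNashOn X g) : (fun x : X => g x) ∈ algebraicAnalytic X := by
  have hga : (fun x : X => g x) ∈ analyticAlgebra X := ⟨g, hg.1, rfl⟩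
  rw [NashSys.mem_algebraicAnalytic]
  refine ⟨hga, ?_⟩
  rw [mem_algebraicOver]
  by_contra htr
  have hind := ((algebraicIndependent_coord hX
    nonempty_of_isDomain_analyticAlgebra).option_iff_transcendental _).2 htr
  obtain ⟨P, hP0, hP⟩ := hg.2.exists_relation
  let σ : Fin (n + 1) → Option (Fin n) := finSuccEquivLast
  have hσ : Function.Injective σ := finSuccEquivLast.injective
  have hPσ : MvPolynomial.rename σ P ≠ 0 := by
    rw [Ne, map_eq_zero_iff _ (MvPolynomial.rename_injective σ hσ)]
    exact hP0
  apply hPσ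
  refine (algebraicIndependent_iff.1 hind) _ ?_
  rw [MvPolynomial.aeval_rename]
  refine Subtype.ext (funext fun x => ?_)
  have hval : ∀ (v : Fin (n + 1) → analyticAlgebra X) (Q : MvPolynomial (Fin (n + 1)) ℝ),
      (MvPolynomial.aeval v Q : analyticAlgebra X).1 x =
        MvPolynomial.eval (fun i => (v i).1 x) Q := by
    intro v Q
    induction Q using MvPolynomial.induction_on with
    | C c => simp
    | add p q hp hq =>
      rw [map_add, map_add, ← hp, ← hq]
      rfl
    | mul_X p i hp =>
      rw [map_mul, map_mul, ← hp, MvPolynomial.aeval_X, MvPolynomial.eval_X]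
      rfl
  rw [hval]
  have hv : (fun i => (((fun o : Option (Fin n) => o.elim
      (⟨fun x : X => g x, hga⟩ : analyticAlgebra X) (coord X)) ∘ σ) i).1 x) =
      (Fin.snoc (x : Fin n → ℝ) (g x) : Fin (n + 1) → ℝ) := by
    funext i
    refine Fin.lastCases ?_ (fun j => ?_) i
    · simp [σ]
    · simp [σ, coord]
  rw [hv, hP x x.2]
  rfl

theorem coord_mem_nashAlgebra (hX : IsSemialgebraic X) (i : Fin n) :
    (coord X i : X → ℝ) ∈ nashAlgebra X :=
  Algebra.subset_adjoin ⟨fun x => MvPolynomial.eval x (MvPolynomial.X i),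
    isNashOn_eval hX _, by ext x; simp [coord]⟩

theorem nashAlgebra_le [IsDomain (analyticAlgebra X)] (hX : IsOpen X) :
    nashAlgebra X ≤ algebraicAnalytic X := by
  refine Algebra.adjoin_le ?_
  rintro _ ⟨G, hG, rfl⟩
  exact hG.mem_algebraicAnalytic hX

theorem trdeg_le_of_le_algebraicAnalytic [IsDomain (analyticAlgebra X)] (hX : IsOpen X)
    {C : Subalgebra ℝ (X → ℝ)} (hC : C ≤ algebraicAnalytic X) : Algebra.trdeg ℝ C ≤ n := by
  have hC' : ∀ c : C, (c : X → ℝ) ∈ analyticAlgebra X := fun c =>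
    (mem_algebraicAnalytic.1 (hC c.2)).1
  refine trdeg_le_of_le_algebraicOver
    (algebraicIndependent_coord hX nonempty_of_isDomain_analyticAlgebra)
    (C.val.codRestrict (analyticAlgebra X) hC') ?_ ?_
  · intro a b hab
    exact Subtype.ext (congrArg (Subtype.val : analyticAlgebra X → X → ℝ) hab)
  · intro c
    exact (mem_algebraicAnalytic.1 (hC c.2)).2

/-- The algebra lies between the polynomials and `algebraicAnalytic X`, and the bound n is attained
by the coordinates. -/
theorem trdeg_nashAlgebra [IsDomain (analyticAlgebra X)] (hX : IsOpen X)
    (hX' : IsSemialgebraic X) : Algebra.trdeg ℝ (nashAlgebra X) = n := by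
  refine le_antisymm (trdeg_le_of_le_algebraicAnalytic hX (nashAlgebra_le hX)) ?_
  let x : Fin n → nashAlgebra X := fun i => ⟨coord X i, coord_mem_nashAlgebra hX' i⟩
  have hx : AlgebraicIndependent ℝ x := by
    have h1 : AlgebraicIndependent ℝ (fun i => (coord X i : X → ℝ)) :=
      (algebraicIndependent_coord hX nonempty_of_isDomain_analyticAlgebra).map'
        (f := (analyticAlgebra X).val) Subtype.val_injective
    exact AlgebraicIndependent.of_comp (nashAlgebra X).val h1
  simpa using hx.cardinalMk_le_trdeg

/-- The zeros of a non-zero algebraic analytic function lie in a proper algebraic subset. -/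
theorem exists_polynomial_of_ne_zero [IsDomain (analyticAlgebra X)] {g : X → ℝ}
    (hg : g ∈ algebraicAnalytic X) (h0 : g ≠ 0) :
    ∃ P : MvPolynomial (Fin n) ℝ, (∃ x ∈ X, MvPolynomial.eval x P ≠ 0) ∧
      ∀ x : X, g x = 0 → MvPolynomial.eval (x : Fin n → ℝ) P = 0 := by
  obtain ⟨hga, hg⟩ := mem_algebraicAnalytic.1 hg
  have hne : (⟨g, hga⟩ : analyticAlgebra X) ≠ 0 := fun h =>
    h0 (congrArg (Subtype.val : analyticAlgebra X → X → ℝ) h)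
  -- A non-zero algebraic element of a domain divides a non-zero element of the base ring, here a
  -- polynomial in the coordinates.
  obtain ⟨r, hr0, k, hk⟩ := IsAlgebraic.exists_nonzero_dvd (mem_algebraicOver.1 hg)
    (mem_nonZeroDivisors_of_ne_zero hne)
  have hr : (r : analyticAlgebra X) ∈ (MvPolynomial.aeval (R := ℝ) (coord X)).range :=
    Algebra.adjoin_range_eq_range_aeval ℝ (coord X) ▸ r.2
  obtain ⟨P, hP⟩ := hr
  have hP' : ∀ x : X, (r : analyticAlgebra X).1 x = MvPolynomial.eval (x : Fin n → ℝ) P := by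
    intro x
    rw [← aeval_coord_apply, ← hP]
    rfl
  refine ⟨P, ?_, fun x hx => ?_⟩
  · by_contra! h
    refine hr0 (Subtype.ext (Subtype.ext (funext fun x => ?_)))
    rw [hP', h x x.2]
    rfl
  · rw [← hP']
    have h1 := congrFun (congrArg (Subtype.val : analyticAlgebra X → X → ℝ) hk) x
    have h2 : (r : analyticAlgebra X).1 x = g x * k.1 x := h1
    rw [h2, hx, zero_mul]

end Nash

/-! ### Lie derivatives and the observation algebra of a Nash system -/

namespace ControlSystem

variable {A : Type} {n r : ℕ} {sys : ControlSystem A n r}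

theorem IsNashSystem.analyticOnNhd_f (h : sys.IsNashSystem) (a : A) :
    AnalyticOnNhd ℝ (sys.f a) sys.X := by
  intro x hx
  rw [analyticAt_pi_iff]
  exact fun i => (h.nash_f a i).1 x hx

theorem IsNashSystem.isDomain (h : sys.IsNashSystem) : IsDomain (analyticAlgebra sys.X) :=
  isDomain_analyticAlgebra h.isOpen h.isConnected

/-- The Lie derivative of a coordinate is a component of f_α, which is Nash and thus algebraic over
the polynomials; `isAlgebraic_derivation` extends this from the generators. -/
theorem IsNashSystem.lieDeriv_mem [IsDomain (analyticAlgebra sys.X)] (h : sys.IsNashSystem)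
    (a : A) {g : sys.X → ℝ} (hg : g ∈ algebraicAnalytic sys.X) :
    sys.lieDeriv a g ∈ algebraicAnalytic sys.X := by
  obtain ⟨hga, hg⟩ := mem_algebraicAnalytic.1 hg
  rw [mem_algebraicAnalytic]
  refine ⟨lieDeriv_mem_analyticAlgebra h.isOpen (h.analyticOnNhd_f a) hga, ?_⟩
  refine isAlgebraic_derivation (sys.lieDerivation h.isOpen a (h.analyticOnNhd_f a)) ?_ hg
  rintro _ ⟨i, rfl⟩
  obtain ⟨hfa, hf⟩ := mem_algebraicAnalytic.1 ((h.nash_f a i).mem_algebraicAnalytic h.isOpen)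
  have : sys.lieDerivation h.isOpen a (h.analyticOnNhd_f a) (coord sys.X i) = ⟨_, hfa⟩ := by
    refine Subtype.ext (funext fun x => ?_)
    have h1 := lieDeriv_comp_val h.isOpen a (fun y => y i) x
    have h2 := ((ContinuousLinearMap.proj (R := ℝ) (φ := fun _ : Fin n => ℝ) i).hasFDerivAt
      (x := (x : Fin n → ℝ))).fderiv
    exact h1.trans (congrArg (fun L : (Fin n → ℝ) →L[ℝ] ℝ => L (sys.f a x)) h2)
  rw [this]
  exact hf

theorem h_mem_obsAlgebra (j : Fin r) : (fun x : sys.X => sys.h x j) ∈ sys.obsAlgebra := by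
  rw [obsAlgebra, Algebra.mem_sInf]
  exact fun B hB => hB.1 j

theorem lieDeriv_mem_obsAlgebra (a : A) {g : sys.X → ℝ} (hg : g ∈ sys.obsAlgebra) :
    sys.lieDeriv a g ∈ sys.obsAlgebra := by
  rw [obsAlgebra, Algebra.mem_sInf] at hg ⊢
  exact fun B hB => hB.2 a g (hg B hB)

theorem obsAlgebra_le {B : Subalgebra ℝ (sys.X → ℝ)}
    (hh : ∀ j : Fin r, (fun x : sys.X => sys.h x j) ∈ B)
    (hB : ∀ a, ∀ g ∈ B, sys.lieDeriv a g ∈ B) : sys.obsAlgebra ≤ B :=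
  sInf_le ⟨hh, hB⟩

theorem IsNashSystem.obsAlgebra_le [IsDomain (analyticAlgebra sys.X)] (h : sys.IsNashSystem) :
    sys.obsAlgebra ≤ algebraicAnalytic sys.X :=
  ControlSystem.obsAlgebra_le (fun j => (h.nash_h j).mem_algebraicAnalytic h.isOpen)
    fun a _ hg => h.lieDeriv_mem a hg

/-- On a semi-algebraically reachable system, an algebraic analytic function that vanishes on the
reachable set is zero. -/
theorem IsNashSystem.eq_zero_of_reachable [IsDomain (analyticAlgebra sys.X)]
    (h : sys.IsNashSystem) (hr : sys.IsSemialgebraicallyReachable) {g : sys.X → ℝ}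
    (hg : g ∈ algebraicAnalytic sys.X) (h0 : ∀ z : sys.X, (z : Fin n → ℝ) ∈ sys.reachableSet →
      g z = 0) : g = 0 := by
  by_contra hne
  obtain ⟨P, ⟨x, hx, hPx⟩, hP⟩ := exists_polynomial_of_ne_zero hg hne
  refine hPx (hr _ (isNashOn_eval h.isSemialgebraic P) ?_ x hx)
  rintro z ⟨u, hu, hz⟩
  exact hP ⟨z, (reaches_iff_steers.1 hz).right_mem⟩ (h0 _ ⟨u, hu, hz⟩)

end ControlSystem

/-! ### Polynomial relations -/

section Relations

variable {n d : ℕ} {X : Set (Fin n → ℝ)} {C : Subalgebra ℝ (X → ℝ)}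

/-- The element `Q(g, φ)` of an algebra of functions. -/
def relationValue (φ : Fin d → C) (g : C) (Q : Polynomial (MvPolynomial (Fin d) ℝ)) : C :=
  Q.eval₂ (MvPolynomial.aeval φ : MvPolynomial (Fin d) ℝ →ₐ[ℝ] C).toRingHom g

theorem relationValue_apply (φ : Fin d → C) (g : C) (Q : Polynomial (MvPolynomial (Fin d) ℝ))
    (x : X) : (relationValue φ g Q : X → ℝ) x =
      evalAt Q ((g : X → ℝ) x) fun i => (φ i : X → ℝ) x := by
  let ev : C →+* ℝ := (Pi.evalRingHom (fun _ : X => ℝ) x).comp C.val.toRingHom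
  have h := Polynomial.hom_eval₂ Q
    (MvPolynomial.aeval φ : MvPolynomial (Fin d) ℝ →ₐ[ℝ] C).toRingHom ev g
  have h2 : ev.comp (MvPolynomial.aeval φ : MvPolynomial (Fin d) ℝ →ₐ[ℝ] C).toRingHom =
      MvPolynomial.eval fun i => (φ i : X → ℝ) x := by
    refine MvPolynomial.ringHom_ext (fun c => ?_) fun i => ?_
    · simp [ev]
    · simp [ev]
  rw [h2] at h
  rw [evalAt, Polynomial.eval_map]
  exact h

theorem relationValue_eq_zero_iff {φ : Fin d → C} {g : C}
    {Q : Polynomial (MvPolynomial (Fin d) ℝ)} : relationValue φ g Q = 0 ↔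
      ∀ x : X, evalAt Q ((g : X → ℝ) x) (fun i => (φ i : X → ℝ) x) = 0 := by
  constructor
  · intro h x
    rw [← relationValue_apply, h]
    rfl
  · intro h
    refine Subtype.ext (funext fun x => ?_)
    rw [relationValue_apply, h]
    rfl

theorem exists_isMinimalRelation {φ : Fin d → C} (hφ : IsTranscendenceBasis ℝ φ) (g : C) :
    ∃ Q, IsMinimalRelation (fun x i => (φ i : X → ℝ) x) (g : X → ℝ) Q := by
  classical
  have hex : ∃ Q : Polynomial (MvPolynomial (Fin d) ℝ), Q ≠ 0 ∧
      ∀ x : X, evalAt Q ((g : X → ℝ) x) (fun i => (φ i : X → ℝ) x) = 0 := by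
    have halg := hφ.isAlgebraic
    obtain ⟨p, hp0, hp⟩ := halg.isAlgebraic g
    -- Algebraic independence identifies ℝ[φ] with a polynomial ring, through which the coefficients
    -- of p become polynomials in T₁, …, T_d.
    let e := hφ.1.aevalEquiv
    refine ⟨p.map e.symm.toRingEquiv.toRingHom, ?_, ?_⟩
    · rwa [Ne, Polynomial.map_eq_zero_iff e.symm.injective]
    · rw [← relationValue_eq_zero_iff, relationValue, Polynomial.eval₂_map, ← hp,
        Polynomial.aeval_def]
      congr 1
      ext y
      have h1 := hφ.1.algebraMap_aevalEquiv (e.symm y)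
      rw [AlgEquiv.apply_symm_apply] at h1
      exact congrFun (congrArg Subtype.val h1.symm) _
  let P : ℕ → Prop := fun k => ∃ Q : Polynomial (MvPolynomial (Fin d) ℝ), (Q ≠ 0 ∧
      ∀ x : X, evalAt Q ((g : X → ℝ) x) (fun i => (φ i : X → ℝ) x) = 0) ∧ Q.natDegree = k
  have hP : ∃ k, P k := by
    obtain ⟨Q, hQ⟩ := hex
    exact ⟨_, Q, hQ, rfl⟩
  obtain ⟨Q, hQ, hdeg⟩ := Nat.find_spec hP
  refine ⟨Q, hQ, fun Q' h1 h2 => ?_⟩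
  rw [hdeg]
  exact Nat.find_min' hP ⟨Q', ⟨h1, h2⟩, rfl⟩

/-- If Q has degree 0 in T, it is a relation between the φ_i alone and must be zero. Otherwise dQ/dT
is non-zero of smaller degree, so by minimality it is not a relation. -/
theorem relationValue_derivative_ne_zero {φ : Fin d → C} (hφ : AlgebraicIndependent ℝ φ) {g : C}
    {Q : Polynomial (MvPolynomial (Fin d) ℝ)}
    (hQ : IsMinimalRelation (fun x i => (φ i : X → ℝ) x) (g : X → ℝ) Q) :
    relationValue φ g (Polynomial.derivative Q) ≠ 0 := by
  intro h
  by_cases h0 : Q.natDegree = 0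
  · have h1 := relationValue_eq_zero_iff.2 hQ.1.2
    have h2 := Polynomial.eq_C_of_natDegree_eq_zero h0
    rw [h2, relationValue, Polynomial.eval₂_C] at h1
    have h3 := (algebraicIndependent_iff.1 hφ) _ h1
    apply hQ.1.1
    rw [h2, h3, Polynomial.C_0]
  · have h1 : Polynomial.derivative Q ≠ 0 := fun h2 => h0 (Polynomial.derivative_eq_zero.1 h2)
    have h2 := hQ.2 _ h1 (relationValue_eq_zero_iff.1 h)
    have h3 := Polynomial.natDegree_derivative_lt h0
    omega

/-- The transcendence degree is at most the dimension n of the state space, so every basis is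
finite. -/
theorem exists_finite_isTranscendenceBasis [IsDomain (analyticAlgebra X)] (hX : IsOpen X)
    (hC : C ≤ algebraicAnalytic X) : ∃ (d : ℕ) (φ : Fin d → C), IsTranscendenceBasis ℝ φ := by
  obtain ⟨x, hx⟩ := nonempty_of_isDomain_analyticAlgebra (X := X)
  have hfs : FaithfulSMul ℝ C := (faithfulSMul_iff_algebraMap_injective ℝ C).2 fun a b hab =>
    congrFun (congrArg (Subtype.val : C → X → ℝ) hab) ⟨x, hx⟩
  obtain ⟨s, hs⟩ := exists_isTranscendenceBasis ℝ C
  have h1 := hs.1.cardinalMk_le_trdeg.trans (trdeg_le_of_le_algebraicAnalytic hX hC)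
  have hfin : Finite s := Cardinal.lt_aleph0_iff_finite.1 (h1.trans_lt (Cardinal.natCast_lt_aleph0))
  obtain ⟨d, ⟨e⟩⟩ := Finite.exists_equiv_fin s
  exact ⟨d, Subtype.val ∘ e.symm, hs.comp_equiv e.symm⟩

end Relations

/-! ### Implicit solutions -/

section Implicit

variable {d : ℕ}

theorem evalAt_add (P Q : Polynomial (MvPolynomial (Fin d) ℝ)) (y : ℝ) (z : Fin d → ℝ) :
    evalAt (P + Q) y z = evalAt P y z + evalAt Q y z := by
  simp [evalAt]

theorem evalAt_monomial (k : ℕ) (c : MvPolynomial (Fin d) ℝ) (y : ℝ) (z : Fin d → ℝ) :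
    evalAt (Polynomial.monomial k c) y z = MvPolynomial.eval z c * y ^ k := by
  simp [evalAt, Polynomial.map_monomial, Polynomial.eval_monomial]

theorem analyticAt_evalAt (Q : Polynomial (MvPolynomial (Fin d) ℝ)) (u : (Fin d → ℝ) × ℝ) :
    AnalyticAt ℝ (fun v : (Fin d → ℝ) × ℝ => evalAt Q v.2 v.1) u := by
  induction Q using Polynomial.induction_on' with
  | add p q hp hq =>
    simp only [evalAt_add]
    exact hp.add hq
  | monomial k c =>
    simp only [evalAt_monomial]
    exact ((analyticOnNhd_eval c Set.univ _ (Set.mem_univ _)).comp analyticAt_fst).mul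
      (analyticAt_snd.pow k)

/-- The polynomial `Q` as a polynomial in `d + 1` variables, of which `T` is the last. -/
def lastVariable (Q : Polynomial (MvPolynomial (Fin d) ℝ)) : MvPolynomial (Fin (d + 1)) ℝ :=
  Q.eval₂ (MvPolynomial.rename Fin.castSucc).toRingHom (MvPolynomial.X (Fin.last d))

theorem eval_lastVariable (Q : Polynomial (MvPolynomial (Fin d) ℝ)) (y : Fin (d + 1) → ℝ) :
    MvPolynomial.eval y (lastVariable Q) = evalAt Q (y (Fin.last d)) (Fin.init y) := by
  have hinit : (Fin.init y : Fin d → ℝ) = y ∘ Fin.castSucc := rfl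
  rw [lastVariable, Polynomial.hom_eval₂, evalAt, Polynomial.eval_map, MvPolynomial.eval_X]
  congr 1
  refine MvPolynomial.ringHom_ext (fun c => ?_) fun i => ?_
  · simp
  · simp [hinit]

/-- The implicit function theorem for polynomial equations, with Nash solutions. -/
theorem exists_nash_implicit_function {Q : Polynomial (MvPolynomial (Fin d) ℝ)} {y₀ : ℝ}
    {z₀ : Fin d → ℝ} (h0 : evalAt Q y₀ z₀ = 0) (h1 : evalAt (Polynomial.derivative Q) y₀ z₀ ≠ 0) :
    ∃ δ > 0, ∃ ρ > 0, ∃ ψ : (Fin d → ℝ) → ℝ, IsNashOn (Metric.ball z₀ ρ) ψ ∧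
      Set.MapsTo ψ (Metric.ball z₀ ρ) (Metric.ball y₀ δ) ∧ ψ z₀ = y₀ ∧
      ∀ y ∈ Metric.ball y₀ δ, ∀ z ∈ Metric.ball z₀ ρ, (evalAt Q y z = 0 ↔ y = ψ z) := by
  let F : (Fin d → ℝ) × ℝ → ℝ := fun v => evalAt Q v.2 v.1
  let u : (Fin d → ℝ) × ℝ := (z₀, y₀)
  have hFa : AnalyticAt ℝ F u := analyticAt_evalAt Q u
  have hF : ContDiffAt ℝ (⊤ : WithTop ℕ∞) F u := hFa.contDiffAt
  have hne : (⊤ : WithTop ℕ∞) ≠ 0 := by simp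
  have hFu : F u = 0 := h0
  -- The partial derivative of F in its last variable is multiplication by the non-zero number dQ/dT
  -- at the base point.
  have hinv : (fderiv ℝ F u ∘L .inr ℝ (Fin d → ℝ) ℝ).IsInvertible := by
    have e1 : HasFDerivAt (fun y => F (z₀, y)) (fderiv ℝ F u ∘L .inr ℝ (Fin d → ℝ) ℝ) y₀ :=
      HasFDerivAt.comp y₀ (hFa.differentiableAt.hasFDerivAt (x := u))
        (hasFDerivAt_prodMk_right z₀ y₀)
    have e2 : HasDerivAt (fun y => F (z₀, y)) (evalAt (Polynomial.derivative Q) y₀ z₀) y₀ := by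
      have h := (Q.map (MvPolynomial.eval z₀)).hasDerivAt y₀
      rw [Polynomial.derivative_map] at h
      exact h
    refine ⟨ContinuousLinearEquiv.unitsEquivAut ℝ (Units.mk0 _ h1), ?_⟩
    rw [e1.unique e2.hasFDerivAt]
    ext
    simp
  let ψ := hF.implicitFunction hne hinv
  have hψa : AnalyticAt ℝ ψ z₀ := (hF.contDiffAt_implicitFunction hne hinv).analyticAt
  have hψ0 : ψ z₀ = y₀ := hF.implicitFunction_apply_self hne hinv
  have hev : ∀ᶠ v in 𝓝 ((z₀, y₀) : (Fin d → ℝ) × ℝ), F v = 0 ↔ ψ v.1 = v.2 := by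
    have h := hF.eventually_apply_eq_iff_implicitFunction hne hinv
    rw [hFu] at h
    exact h
  obtain ⟨δ, hδ, hball⟩ := Metric.eventually_nhds_iff_ball.1 hev
  have h2 : ∀ᶠ z in 𝓝 z₀, ψ z ∈ Metric.ball y₀ δ := by
    have h := hψa.continuousAt.tendsto
    rw [hψ0] at h
    exact h.eventually (Metric.ball_mem_nhds y₀ hδ)
  obtain ⟨ρ', hρ', hball'⟩ := Metric.eventually_nhds_iff_ball.1
    (h2.and hψa.eventually_analyticAt)
  -- The minimum with δ keeps (z, y) in the δ-ball of the product, whose metric is the maximum.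
  set ρ := min ρ' δ
  have hρ : 0 < ρ := lt_min hρ' hδ
  have hiff : ∀ y ∈ Metric.ball y₀ δ, ∀ z ∈ Metric.ball z₀ ρ, (evalAt Q y z = 0 ↔ y = ψ z) := by
    intro y hy z hz
    have h := hball (z, y) (by
      rw [Metric.mem_ball, Prod.dist_eq, max_lt_iff]
      exact ⟨(Metric.mem_ball.1 hz).trans_le (min_le_right _ _), hy⟩)
    exact h.trans eq_comm
  have hmaps : Set.MapsTo ψ (Metric.ball z₀ ρ) (Metric.ball y₀ δ) := fun z hz =>
    (hball' z (Metric.ball_subset_ball (min_le_left _ _) hz)).1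
  refine ⟨δ, hδ, ρ, hρ, ψ, ⟨fun z hz =>
    (hball' z (Metric.ball_subset_ball (min_le_left _ _) hz)).2, ?_⟩, hmaps, hψ0, hiff⟩
  -- Over the box, the graph of ψ is the zero set of Q, which exhibits it as semi-algebraic
  -- directly.
  have hs := ((isSemialgebraic_init_mem (isSemialgebraic_ball z₀ hρ)).inter
    ((isSemialgebraic_eval_pos (MvPolynomial.X (Fin.last d) - MvPolynomial.C (y₀ - δ))).inter
      (isSemialgebraic_eval_pos (MvPolynomial.C (y₀ + δ) - MvPolynomial.X (Fin.last d))))).inter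
    (isSemialgebraic_eval_eq_zero (lastVariable Q))
  unfold IsSemialgebraicFunOn
  convert hs using 1
  ext y
  simp only [Set.mem_ofPred_eq, Set.mem_inter_iff, map_sub, MvPolynomial.eval_X,
    MvPolynomial.eval_C, eval_lastVariable]
  have hb : (0 < y (Fin.last d) - (y₀ - δ) ∧ 0 < y₀ + δ - y (Fin.last d)) ↔
      y (Fin.last d) ∈ Metric.ball y₀ δ := by
    rw [Metric.mem_ball, Real.dist_eq, abs_sub_lt_iff]
    constructor <;> rintro ⟨h1, h2⟩ <;> constructor <;> linarith
  rw [hb]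
  constructor
  · rintro ⟨h1, h2⟩
    have h3 : y (Fin.last d) ∈ Metric.ball y₀ δ := h2 ▸ hmaps h1
    exact ⟨⟨h1, h3⟩, (hiff _ h3 _ h1).2 h2⟩
  · rintro ⟨⟨h1, h3⟩, h2⟩
    exact ⟨h1, (hiff _ h3 _ h1).1 h2⟩

/-- The domain is taken to be a ball of the maximum norm: it is semi-algebraic, and its convexity
later makes the intersection of all domains connected. -/
theorem exists_isImplicitSolution {n : ℕ} {X : Set (Fin n → ℝ)} {Φ : X → Fin d → ℝ} {g : X → ℝ}
    {Q : Polynomial (MvPolynomial (Fin d) ℝ)} {xb : X} (h0 : evalAt Q (g xb) (Φ xb) = 0)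
    (h1 : IsRegularAt Φ g Q xb) : ∃ (W : Set ℝ) (ρ : ℝ) (ψ : (Fin d → ℝ) → ℝ), 0 < ρ ∧
      IsImplicitSolution Φ g Q xb W (Metric.ball (Φ xb) ρ) ψ := by
  obtain ⟨δ, hδ, ρ, hρ, ψ, hN, hmaps, hψ, hiff⟩ := exists_nash_implicit_function h0 h1.self_of_nhds
  refine ⟨Metric.ball (g xb) δ, ρ, ψ, hρ, Metric.isOpen_ball,
    (convex_ball _ _).isConnected (Metric.nonempty_ball.2 hδ), ?_, Metric.isOpen_ball,
    (convex_ball _ _).isConnected (Metric.nonempty_ball.2 hρ), isSemialgebraic_ball _ hρ, hN, hmaps,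
    Metric.mem_ball_self hδ, Metric.mem_ball_self hρ, hψ, fun x hx hx' => hiff _ hx _ hx'⟩
  have h := isSemialgebraic_ball (fun _ : Fin 1 => g xb) hδ
  convert h using 1
  ext y
  simp [dist_pi_lt_iff hδ]

end Implicit

/-! ### Short inputs leading to regular states -/

theorem duration_le_of_forall_le {A : Type} {v : Input A} {η : ℝ} (h : ∀ q ∈ v, (q.2 : ℝ) ≤ η) :
    duration v ≤ v.length * η := by
  induction v with
  | nil => simp
  | cons q v ih =>
    have h1 := h q (by simp)
    have h2 := ih fun r hr => h r (by simp [hr])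
    simp only [duration_cons, List.length_cons]
    push_cast
    linarith

namespace ControlSystem

variable {A : Type} {n r : ℕ} {sys : ControlSystem A n r}

theorem IsNashSystem.exists_mem_admissibleInputs [Finite A] (h : sys.IsNashSystem) :
    ∃ ε > 0, ∀ u : Input A, duration u < ε → u ∈ sys.admissibleInputs :=
  exists_mem_admissibleInputs_of_duration_lt h.isOpen h.x₀_mem h.analyticOnNhd_f

/-- A function which vanishes at all states reached by a fixed admissible input followed by short
inputs is zero, on a semi-algebraically reachable system. -/
theorem IsNashSystem.eq_zero_of_vanishesAfter [IsDomain (analyticAlgebra sys.X)]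
    (h : sys.IsNashSystem) (hr : sys.IsSemialgebraicallyReachable) {G : (Fin n → ℝ) → ℝ}
    (hGa : AnalyticOnNhd ℝ G sys.X)
    (hG : (fun x : sys.X => G x) ∈ algebraicAnalytic sys.X) {u : Input A}
    (hu : u ∈ sys.admissibleInputs) (hv : VanishesAfter sys.X sys.f sys.x₀ G u) :
    (fun x : sys.X => G x) = 0 := by
  refine h.eq_zero_of_reachable hr hG ?_
  rintro z ⟨w, hw, hz⟩
  exact NashSys.eq_zero_of_vanishesAfter h.isOpen h.analyticOnNhd_f hGa isAdmissible_admissibleInputs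
    (fun _ hu => exists_steers_of_mem_admissibleInputs hu) hu hv hw (reaches_iff_steers.1 hz)

/-- Otherwise g vanishes after the empty input and is zero by continuation. The continuation runs
through `sys.admissibleInputs`; S enters only through its short words, which exist for every
sequence of letters. -/
theorem IsNashSystem.exists_short_input [Finite A] [IsDomain (analyticAlgebra sys.X)]
    (h : sys.IsNashSystem) (hr : sys.IsSemialgebraicallyReachable) {S : Set (Input A)}
    (hS : IsAdmissible S) (hne : S.Nonempty) {g : sys.X → ℝ} (hg : g ∈ algebraicAnalytic sys.X)
    (hg0 : g ≠ 0) {ε : ℝ} (hε : 0 < ε) :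
    ∃ u ∈ S ∩ sys.admissibleInputs, duration u < ε ∧
      ∃ xb : sys.X, sys.Reaches u xb ∧ g xb ≠ 0 := by
  by_contra hcon
  obtain ⟨G, hGa, rfl⟩ := (mem_algebraicAnalytic.1 hg).1
  obtain ⟨ε', hε', hadm⟩ := h.exists_mem_admissibleInputs
  refine hg0 (h.eq_zero_of_vanishesAfter hr hGa hg (u := []) (hadm _ (by simpa using hε'))
    fun β => ?_)
  obtain ⟨δ, hδ, hδS⟩ := hS.exists_extension (hS.nil_mem hne) β
  have hδ' : (0 : ℝ) < δ := hδ
  refine ⟨min δ (min ε ε' / (β.length + 1)), by positivity, fun v hvβ hv z hz => ?_⟩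
  have hvS : v ∈ S := hδS [] v List.Forall₂.nil hvβ fun q hq => by
    have h1 : (q.2 : ℝ) ≤ δ := (hv q hq).le.trans (min_le_left _ _)
    exact_mod_cast h1
  have hlen : v.length = β.length := by rw [← hvβ, List.length_map]
  have hdur : duration v < min ε ε' := by
    have h1 := duration_le_of_forall_le fun q hq => (hv q hq).le.trans (min_le_right _ _)
    refine h1.trans_lt ?_
    rw [hlen, mul_div_assoc', div_lt_iff₀ (by positivity)]
    have : 0 < min ε ε' := lt_min hε hε'
    nlinarith
  by_contra hGz
  exact hcon ⟨v, ⟨hvS, hadm v (hdur.trans_le (min_le_right _ _))⟩,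
    hdur.trans_le (min_le_left _ _), ⟨z, hz.right_mem⟩, reaches_iff_steers.2 hz, hGz⟩

end ControlSystem

/-! ### Response maps along affine families of inputs -/

section ResponseMaps

variable {A : Type}

theorem IsResponseMap.analyticOn_affineWord {r : ℕ} {S : Set (Input A)} {p : Input A → Fin r → ℝ}
    (hp : IsResponseMap S p) {L : List (A × ℝ × ℝ)} (hL : AffineNonneg L)
    (hS : ∀ s ∈ Set.Icc (0 : ℝ) 1, affineWord L s ∈ S) :
    AnalyticOn ℝ (fun s => p (affineWord L s)) (Set.Icc 0 1) := by
  let α : Fin L.length → A := fun i => (L.get i).1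
  let t : ℝ → Fin L.length → ℝ := fun s i => (L.get i).2.1 + s * (L.get i).2.2
  have hw : ∀ s, word α (t s) = affineWord L s := by
    intro s
    conv_rhs => rw [affineWord, ← List.ofFn_get L, List.map_ofFn]
    rfl
  have ht : AnalyticOnNhd ℝ t Set.univ := by
    intro s _
    rw [analyticAt_pi_iff]
    exact fun i => analyticAt_const.add (analyticAt_id.mul analyticAt_const)
  have h := (hp.analytic L.length α).comp (ht.analyticOn.mono (Set.subset_univ (Set.Icc 0 1)))
    fun s hs => ⟨fun i => hL _ (List.get_mem L i) s hs, by rw [hw]; exact hS s hs⟩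
  refine h.congr fun s _ => ?_
  simp only [Function.comp_apply, hw]

end ResponseMaps

/-! ### Local morphisms of control systems -/

namespace ControlSystem

variable {A : Type} {n d r : ℕ} {sys : ControlSystem A n r} {red : ControlSystem A d r}
  {Ψ : (Fin n → ℝ) → Fin d → ℝ} {N : Set (Fin n → ℝ)} {xb : sys.X}

/-- The map `Ψ` is compatible with the vector fields and outputs of two systems on the
neighbourhood `N` of `xb`, and maps `xb` to the initial state. -/
structure IsLocalMorphism (sys : ControlSystem A n r) (red : ControlSystem A d r)
    (Ψ : (Fin n → ℝ) → Fin d → ℝ) (N : Set (Fin n → ℝ)) (xb : sys.X) : Prop where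
  mem_nhds : N ∈ 𝓝 (xb : Fin n → ℝ)
  subset : N ⊆ sys.X
  analytic : AnalyticOnNhd ℝ Ψ sys.X
  mapsTo : Set.MapsTo Ψ N red.X
  base : Ψ xb = red.x₀
  map_f : ∀ a, ∀ x ∈ N, fderiv ℝ Ψ x (sys.f a x) = red.f a (Ψ x)
  map_h : ∀ x ∈ N, sys.h x = red.h (Ψ x)

/-- By the chain rule Ψ maps integral curves inside N to integral curves. -/
theorem IsLocalMorphism.steers (hm : IsLocalMorphism sys red Ψ N xb) {v : Input A}
    {x z : Fin n → ℝ} (h : Steers N sys.f v x z) : Steers red.X red.f v (Ψ x) (Ψ z) := by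
  induction v generalizing x with
  | nil => exact ⟨hm.mapsTo h.1, congrArg Ψ h.2⟩
  | cons q v ih =>
    obtain ⟨y, ⟨c, hc, rfl, rfl⟩, h⟩ := h
    refine ⟨Ψ (c q.2), ⟨Ψ ∘ c, ⟨?_, fun s hs => hm.mapsTo (hc.mapsTo hs), ?_⟩, rfl, rfl⟩, ih h⟩
    · exact hm.analytic.continuousOn.comp hc.continuousOn fun s hs => hm.subset (hc.mapsTo hs)
    · intro s hs
      have hcs := hc.mapsTo (Set.Ioo_subset_Icc_self hs)
      have h1 := (hm.analytic _ (hm.subset hcs)).differentiableAt.hasFDerivAt.comp_hasDerivAt s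
        (hc.hasDerivAt s hs)
      rwa [hm.map_f _ _ hcs] at h1

theorem IsLocalMorphism.exists_steers [Finite A] (hm : IsLocalMorphism sys red Ψ N xb)
    (hsys : sys.IsNashSystem) :
    ∃ ε > 0, ∀ v : Input A, duration v < ε → ∃ z, Steers N sys.f v xb z :=
  exists_steers_of_duration_lt hm.mem_nhds fun a => hsys.analyticOnNhd_f a _ xb.2

/-- A local morphism relates the states reached by short inputs. -/
theorem IsLocalMorphism.eventually_steers [Finite A] (hm : IsLocalMorphism sys red Ψ N xb)
    (hsys : sys.IsNashSystem) {u : Input A} (hux : sys.Reaches u xb) :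
    ∃ ε > 0, ∀ v : Input A, duration v < ε → ∃ z ∈ N, Steers sys.X sys.f (u ++ v) sys.x₀ z ∧
      Steers red.X red.f v red.x₀ (Ψ z) := by
  obtain ⟨ε, hε, h⟩ := hm.exists_steers hsys
  refine ⟨ε, hε, fun v hv => ?_⟩
  obtain ⟨z, hz⟩ := h v hv
  refine ⟨z, hz.right_mem, steers_append.2 ⟨xb, reaches_iff_steers.1 hux, hz.mono hm.subset⟩, ?_⟩
  rw [← hm.base]
  exact hm.steers hz

/-- A long input v may lead out of the region controlled by Ψ, so outputs are compared along the
inputs with durations multiplied by s. Both p(u·) and the output of the second system are analytic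
in s on [0,1] and agree for small s, hence at s = 1. -/
theorem IsLocalMorphism.isLocalNashRealization [Finite A] (hm : IsLocalMorphism sys red Ψ N xb)
    {S : Set (Input A)} {p : Input A → Fin r → ℝ} (hp : IsResponseMap S p)
    (hsys : sys.IsLocalNashRealization S p) (hred : red.IsNashSystem) {u : Input A}
    (hu : u ∈ sys.admissibleInputs) (hux : sys.Reaches u xb) :
    red.IsLocalNashRealization (shiftDomain S u) (shift p u) := by
  refine ⟨hred, ?_⟩
  rintro v ⟨⟨-, hvS⟩, hv⟩ z hz
  rw [reaches_iff_steers] at hz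
  have hex : ∀ s, ∃ y, s ∈ Set.Icc (0 : ℝ) 1 →
      Steers red.X red.f (affineWord (contraction v) s) red.x₀ y := by
    intro s
    by_cases hs : s ∈ Set.Icc (0 : ℝ) 1
    · obtain ⟨y, hy⟩ := exists_steers_of_mem_admissibleInputs
        (isAdmissible_admissibleInputs.mem_of_dominates_zero hv
          (dominates_affineWord_contraction v hs))
      exact ⟨y, fun _ => hy⟩
    · exact ⟨0, fun h => absurd h hs⟩
  choose e he using hex
  have he1 : e 1 = z := by
    have h1 := he 1 ⟨zero_le_one, le_rfl⟩
    rw [affineWord_contraction_one] at h1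
    exact h1.unique hred.analyticOnNhd_f hz
  have hea : AnalyticOn ℝ e (Set.Icc 0 1) :=
    analyticOn_of_steers_affineWord hred.isOpen hred.analyticOnNhd_f (affineNonneg_contraction v)
      analyticOn_const he
  have hha : AnalyticOn ℝ (fun s => red.h (e s)) (Set.Icc 0 1) := by
    have h1 : AnalyticOnNhd ℝ red.h red.X := fun x hx =>
      analyticAt_pi_iff.2 fun j => (hred.nash_h j).1 x hx
    exact fun s hs => AnalyticAt.comp_analyticWithinAt (h1 _ (he s hs).right_mem) (hea s hs)
  have hpa : AnalyticOn ℝ (fun s => p (u ++ affineWord (contraction v) s)) (Set.Icc 0 1) := by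
    have h1 := hp.analyticOn_affineWord
      ((affineNonneg_constantFamily u).append (affineNonneg_contraction v)) fun s hs => by
        rw [affineWord_append, affineWord_constantFamily]
        exact hp.admissible.mem_of_dominates_zero hvS
          ((Dominates.refl 0 u).append (dominates_affineWord_contraction v hs))
    simpa only [affineWord_append, affineWord_constantFamily] using h1
  obtain ⟨ε, hε, hε'⟩ := hm.eventually_steers hsys.1 hux
  obtain ⟨δ, hδ, hδ'⟩ := isAdmissible_admissibleInputs.exists_extension hu (v.map Prod.fst)
  have hδ0 : (0 : ℝ) < δ := hδ
  have hv0 := duration_nonneg v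
  -- Below this parameter the contracted word is short enough for Ψ to transport its trajectory and
  -- for u followed by it to be admissible for `sys`, although `u ++ v` need not be.
  have key := eq_zero_at_one_of_analyticOn (hpa.sub hha) (η := min ε δ / (duration v + 1))
    (by positivity) fun s hs hsη => by
      have hdur : duration (affineWord (contraction v) s) < min ε δ := by
        rw [duration_affineWord_contraction v hs.1]
        rw [lt_div_iff₀ (by positivity)] at hsη
        nlinarith [hs.1]
      obtain ⟨y, hyN, hy, hy'⟩ := hε' _ (hdur.trans_le (min_le_left _ _))
      have hadm := hδ' u (affineWord (contraction v) s) (Dominates.refl δ u)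
        (by simp [affineWord_contraction, Function.comp_def]) fun q hq => by
          have h1 := (coe_le_duration hq).trans (hdur.le.trans (min_le_right _ _))
          exact_mod_cast h1
      have hS := hp.admissible.mem_of_dominates_zero hvS
        ((Dominates.refl 0 u).append (dominates_affineWord_contraction v hs))
      have h1 := hsys.2 _ ⟨hS, hadm⟩ y (reaches_iff_steers.2 hy)
      have h2 := (he s hs).unique hred.analyticOnNhd_f hy'
      simp only [Pi.sub_apply]
      rw [h1, h2, hm.map_h y hyN, sub_self]
  simp only [Pi.sub_apply, affineWord_contraction_one, he1] at key
  exact sub_eq_zero.1 key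

/-- Functions on `X` that near `xb` are the pull-back of an element of the observation algebra of
the second system. -/
def pullbackAlgebra (sys : ControlSystem A n r) (red : ControlSystem A d r)
    (Ψ : (Fin n → ℝ) → Fin d → ℝ) (xb : sys.X) : Subalgebra ℝ (sys.X → ℝ) where
  carrier := {g | ∃ K : (Fin d → ℝ) → ℝ, AnalyticOnNhd ℝ K red.X ∧
    (fun z : red.X => K z) ∈ red.obsAlgebra ∧ ∀ᶠ x in 𝓝 xb, g x = K (Ψ x)}
  mul_mem' := by
    rintro g g' ⟨K, hK, hKo, hg⟩ ⟨K', hK', hKo', hg'⟩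
    refine ⟨fun z => K z * K' z, hK.mul hK', mul_mem hKo hKo', ?_⟩
    filter_upwards [hg, hg'] with x h h'
    rw [Pi.mul_apply, h, h']
  add_mem' := by
    rintro g g' ⟨K, hK, hKo, hg⟩ ⟨K', hK', hKo', hg'⟩
    refine ⟨fun z => K z + K' z, hK.add hK', add_mem hKo hKo', ?_⟩
    filter_upwards [hg, hg'] with x h h'
    rw [Pi.add_apply, h, h']
  algebraMap_mem' c := ⟨fun _ => c, analyticOnNhd_const, red.obsAlgebra.algebraMap_mem c,
    Filter.Eventually.of_forall fun _ => rfl⟩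

theorem IsLocalMorphism.eventually_mem (hm : IsLocalMorphism sys red Ψ N xb) :
    ∀ᶠ x : sys.X in 𝓝 xb, (x : Fin n → ℝ) ∈ N :=
  continuous_subtype_val.continuousAt.eventually hm.mem_nhds

/-- The pull-backs contain the outputs and are closed under Lie derivatives by the chain rule, so
the minimality of the observation algebra applies. -/
theorem IsLocalMorphism.obsAlgebra_le (hm : IsLocalMorphism sys red Ψ N xb)
    (hsys : sys.IsNashSystem) (hred : red.IsNashSystem) :
    sys.obsAlgebra ≤ pullbackAlgebra sys red Ψ xb := by
  refine ControlSystem.obsAlgebra_le (fun j => ?_) ?_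
  · refine ⟨fun z => red.h z j, (hred.nash_h j).1, h_mem_obsAlgebra j, ?_⟩
    filter_upwards [hm.eventually_mem] with x hx
    rw [hm.map_h x hx]
  · rintro a g ⟨K, hK, hKo, hg⟩
    refine ⟨fun z => fderiv ℝ K z (red.f a z), ?_, ?_, ?_⟩
    · intro z hz
      exact AnalyticAt.comp (f := fun y => (fderiv ℝ K y, red.f a y))
        ((ContinuousLinearMap.id ℝ ((Fin d → ℝ) →L[ℝ] ℝ)).analyticAt_bilinear
          (fderiv ℝ K z, red.f a z)) ((hK.fderiv z hz).prod (hred.analyticOnNhd_f a z hz))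
    · have h1 := lieDeriv_mem_obsAlgebra a hKo
      rwa [show red.lieDeriv a (fun z : red.X => K z) = fun z : red.X => fderiv ℝ K z (red.f a z)
        from funext fun z => lieDeriv_comp_val hred.isOpen a K z] at h1
    -- Differentiating at x requires the pull-back identity in a neighbourhood of x.
    · filter_upwards [hm.eventually_mem, eventually_eventually_nhds.2 hg] with x hx hgx
      have h1 := (hK _ (hm.mapsTo hx)).differentiableAt.hasFDerivAt.comp (x : Fin n → ℝ)
        (hm.analytic x x.2).differentiableAt.hasFDerivAt
      rw [lieDeriv_apply hsys.isOpen a (G := K ∘ Ψ) hgx, h1.fderiv, ← hm.map_f a x hx]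
      rfl

/-! ### Observability and reachability of the target of a local morphism -/

section Coordinates

variable {φ : Fin d → sys.obsAlgebra}

theorem coe_aeval_apply {X : Set (Fin n → ℝ)} {C : Subalgebra ℝ (X → ℝ)} (φ : Fin d → C)
    (P : MvPolynomial (Fin d) ℝ) (x : X) :
    (MvPolynomial.aeval φ P : C).1 x = MvPolynomial.eval (fun i => (φ i : X → ℝ) x) P := by
  induction P using MvPolynomial.induction_on with
  | C c => simp
  | add p q hp hq =>
    rw [map_add, map_add, ← hp, ← hq]
    rfl
  | mul_X p i hp =>
    rw [map_mul, map_mul, ← hp, MvPolynomial.aeval_X, MvPolynomial.eval_X]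
    rfl

/-- Near `xb` each φ_i is K_i ∘ Ψ with K_i in the observation algebra of `red`. A relation between
the K_i becomes one between the φ_i near `xb`, hence on X by the identity theorem. So the K_i are d
independent elements, and d is also the upper bound. -/
theorem IsLocalMorphism.isSemialgebraicallyObservable (hm : IsLocalMorphism sys red Ψ N xb)
    (hsys : sys.IsNashSystem) (hred : red.IsNashSystem) (hφ : AlgebraicIndependent ℝ φ) :
    red.IsSemialgebraicallyObservable := by
  have := hsys.isDomain
  have := hred.isDomain
  rw [IsSemialgebraicallyObservable, trdeg_nashAlgebra hred.isOpen hred.isSemialgebraic]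
  refine le_antisymm (trdeg_le_of_le_algebraicAnalytic hred.isOpen hred.obsAlgebra_le) ?_
  choose K hK hKo hφK using fun i => hm.obsAlgebra_le hsys hred (φ i).2
  let κ : Fin d → red.obsAlgebra := fun i => ⟨_, hKo i⟩
  have hκ : AlgebraicIndependent ℝ κ := by
    rw [algebraicIndependent_iff] at hφ ⊢
    intro P hP
    refine hφ P (Subtype.ext ?_)
    obtain ⟨G, hG, hGP⟩ := (mem_algebraicAnalytic.1
      (hsys.obsAlgebra_le (MvPolynomial.aeval φ P).2)).1
    have hev : ∀ᶠ y in 𝓝 (xb : Fin n → ℝ), G y = 0 := by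
      have h1 : ∀ᶠ x : sys.X in 𝓝 xb, G x = 0 := by
        filter_upwards [hm.eventually_mem, Filter.eventually_all.2 hφK] with x hx hxK
        rw [← congrFun hGP x, coe_aeval_apply]
        simp only [hxK]
        have h2 := congrFun (congrArg Subtype.val hP) ⟨Ψ x, hm.mapsTo hx⟩
        rwa [coe_aeval_apply] at h2
      rw [nhds_subtype_eq_comap, Filter.eventually_comap] at h1
      filter_upwards [h1, hsys.isOpen.mem_nhds xb.2] with y hy hyX using hy ⟨y, hyX⟩ rfl
    have h3 := hG.eqOn_zero_of_preconnected_of_eventuallyEq_zero hsys.isConnected.isPreconnected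
      xb.2 hev
    rw [hGP]
    exact funext fun x => h3 x.2
  simpa using hκ.cardinalMk_le_trdeg

/-- A non-zero Nash g vanishing on the reachable set would give a polynomial P ≠ 0 vanishing there.
Then P(φ) vanishes after u followed by short inputs, and so on all of X by continuation and
reachability of `sys`, against the independence of φ. -/
theorem IsLocalMorphism.isSemialgebraicallyReachable [Finite A]
    (hm : IsLocalMorphism sys red Ψ N xb) (hsys : sys.IsNashSystem) (hred : red.IsNashSystem)
    (hr : sys.IsSemialgebraicallyReachable) (hφ : AlgebraicIndependent ℝ φ)
    (hΨ : ∀ (x : sys.X) i, Ψ x i = (φ i : sys.X → ℝ) x) {u : Input A}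
    (hu : u ∈ sys.admissibleInputs) (hux : sys.Reaches u xb) :
    red.IsSemialgebraicallyReachable := by
  have := hsys.isDomain
  have := hred.isDomain
  intro g hg hg0
  by_contra! hne
  obtain ⟨z₀, hz₀, hgz₀⟩ := hne
  obtain ⟨P, ⟨y, -, hy⟩, hP⟩ := exists_polynomial_of_ne_zero (hg.mem_algebraicAnalytic hred.isOpen)
    fun h => hgz₀ (congrFun h ⟨z₀, hz₀⟩)
  have hGP : (fun x : sys.X => MvPolynomial.eval (Ψ x) P) = (MvPolynomial.aeval φ P).1 := by
    funext x
    rw [coe_aeval_apply]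
    congr 2
    exact funext (hΨ x)
  have hGa : AnalyticOnNhd ℝ (fun x => MvPolynomial.eval (Ψ x) P) sys.X := fun x hx =>
    AnalyticAt.comp (g := fun z => MvPolynomial.eval z P) (f := Ψ)
      (analyticOnNhd_eval P Set.univ _ (Set.mem_univ _)) (hm.analytic x hx)
  obtain ⟨ε, hε, hε'⟩ := hm.eventually_steers hsys hux
  obtain ⟨ε', hε0, hadm⟩ := hred.exists_mem_admissibleInputs
  have h0 := hsys.eq_zero_of_vanishesAfter hr hGa
    (by rw [hGP]; exact hsys.obsAlgebra_le (MvPolynomial.aeval φ P).2) hu fun β => by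
      refine ⟨min ε ε' / (β.length + 1), by positivity, fun v hvβ hv z hz => ?_⟩
      have hdur : duration v < min ε ε' := by
        refine (duration_le_of_forall_le fun q hq => (hv q hq).le).trans_lt ?_
        rw [← hvβ, List.length_map, mul_div_assoc', div_lt_iff₀ (by positivity)]
        have : 0 < min ε ε' := lt_min hε hε0
        nlinarith
      obtain ⟨z', hzN, hz', hz''⟩ := hε' v (hdur.trans_le (min_le_left _ _))
      rw [hz.unique hsys.analyticOnNhd_f hz']
      exact hP ⟨Ψ z', hm.mapsTo hzN⟩ (hg0 _ ⟨v, hadm v (hdur.trans_le (min_le_right _ _)),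
        reaches_iff_steers.2 hz''⟩)
  rw [hGP] at h0
  have h1 := algebraicIndependent_iff.1 hφ P (Subtype.ext h0)
  rw [h1] at hy
  exact hy (map_zero _)

end Coordinates

end ControlSystem

/-! ### The reduced system -/

theorem continuous_of_mem_algebraicAnalytic {n : ℕ} {X : Set (Fin n → ℝ)}
    [IsDomain (analyticAlgebra X)] {g : X → ℝ} (hg : g ∈ algebraicAnalytic X) : Continuous g := by
  obtain ⟨G, hG, rfl⟩ := (mem_algebraicAnalytic.1 hg).1
  exact continuousOn_iff_continuous_domRestrict.1 hG.continuousOn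

/-- In a domain the product of finitely many non-zero elements is non-zero; this merges all
regularity conditions into one. -/
theorem exists_ne_zero_of_forall {n : ℕ} {X : Set (Fin n → ℝ)} [IsDomain (analyticAlgebra X)]
    {ι : Type} [Finite ι] {g : ι → X → ℝ} (hg : ∀ i, g i ∈ algebraicAnalytic X)
    (hg0 : ∀ i, g i ≠ 0) :
    ∃ G ∈ algebraicAnalytic X, G ≠ 0 ∧ ∀ x, G x ≠ 0 → ∀ i, g i x ≠ 0 := by
  have := Fintype.ofFinite ι
  refine ⟨∏ i, g i, prod_mem fun i _ => hg i, fun h => ?_, fun x hx i hi => hx ?_⟩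
  · let γ : ι → analyticAlgebra X := fun i => ⟨g i, (mem_algebraicAnalytic.1 (hg i)).1⟩
    have h1 : ∏ i, γ i = 0 := Subtype.ext ((map_prod (analyticAlgebra X).val γ Finset.univ).trans h)
    obtain ⟨i, -, hi⟩ := Finset.prod_eq_zero_iff.1 h1
    exact hg0 i (congrArg Subtype.val hi)
  · rw [Finset.prod_apply]
    exact Finset.prod_eq_zero (Finset.mem_univ i) hi

namespace ControlSystem

variable {A : Type} {n d r : ℕ} {sys : ControlSystem A n r}

/-- A transcendence basis `φ` of the observation algebra, the functions `f_α φ_i` and `h_j`, and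
minimal polynomial relations for them. -/
structure IsReductionData (sys : ControlSystem A n r) (φ : Fin d → sys.obsAlgebra)
    (Φ : sys.X → Fin d → ℝ) (fφ : A → Fin d → sys.X → ℝ) (hh : Fin r → sys.X → ℝ)
    (Q : A → Fin d → Polynomial (MvPolynomial (Fin d) ℝ))
    (P : Fin r → Polynomial (MvPolynomial (Fin d) ℝ)) : Prop where
  algebraicIndependent : AlgebraicIndependent ℝ φ
  map_eq : ∀ x i, Φ x i = (φ i : sys.X → ℝ) x
  lie_eq : ∀ a i, fφ a i = sys.lieDeriv a (φ i : sys.X → ℝ)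
  out_eq : ∀ j x, hh j x = sys.h x j
  relation_lie : ∀ a i, IsMinimalRelation Φ (fφ a i) (Q a i)
  relation_out : ∀ j, IsMinimalRelation Φ (hh j) (P j)

variable {φ : Fin d → sys.obsAlgebra} {Φ : sys.X → Fin d → ℝ} {fφ : A → Fin d → sys.X → ℝ}
  {hh : Fin r → sys.X → ℝ} {Q : A → Fin d → Polynomial (MvPolynomial (Fin d) ℝ)}
  {P : Fin r → Polynomial (MvPolynomial (Fin d) ℝ)}

theorem IsReductionData.lie_mem (hD : IsReductionData sys φ Φ fφ hh Q P) (a : A) (i : Fin d) :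
    fφ a i ∈ sys.obsAlgebra :=
  hD.lie_eq a i ▸ lieDeriv_mem_obsAlgebra a (φ i).2

theorem IsReductionData.out_mem (hD : IsReductionData sys φ Φ fφ hh Q P) (j : Fin r) :
    hh j ∈ sys.obsAlgebra := by
  rw [show hh j = _ from funext (hD.out_eq j)]
  exact h_mem_obsAlgebra j

theorem eq_coe_of_forall_eq (h : ∀ x i, Φ x i = (φ i : sys.X → ℝ) x) :
    Φ = fun x i => (φ i : sys.X → ℝ) x :=
  funext fun x => funext fun i => h x i

theorem isRegularAt_of_relationValue_ne_zero [IsDomain (analyticAlgebra sys.X)]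
    (hsys : sys.IsNashSystem) {g : sys.obsAlgebra}
    {Q : Polynomial (MvPolynomial (Fin d) ℝ)} {xb : sys.X}
    (h : (relationValue φ g (Polynomial.derivative Q)).1 xb ≠ 0) :
    IsRegularAt (fun x i => (φ i : sys.X → ℝ) x) (g : sys.X → ℝ) Q xb := by
  have h1 := (continuous_of_mem_algebraicAnalytic (hsys.obsAlgebra_le
    (relationValue φ g (Polynomial.derivative Q)).2)).continuousAt.eventually_ne h
  filter_upwards [h1] with x hx
  rwa [relationValue_apply] at hx

theorem IsReductionData.exists_regular_state [Finite A]
    (hD : IsReductionData sys φ Φ fφ hh Q P) (hsys : sys.IsNashSystem)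
    (hr : sys.IsSemialgebraicallyReachable) {S : Set (Input A)} (hS : IsAdmissible S)
    (hne : S.Nonempty) {ε : ℝ} (hε : 0 < ε) :
    ∃ u ∈ S ∩ sys.admissibleInputs, duration u < ε ∧ ∃ xb : sys.X, sys.Reaches u xb ∧
      (∀ a i, IsRegularAt Φ (fφ a i) (Q a i) xb) ∧ ∀ j, IsRegularAt Φ (hh j) (P j) xb := by
  have := hsys.isDomain
  obtain rfl := eq_coe_of_forall_eq hD.map_eq
  let δ : (A × Fin d) ⊕ Fin r → sys.obsAlgebra := Sum.elim
    (fun q => relationValue φ ⟨_, hD.lie_mem q.1 q.2⟩ (Polynomial.derivative (Q q.1 q.2)))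
    (fun j => relationValue φ ⟨_, hD.out_mem j⟩ (Polynomial.derivative (P j)))
  have hδ : ∀ k, (δ k : sys.X → ℝ) ≠ 0 := by
    intro k hk
    have hk' : δ k = 0 := Subtype.ext hk
    rcases k with ⟨a, i⟩ | j
    · exact relationValue_derivative_ne_zero hD.algebraicIndependent (hD.relation_lie a i) hk'
    · exact relationValue_derivative_ne_zero hD.algebraicIndependent (hD.relation_out j) hk'
  obtain ⟨G, hG, hG0, hGδ⟩ := exists_ne_zero_of_forall
    (fun k => hsys.obsAlgebra_le (δ k).2) hδ
  obtain ⟨u, hu, hdur, xb, hxb, hGxb⟩ := hsys.exists_short_input hr hS hne hG hG0 hε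
  exact ⟨u, hu, hdur, xb, hxb,
    fun a i => isRegularAt_of_relationValue_ne_zero hsys (hGδ xb hGxb (Sum.inl (a, i))),
    fun j => isRegularAt_of_relationValue_ne_zero hsys (hGδ xb hGxb (Sum.inr j))⟩

theorem IsReductionData.exists_implicit_solutions (hD : IsReductionData sys φ Φ fφ hh Q P)
    {xb : sys.X} (hQ : ∀ a i, IsRegularAt Φ (fφ a i) (Q a i) xb)
    (hP : ∀ j, IsRegularAt Φ (hh j) (P j) xb) :
    ∃ (WQ : A → Fin d → Set ℝ) (VQ : A → Fin d → Set (Fin d → ℝ))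
      (ψQ : A → Fin d → (Fin d → ℝ) → ℝ)
      (WP : Fin r → Set ℝ) (VP : Fin r → Set (Fin d → ℝ)) (ψP : Fin r → (Fin d → ℝ) → ℝ),
      (∀ a i, IsImplicitSolution Φ (fφ a i) (Q a i) xb (WQ a i) (VQ a i) (ψQ a i)) ∧
      (∀ j, IsImplicitSolution Φ (hh j) (P j) xb (WP j) (VP j) (ψP j)) ∧
      IsConnected ((⋂ a, ⋂ i, VQ a i) ∩ ⋂ j, VP j) := by
  choose WQ ρQ ψQ hρQ hsQ using fun a i =>
    exists_isImplicitSolution ((hD.relation_lie a i).1.2 xb) (hQ a i)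
  choose WP ρP ψP hρP hsP using fun j =>
    exists_isImplicitSolution ((hD.relation_out j).1.2 xb) (hP j)
  refine ⟨WQ, _, ψQ, WP, _, ψP, hsQ, hsP, ?_⟩
  refine ((convex_iInter fun a => convex_iInter fun i => convex_ball _ _).inter
    (convex_iInter fun j => convex_ball _ _)).isConnected ⟨Φ xb, ?_, ?_⟩
  · exact Set.mem_iInter₂.2 fun a i => (hsQ a i).mem_V
  · exact Set.mem_iInter.2 fun j => (hsP j).mem_V

variable {xb : sys.X} {WQ : A → Fin d → Set ℝ} {VQ : A → Fin d → Set (Fin d → ℝ)}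
  {ψQ : A → Fin d → (Fin d → ℝ) → ℝ} {WP : Fin r → Set ℝ} {VP : Fin r → Set (Fin d → ℝ)}
  {ψP : Fin r → (Fin d → ℝ) → ℝ}

theorem isNashSystem_reducedSystem [Finite A]
    (hQ : ∀ a i, IsImplicitSolution Φ (fφ a i) (Q a i) xb (WQ a i) (VQ a i) (ψQ a i))
    (hP : ∀ j, IsImplicitSolution Φ (hh j) (P j) xb (WP j) (VP j) (ψP j))
    (hc : IsConnected ((⋂ a, ⋂ i, VQ a i) ∩ ⋂ j, VP j)) :
    (reducedSystem VQ VP ψQ ψP (Φ xb)).IsNashSystem := by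
  have hsub : ((⋂ a, ⋂ i, VQ a i) ∩ ⋂ j, VP j) ⊆ ⋂ a, ⋂ i, VQ a i := Set.inter_subset_left
  have hsub' : ((⋂ a, ⋂ i, VQ a i) ∩ ⋂ j, VP j) ⊆ ⋂ j, VP j := Set.inter_subset_right
  have hV : IsSemialgebraic ((⋂ a, ⋂ i, VQ a i) ∩ ⋂ j, VP j) :=
    (isSemialgebraic_iInter fun a => isSemialgebraic_iInter fun i =>
      (hQ a i).isSemialgebraic_V).inter (isSemialgebraic_iInter fun j => (hP j).isSemialgebraic_V)
  exact {
    isOpen := (isOpen_iInter_of_finite fun a => isOpen_iInter_of_finite fun i =>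
      (hQ a i).isOpen_V).inter (isOpen_iInter_of_finite fun j => (hP j).isOpen_V)
    isConnected := hc
    isSemialgebraic := hV
    nash_f := fun a i => (hQ a i).nash.mono
      (fun _ hz => Set.mem_iInter₂.1 (hsub hz) a i) hV
    nash_h := fun j => (hP j).nash.mono (fun _ hz => Set.mem_iInter.1 (hsub' hz) j) hV
    x₀_mem := ⟨Set.mem_iInter₂.2 fun a i => (hQ a i).mem_V,
      Set.mem_iInter.2 fun j => (hP j).mem_V⟩ }

/-- On the neighbourhood where every f_α φ_i, h_j and Φ lies in its W or V, `solves` turns the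
polynomial relations into f_α φ_i = ψ(Φ) and h_j = ψ_j(Φ). These say that Φ intertwines the two
systems, and they hold for every choice of implicit solutions. -/
theorem IsReductionData.exists_isLocalMorphism [Finite A]
    (hD : IsReductionData sys φ Φ fφ hh Q P) (hsys : sys.IsNashSystem)
    (hQ : ∀ a i, IsImplicitSolution Φ (fφ a i) (Q a i) xb (WQ a i) (VQ a i) (ψQ a i))
    (hP : ∀ j, IsImplicitSolution Φ (hh j) (P j) xb (WP j) (VP j) (ψP j)) :
    ∃ Ψ N, (∀ (x : sys.X) i, Ψ x i = (φ i : sys.X → ℝ) x) ∧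
      IsLocalMorphism sys (reducedSystem VQ VP ψQ ψP (Φ xb)) Ψ N xb := by
  have := hsys.isDomain
  have hC : ∀ c : sys.obsAlgebra, Continuous (c : sys.X → ℝ) := fun c =>
    continuous_of_mem_algebraicAnalytic (hsys.obsAlgebra_le c.2)
  have hΦc : Continuous Φ := continuous_pi fun i => by
    simp only [hD.map_eq]
    exact hC (φ i)
  choose G hG hGφ using fun i => (mem_algebraicAnalytic.1 (hsys.obsAlgebra_le (φ i).2)).1
  have hGΦ : ∀ x : sys.X, (fun i => G i x) = Φ x := fun x => funext fun i => by
    rw [hD.map_eq, hGφ]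
  let N' : Set sys.X := {x | (∀ a i, fφ a i x ∈ WQ a i ∧ Φ x ∈ VQ a i) ∧
    ∀ j, hh j x ∈ WP j ∧ Φ x ∈ VP j}
  have hN' : N' ∈ 𝓝 xb := by
    refine (Filter.eventually_all.2 fun a => Filter.eventually_all.2 fun i => ?_).and
      (Filter.eventually_all.2 fun j => ?_)
    · exact ((hC ⟨_, hD.lie_mem a i⟩).continuousAt.eventually
        ((hQ a i).isOpen_W.mem_nhds (hQ a i).mem_W)).and
        (hΦc.continuousAt.eventually ((hQ a i).isOpen_V.mem_nhds (hQ a i).mem_V))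
    · exact ((hC ⟨_, hD.out_mem j⟩).continuousAt.eventually
        ((hP j).isOpen_W.mem_nhds (hP j).mem_W)).and
        (hΦc.continuousAt.eventually ((hP j).isOpen_V.mem_nhds (hP j).mem_V))
  refine ⟨fun x i => G i x, Subtype.val '' N', fun x i => by rw [hGφ], {
    mem_nhds := hsys.isOpen.isOpenMap_subtype_val.image_mem_nhds hN'
    subset := by
      rintro _ ⟨x, -, rfl⟩
      exact x.2
    analytic := fun x hx => analyticAt_pi_iff.2 fun i => hG i x hx
    mapsTo := by
      rintro _ ⟨x, hx, rfl⟩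
      simp only [hGΦ]
      exact ⟨Set.mem_iInter₂.2 fun a i => (hx.1 a i).2, Set.mem_iInter.2 fun j => (hx.2 j).2⟩
    base := hGΦ xb
    map_f := ?_
    map_h := ?_ }⟩
  · rintro a _ ⟨x, hx, rfl⟩
    funext i
    have h1 : HasFDerivAt (fun y i => G i y)
        (ContinuousLinearMap.pi fun i => fderiv ℝ (G i) (x : Fin n → ℝ)) (x : Fin n → ℝ) :=
      hasFDerivAt_pi.2 fun i => (hG i x x.2).differentiableAt.hasFDerivAt
    have h2 : fderiv ℝ (G i) x (sys.f a x) = fφ a i x := by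
      rw [hD.lie_eq, hGφ, lieDeriv_comp_val hsys.isOpen]
    rw [h1.fderiv, hGΦ]
    exact h2.trans (((hQ a i).solves x (hx.1 a i).1 (hx.1 a i).2).1
      ((hD.relation_lie a i).1.2 x))
  · rintro _ ⟨x, hx, rfl⟩
    funext j
    rw [hGΦ, ← hD.out_eq]
    exact ((hP j).solves x (hx.2 j).1 (hx.2 j).2).1 ((hD.relation_out j).1.2 x)

end ControlSystem

end NashSys

end

/-! ### Correctness of the reduction procedure -/

open NashSys

theorem mainTheorem3 {m n r : ℕ} (U : Set (Fin m → ℝ)) (hU : U.Finite)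
    (S : Set (Input U)) (hS : S.Nonempty) (p : Input U → Fin r → ℝ) (hp : IsResponseMap S p)
    (sys : ControlSystem U n r) (hsys : sys.IsLocalNashRealization S p)
    (hreach : sys.IsSemialgebraicallyReachable) :
    -- step 1: a finite transcendence basis of the observation algebra exists
    (∃ (d : ℕ) (φ : Fin d → sys.obsAlgebra), IsTranscendenceBasis ℝ φ) ∧
    -- for every choice of it
    ∀ (d : ℕ) (φ : Fin d → sys.obsAlgebra), IsTranscendenceBasis ℝ φ →
    ∀ (Φ : sys.X → Fin d → ℝ), (∀ x i, Φ x i = (φ i : sys.X → ℝ) x) →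
    ∀ (fφ : U → Fin d → sys.X → ℝ), (∀ a i, fφ a i = sys.lieDeriv a (φ i : sys.X → ℝ)) →
    ∀ (hh : Fin r → sys.X → ℝ), (∀ j x, hh j x = sys.h x j) →
    -- step 2: polynomials of smallest degree exist
    (∃ (Q : U → Fin d → Polynomial (MvPolynomial (Fin d) ℝ))
        (P : Fin r → Polynomial (MvPolynomial (Fin d) ℝ)),
      (∀ a i, IsMinimalRelation Φ (fφ a i) (Q a i)) ∧ ∀ j, IsMinimalRelation Φ (hh j) (P j)) ∧
    -- for every choice of them
    ∀ (Q : U → Fin d → Polynomial (MvPolynomial (Fin d) ℝ))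
      (P : Fin r → Polynomial (MvPolynomial (Fin d) ℝ)),
      (∀ a i, IsMinimalRelation Φ (fφ a i) (Q a i)) → (∀ j, IsMinimalRelation Φ (hh j) (P j)) →
    -- step 3: arbitrarily short inputs leading to a regular state exist
    (∀ ε : ℝ, 0 < ε → ∃ u ∈ S ∩ sys.admissibleInputs, duration u < ε ∧
      ∃ xb : sys.X, sys.Reaches u xb ∧
        (∀ a i, IsRegularAt Φ (fφ a i) (Q a i) xb) ∧ ∀ j, IsRegularAt Φ (hh j) (P j) xb) ∧
    -- for every choice of such an input
    ∀ u ∈ S ∩ sys.admissibleInputs, ∀ xb : sys.X, sys.Reaches u xb →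
      (∀ a i, IsRegularAt Φ (fφ a i) (Q a i) xb) → (∀ j, IsRegularAt Φ (hh j) (P j) xb) →
    -- steps 4 and 5: implicit solutions whose common domain is connected exist
    (∃ (WQ : U → Fin d → Set ℝ) (VQ : U → Fin d → Set (Fin d → ℝ))
        (ψQ : U → Fin d → (Fin d → ℝ) → ℝ)
        (WP : Fin r → Set ℝ) (VP : Fin r → Set (Fin d → ℝ)) (ψP : Fin r → (Fin d → ℝ) → ℝ),
      (∀ a i, IsImplicitSolution Φ (fφ a i) (Q a i) xb (WQ a i) (VQ a i) (ψQ a i)) ∧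
      (∀ j, IsImplicitSolution Φ (hh j) (P j) xb (WP j) (VP j) (ψP j)) ∧
      IsConnected ((⋂ a, ⋂ i, VQ a i) ∩ ⋂ j, VP j)) ∧
    -- step 6: for every choice of them the reduced system has the required properties
    ∀ (WQ : U → Fin d → Set ℝ) (VQ : U → Fin d → Set (Fin d → ℝ))
      (ψQ : U → Fin d → (Fin d → ℝ) → ℝ)
      (WP : Fin r → Set ℝ) (VP : Fin r → Set (Fin d → ℝ)) (ψP : Fin r → (Fin d → ℝ) → ℝ),
      (∀ a i, IsImplicitSolution Φ (fφ a i) (Q a i) xb (WQ a i) (VQ a i) (ψQ a i)) →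
      (∀ j, IsImplicitSolution Φ (hh j) (P j) xb (WP j) (VP j) (ψP j)) →
      IsConnected ((⋂ a, ⋂ i, VQ a i) ∩ ⋂ j, VP j) →
      (reducedSystem VQ VP ψQ ψP (Φ xb)).IsLocalNashRealization (shiftDomain S u) (shift p u) ∧
      (reducedSystem VQ VP ψQ ψP (Φ xb)).IsSemialgebraicallyReachable ∧
      (reducedSystem VQ VP ψQ ψP (Φ xb)).IsSemialgebraicallyObservable := by
  have : Finite U := hU
  have := hsys.1.isDomain
  refine ⟨exists_finite_isTranscendenceBasis hsys.1.isOpen hsys.1.obsAlgebra_le,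
    fun d φ hφ Φ hΦ fφ hfφ hh hhh => ⟨?_, fun Q P hQ hP => ?_⟩⟩
  · obtain rfl := ControlSystem.eq_coe_of_forall_eq hΦ
    obtain rfl := funext fun a => funext (hfφ a)
    obtain rfl := funext fun j => funext (hhh j)
    choose Q hQ using fun a i =>
      exists_isMinimalRelation hφ ⟨_, sys.lieDeriv_mem_obsAlgebra a (φ i).2⟩
    choose P hP using fun j => exists_isMinimalRelation hφ ⟨_, sys.h_mem_obsAlgebra j⟩
    exact ⟨Q, P, hQ, hP⟩
  · have hD : sys.IsReductionData φ Φ fφ hh Q P := ⟨hφ.1, hΦ, hfφ, hhh, hQ, hP⟩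
    refine ⟨fun ε hε => hD.exists_regular_state hsys.1 hreach hp.admissible hS hε,
      fun u hu xb hxb hrQ hrP => ⟨hD.exists_implicit_solutions hrQ hrP,
        fun WQ VQ ψQ WP VP ψP hsQ hsP hc => ?_⟩⟩
    have hred := ControlSystem.isNashSystem_reducedSystem hsQ hsP hc
    obtain ⟨Ψ, N, hΨ, hm⟩ := hD.exists_isLocalMorphism hsys.1 hsQ hsP
    exact ⟨hm.isLocalNashRealization hp hsys hred hu.2 hxb,
      hm.isSemialgebraicallyReachable hsys.1 hred hreach hφ.1 hΨ hu.2 hxb,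
      hm.isSemialgebraicallyObservable hsys.1 hred hφ.1⟩
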